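/- **Theorem 2.5.** Let $k$ be a field. A *weak Hopf algebra* is a $k$-algebra and $k$-coalgebra $(H,\Delta,\varepsilon)$ with $\Delta(gh)=\Delta(g)\Delta(h)$, $\Delta^2(1)=1_1\otimes 1_21_{1'}\otimes 1_{2'}=1_1\otimes 1_{1'}1_2\otimes 1_{2'}$, $\varepsilon(ghl)=\varepsilon(gh_1)\varepsilon(h_2l)=\varepsilon(gh_2)\varepsilon(h_1l)$, and a linear antipode $S$ with $h_1S(h_2)=\varepsilon_t(h):=\varepsilon(1_1h)1_2$, $S(h_1)h_2=\varepsilon_s(h):=1_1\varepsilon(h1_2)$ and $S(h_1)h_2S(h_3)=S(h)$. Put $H_t=\varepsilon_t(H)$, $H_s=\varepsilon_s(H)$. $H$ is *regular* if $S^2(zy)=zy$ for all $z\in H_t$, $y\in H_s$. $(H,R)$ is *quasitriangular* if $S$ is bijective and $R=R^1\otimes R^2\in\Delta^{cop}(1)(H\otimes H)\Delta(1)$ satisfies $(\mathrm{id}\otimes\Delta)R=R_{13}R_{12}$, $(\Delta\otimes\mathrm{id})R=R_{13}R_{23}$, $\Delta^{cop}(h)R=R\Delta(h)$ for all $h\in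 H$, and there is $\overline R\in\Delta(1)(H\otimes H)\Delta^{cop}(1)$ with $R\overline R=\Delta^{cop}(1)$, $\overline RR=\Delta(1)$. The category ${}_H\mathscr M$ of left $H$-modules is monoidal with $M\otimes_tN=\Delta(1)(M\otimes N)$, $h\cdot(m\otimes n)=h_1\cdot m\otimes h_2\cdot n$, unit $H_t$ with $h\cdot z=\varepsilon_t(hz)$, the associativity of $\otimes_k$, and unit constraints $1_1\cdot z\otimes 1_2\cdot m\mapsto z\cdot m$ and $1_1\cdot m\otimes 1_2\cdot z\mapsto S(z)\cdot m$. Write $C(m\otimes n)=R^2\cdot n\otimes R^1\cdot m$. Let ${}_RH=C_H(H_s)$ be the centralizer of $H_s$ in $H$, with the action $h\cdot x=h_1xS(h_2)$, the product $\overline\mu$ of $H$, $\overline\Delta(x)=x_1S(R^2)\otimes R^1\cdot x_2$ and $\overline\varepsilon=\varepsilon_t$. A *left ${}_RH$-comodule* is a left $H$-module $M$ with an $H$-linear map $\rho^l:M\to{}_RH\otimes_tM$, $m\mapsto m_{(-1)}\otimes m_{(0)}$, such that $(\overline\Delta\otimes 1)\rho^l=(1\otimes\rho^l)\rho^l$ and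 $\varepsilon_t(m_{(-1)})\cdot m_{(0)}=m$. Let ${}^{{}_RH}({}_H\mathscr M)$ be the category of these, with the $H$-linear colinear maps; the tensor product is $M\otimes_tN$ with the coaction $(\overline\mu\otimes1\otimes1)(1\otimes C\otimes1)(\rho^l_M\otimes\rho^l_N)$, and the unit object is $H_t$ with the coaction $z\mapsto 1_1\cdot 1\otimes 1_2\cdot z$. A *left Yetter–Drinfeld module* is a left $H$-module $N$ with a left $H$-comodule structure $\rho^L:N\to H\otimes N$, $n\mapsto n_{[-1]}\otimes n_{[0]}$, such that $\rho^L(N)\subseteq H\otimes_tN$ (for left multiplication on $H$) and $\rho^L(h\cdot n)=h_1n_{[-1]}S(h_3)\otimes h_2\cdot n_{[0]}$. Let ${}^H_H\mathscr{YD}$ be the category of these, with the $H$-linear $H$-colinear maps; the tensor product is $M\otimes_tN$ with the coaction $m\otimes n\mapsto m_{[-1]}n_{[-1]}\otimes m_{[0]}\otimes n_{[0]}$, and the unit object is $H_t$ with the coaction $\Delta|_{H_t}$. Let $(H,R)$ be a quasitriangular regular weak Hopf algebra over $k$. Then ${}^{{}_RH}({}_H\mathscr M)$ and ${}^H_H\mathscr{YD}$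 are monoidal categories with the structures just described and the constraints of ${}_H\mathscr M$, and there is a monoidal equivalence $$\mathcal F:{}^{{}_RH}({}_H\mathscr M)\to{}^H_H\mathscr{YD},\quad (M,\rho^l)\mapsto(M,\rho^L),\qquad \rho^L(m)=m_{(-1)}R^2\otimes R^1\cdot m_{(0)},$$ with the monoidal quasi-inverse $$\mathcal G:{}^H_H\mathscr{YD}\to{}^{{}_RH}({}_H\mathscr M),\quad (N,\rho^L)\mapsto(N,\rho^l),\qquad \rho^l(n)=n_{[-1]}S(R^2)\otimes R^1\cdot n_{[0]};$$ both functors are the identity on underlying $H$-modules and on morphisms, and are well defined. -/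

import Mathlib

open scoped TensorProduct

universe u v

namespace WeakHopf

section Maps

variable (k : Type u) (H : Type v) [Field k] [Ring H] [Algebra k H]

/-- The target map `ε_t(h) = ε(1₁h)1₂`. -/
noncomputable def targetMap [CoalgebraStruct k H] : H →ₗ[k] H :=
  (TensorProduct.lid k H).toLinearMap ∘ₗ
    (CoalgebraStruct.counit (R := k) (A := H)).rTensor H ∘ₗ
    LinearMap.mulLeft k (CoalgebraStruct.comul (R := k) (1 : H)) ∘ₗ
    (TensorProduct.mk k H H).flip 1

/-- The source map `ε_s(h) = 1₁ε(h1₂)`. -/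
noncomputable def sourceMap [CoalgebraStruct k H] : H →ₗ[k] H :=
  (TensorProduct.rid k H).toLinearMap ∘ₗ
    (CoalgebraStruct.counit (R := k) (A := H)).lTensor H ∘ₗ
    LinearMap.mulRight k (CoalgebraStruct.comul (R := k) (1 : H)) ∘ₗ
    TensorProduct.mk k H H 1

end Maps

end WeakHopf

open WeakHopf CoalgebraStruct in
/-- A weak Hopf algebra over the field `k`, with its antipode `S` as part of the data. -/
class WeakHopfAlgebra (k : Type u) (H : Type v) [Field k] [Ring H] [Algebra k H]
    extends Coalgebra k H where
  /-- `Δ(gh) = Δ(g)Δ(h)` -/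
  comul_mul : ∀ g h : H, comul (g * h) = comul g * comul h
  /-- `1₁ ⊗ 1₂ ⊗ 1₃ = 1₁ ⊗ 1₂1₁' ⊗ 1₂'` -/
  comul_one : comul.lTensor H (comul (1 : H)) =
    (TensorProduct.assoc k H H H (comul (1 : H) ⊗ₜ[k] (1 : H))) *
      ((1 : H) ⊗ₜ[k] comul (1 : H))
  /-- `1₁ ⊗ 1₂ ⊗ 1₃ = 1₁ ⊗ 1₁'1₂ ⊗ 1₂'` -/
  comul_one' : comul.lTensor H (comul (1 : H)) =
    ((1 : H) ⊗ₜ[k] comul (1 : H)) *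
      (TensorProduct.assoc k H H H (comul (1 : H) ⊗ₜ[k] (1 : H)))
  /-- `ε(ghl) = ε(gh₁)ε(h₂l)` -/
  counit_mul : ∀ g h l : H, counit (g * h * l) =
    LinearMap.mul' k k (TensorProduct.map (counit ∘ₗ LinearMap.mulLeft k g)
      (counit ∘ₗ LinearMap.mulRight k l) (comul h))
  /-- `ε(ghl) = ε(gh₂)ε(h₁l)` -/
  counit_mul' : ∀ g h l : H, counit (g * h * l) =
    LinearMap.mul' k k (TensorProduct.map (counit ∘ₗ LinearMap.mulRight k l)
      (counit ∘ₗ LinearMap.mulLeft k g) (comul h))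
  /-- the antipode `S` -/
  antipode : H →ₗ[k] H
  /-- `h₁S(h₂) = ε_t(h)` -/
  mul_antipode : ∀ h : H,
    LinearMap.mul' k H (antipode.lTensor H (comul h)) = targetMap k H h
  /-- `S(h₁)h₂ = ε_s(h)` -/
  antipode_mul : ∀ h : H,
    LinearMap.mul' k H (antipode.rTensor H (comul h)) = sourceMap k H h
  /-- `S(h₁)h₂S(h₃) = S(h)` -/
  antipode_mul_antipode : ∀ h : H,
    LinearMap.mul' k H (TensorProduct.map antipode
      (LinearMap.mul' k H ∘ₗ antipode.lTensor H ∘ₗ comul) (comul h)) =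
        antipode h

namespace WeakHopf

section Algebra

variable (k : Type u) (H : Type v) [Field k] [Ring H] [Algebra k H] [WeakHopfAlgebra k H]

/-- The comultiplication `Δ`. -/
noncomputable abbrev Δ : H →ₗ[k] H ⊗[k] H := CoalgebraStruct.comul

/-- The counit `ε`. -/
noncomputable abbrev ε : H →ₗ[k] k := CoalgebraStruct.counit

/-- The antipode `S`. -/
noncomputable abbrev S : H →ₗ[k] H := WeakHopfAlgebra.antipode

/-- The target space `H_t`. -/
noncomputable def targetSpace : Submodule k H := LinearMap.range (targetMap k H)

/-- The source space `H_s`. -/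
noncomputable def sourceSpace : Submodule k H := LinearMap.range (sourceMap k H)

/-- `H` is regular: `S²(x) = x` for all `x ∈ H_t H_s`. -/
class Regular : Prop where
  antipode_antipode : ∀ z ∈ targetSpace k H, ∀ y ∈ sourceSpace k H,
    S k H (S k H (z * y)) = z * y

variable {k H}

/-- The multiplication of `H ⊗ H ⊗ H` against the middle counit: `x ⊗ y ⊗ w ↦ ε(y) x ⊗ w`. -/
noncomputable def ctr : H ⊗[k] (H ⊗[k] H) →ₗ[k] H ⊗[k] H :=
  ((TensorProduct.lid k H).toLinearMap ∘ₗ (ε k H).rTensor H).lTensor H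

theorem counit_left (h : H) : TensorProduct.lid k H ((ε k H).rTensor H (Δ k H h)) = h := by
  rw [Coalgebra.rTensor_counit_comul]; simp

theorem counit_right (h : H) : TensorProduct.rid k H ((ε k H).lTensor H (Δ k H h)) = h := by
  rw [Coalgebra.lTensor_counit_comul]; simp

theorem Δ_mul (g h : H) : Δ k H (g * h) = Δ k H g * Δ k H h := WeakHopfAlgebra.comul_mul g h

theorem Δ_one_mul (h : H) : Δ k H 1 * Δ k H h = Δ k H h := by rw [← Δ_mul, one_mul]

theorem Δ_mul_one (h : H) : Δ k H h * Δ k H 1 = Δ k H h := by rw [← Δ_mul, mul_one]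

theorem targetMap_apply (h : H) : targetMap k H h =
    TensorProduct.lid k H ((ε k H).rTensor H (Δ k H 1 * (h ⊗ₜ[k] (1 : H)))) := rfl

theorem sourceMap_apply (h : H) : sourceMap k H h =
    TensorProduct.rid k H ((ε k H).lTensor H (((1 : H) ⊗ₜ[k] h) * Δ k H 1)) := rfl

theorem targetMap_one : targetMap k H 1 = 1 := by
  rw [targetMap_apply, ← Algebra.TensorProduct.one_def, mul_one, counit_left]

theorem sourceMap_one : sourceMap k H 1 = 1 := by
  rw [sourceMap_apply, ← Algebra.TensorProduct.one_def, one_mul, counit_right]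

/-- `ε(gε_t(h)) = ε(gh)` -/
theorem counit_mul_targetMap (g h : H) : ε k H (g * targetMap k H h) = ε k H (g * h) := by
  have h1 := WeakHopfAlgebra.counit_mul' (k := k) g 1 h
  rw [mul_one] at h1
  rw [h1, targetMap_apply]
  change _ = LinearMap.mul' k k (TensorProduct.map _ _ (Δ k H 1))
  induction Δ k H 1 using TensorProduct.induction_on with
  | zero => simp
  | tmul x y => simp
  | add x y hx hy => simp only [add_mul, mul_add, map_add, hx, hy]

/-- `ε(ε_s(g)h) = ε(gh)` -/
theorem counit_sourceMap_mul (g h : H) : ε k H (sourceMap k H g * h) = ε k H (g * h) := by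
  have h1 := WeakHopfAlgebra.counit_mul' (k := k) g 1 h
  rw [mul_one] at h1
  rw [h1, sourceMap_apply]
  change _ = LinearMap.mul' k k (TensorProduct.map _ _ (Δ k H 1))
  induction Δ k H 1 using TensorProduct.induction_on with
  | zero => simp
  | tmul x y => simp [mul_comm]
  | add x y hx hy => simp only [add_mul, mul_add, map_add, hx, hy]

/-- `ε_t(gε_t(h)) = ε_t(gh)` -/
theorem targetMap_mul_targetMap (g h : H) :
    targetMap k H (g * targetMap k H h) = targetMap k H (g * h) := by
  rw [targetMap_apply (g * _), targetMap_apply (g * h)]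
  induction Δ k H 1 using TensorProduct.induction_on with
  | zero => simp
  | tmul x y => simp [← mul_assoc, counit_mul_targetMap]
  | add x y hx hy => simp only [add_mul, map_add, hx, hy]

theorem sourceMap_sourceMap_mul (g h : H) :
    sourceMap k H (sourceMap k H g * h) = sourceMap k H (g * h) := by
  rw [sourceMap_apply (_ * h), sourceMap_apply (g * h)]
  induction Δ k H 1 using TensorProduct.induction_on with
  | zero => simp
  | tmul x y => simp [mul_assoc, counit_sourceMap_mul]
  | add x y hx hy => simp only [mul_add, map_add, hx, hy]

theorem targetMap_targetMap (h : H) : targetMap k H (targetMap k H h) = targetMap k H h := by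
  simpa using targetMap_mul_targetMap (k := k) 1 h

theorem sourceMap_sourceMap (h : H) : sourceMap k H (sourceMap k H h) = sourceMap k H h := by
  simpa using sourceMap_sourceMap_mul (k := k) h 1

theorem lTensor_Δ_mul (x y : H ⊗[k] H) :
    (Δ k H).lTensor H (x * y) = (Δ k H).lTensor H x * (Δ k H).lTensor H y := by
  induction x using TensorProduct.induction_on with
  | zero => simp
  | add x x' hx hx' => simp only [add_mul, map_add, hx, hx']
  | tmul a b =>
    induction y using TensorProduct.induction_on with
    | zero => simp
    | add y y' hy hy' => simp only [mul_add, map_add, hy, hy']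
    | tmul c d => simp [Δ_mul]

theorem assoc_mul (x y : (H ⊗[k] H) ⊗[k] H) :
    TensorProduct.assoc k H H H (x * y) =
      TensorProduct.assoc k H H H x * TensorProduct.assoc k H H H y :=
  map_mul (Algebra.TensorProduct.assoc k k k H H H) x y

theorem coassoc' (h : H) : TensorProduct.assoc k H H H ((Δ k H).rTensor H (Δ k H h)) =
    (Δ k H).lTensor H (Δ k H h) := Coalgebra.coassoc_apply h

theorem rTensor_Δ_mul (x y : H ⊗[k] H) :
    (Δ k H).rTensor H (x * y) = (Δ k H).rTensor H x * (Δ k H).rTensor H y := by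
  induction x using TensorProduct.induction_on with
  | zero => simp
  | add x x' hx hx' => simp only [add_mul, map_add, hx, hx']
  | tmul a b =>
    induction y using TensorProduct.induction_on with
    | zero => simp
    | add y y' hy hy' => simp only [mul_add, map_add, hy, hy']
    | tmul c d => simp [Δ_mul]

/-- `h₁ ⊗ ε_t(h₂) = 1₁h ⊗ 1₂` -/
theorem lTensor_targetMap (h : H) :
    (targetMap k H).lTensor H (Δ k H h) = Δ k H 1 * (h ⊗ₜ[k] (1 : H)) := by
  have e1 : ∀ D : H ⊗[k] H, (targetMap k H).lTensor H D =
      ctr (((1 : H) ⊗ₜ[k] Δ k H 1) * TensorProduct.assoc k H H H (D ⊗ₜ[k] (1 : H))) := by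
    intro D
    induction D using TensorProduct.induction_on with
    | zero => simp
    | tmul x y => simp [ctr, targetMap_apply]
    | add x y hx hy => simp only [map_add, TensorProduct.add_tmul, mul_add, hx, hy]
  have e2 : ∀ D : H ⊗[k] H, ctr (TensorProduct.assoc k H H H ((Δ k H).rTensor H D)) = D := by
    intro D
    induction D using TensorProduct.induction_on with
    | zero => simp
    | add x y hx hy => simp only [map_add, hx, hy]
    | tmul x y =>
      have : ∀ E : H ⊗[k] H, ctr (TensorProduct.assoc k H H H (E ⊗ₜ[k] y)) =
          (TensorProduct.rid k H ((ε k H).lTensor H E)) ⊗ₜ[k] y := by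
        intro E
        induction E using TensorProduct.induction_on with
        | zero => simp
        | add x y hx hy => simp only [map_add, TensorProduct.add_tmul, hx, hy]
        | tmul a b => simp [ctr, TensorProduct.smul_tmul]
      rw [LinearMap.rTensor_tmul, this, counit_right]
  have e3 : TensorProduct.assoc k H H H (Δ k H h ⊗ₜ[k] (1 : H)) =
      TensorProduct.assoc k H H H (Δ k H 1 ⊗ₜ[k] (1 : H)) *
        TensorProduct.assoc k H H H (Δ k H h ⊗ₜ[k] (1 : H)) := by
    rw [← assoc_mul]; simp [Δ_one_mul]
  rw [e1, e3, ← mul_assoc]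
  have := WeakHopfAlgebra.comul_one' (k := k) (H := H)
  change (Δ k H).lTensor H (Δ k H 1) = _ at this
  rw [← this, ← coassoc', ← assoc_mul]
  have e5 : (Δ k H).rTensor H (Δ k H 1) * (Δ k H h ⊗ₜ[k] (1 : H)) =
      (Δ k H).rTensor H (Δ k H 1 * (h ⊗ₜ[k] (1 : H))) := by
    induction Δ k H 1 using TensorProduct.induction_on with
    | zero => simp
    | add x y hx hy => simp only [map_add, add_mul, hx, hy]
    | tmul x y => simp [Δ_mul]
  rw [e5, e2]

/-- `ε_s(h₁) ⊗ h₂ = 1₁ ⊗ h1₂` -/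
theorem rTensor_sourceMap (h : H) :
    (sourceMap k H).rTensor H (Δ k H h) = ((1 : H) ⊗ₜ[k] h) * Δ k H 1 := by
  have e1 : ∀ D : H ⊗[k] H, (sourceMap k H).rTensor H D =
      ctr (((1 : H) ⊗ₜ[k] D) * TensorProduct.assoc k H H H (Δ k H 1 ⊗ₜ[k] (1 : H))) := by
    intro D
    induction D using TensorProduct.induction_on with
    | zero => simp
    | tmul x y =>
      simp only [LinearMap.rTensor_tmul, sourceMap_apply]
      induction Δ k H 1 using TensorProduct.induction_on with
      | zero => simp
      | tmul a b => simp [ctr, TensorProduct.smul_tmul]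
      | add x y hx hy => simp only [map_add, TensorProduct.add_tmul, mul_add, hx, hy]
    | add x y hx hy => simp only [map_add, TensorProduct.tmul_add, add_mul, hx, hy]
  have e2 : ∀ D : H ⊗[k] H, ctr ((Δ k H).lTensor H D) = D := by
    intro D
    induction D using TensorProduct.induction_on with
    | zero => simp
    | add x y hx hy => simp only [map_add, hx, hy]
    | tmul x y => simp [ctr]
  have e3 : (1 : H) ⊗ₜ[k] Δ k H h = ((1 : H) ⊗ₜ[k] Δ k H h) * ((1 : H) ⊗ₜ[k] Δ k H 1) := by
    simp [Δ_mul_one]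
  rw [e1, e3, mul_assoc]
  have := WeakHopfAlgebra.comul_one' (k := k) (H := H)
  change (Δ k H).lTensor H (Δ k H 1) = _ at this
  rw [← this]
  have e5 : ((1 : H) ⊗ₜ[k] Δ k H h) * (Δ k H).lTensor H (Δ k H 1) =
      (Δ k H).lTensor H (((1 : H) ⊗ₜ[k] h) * Δ k H 1) := by
    induction Δ k H 1 using TensorProduct.induction_on with
    | zero => simp
    | add x y hx hy => simp only [map_add, mul_add, hx, hy]
    | tmul x y => simp [Δ_mul]
  rw [e5, e2]

theorem targetMap_contract (h : H) (D E : H ⊗[k] H) :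
    (TensorProduct.lid k (H ⊗[k] H)) ((ε k H ∘ₗ LinearMap.mulRight k h).rTensor (H ⊗[k] H)
      (TensorProduct.assoc k H H H (D ⊗ₜ[k] (1 : H)) * ((1 : H) ⊗ₜ[k] E))) =
    ((TensorProduct.lid k H ((ε k H).rTensor H (D * (h ⊗ₜ[k] (1 : H))))) ⊗ₜ[k] (1 : H)) * E := by
  induction D using TensorProduct.induction_on with
  | zero => simp
  | add x y hx hy => simp only [map_add, TensorProduct.add_tmul, add_mul, hx, hy]
  | tmul a b => 
    simp only [TensorProduct.assoc_tmul, Algebra.TensorProduct.tmul_mul_tmul, mul_one,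
      LinearMap.rTensor_tmul, LinearMap.comp_apply, LinearMap.mulRight_apply,
      TensorProduct.lid_tmul, ← TensorProduct.smul_tmul', smul_mul_assoc]

theorem targetMap_contract' (h : H) (D E : H ⊗[k] H) :
    (TensorProduct.lid k (H ⊗[k] H)) ((ε k H ∘ₗ LinearMap.mulRight k h).rTensor (H ⊗[k] H)
      (((1 : H) ⊗ₜ[k] E) * TensorProduct.assoc k H H H (D ⊗ₜ[k] (1 : H)))) =
    E * ((TensorProduct.lid k H ((ε k H).rTensor H (D * (h ⊗ₜ[k] (1 : H))))) ⊗ₜ[k] (1 : H)) := by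
  induction D using TensorProduct.induction_on with
  | zero => simp
  | add x y hx hy => simp only [map_add, TensorProduct.add_tmul, mul_add, add_mul, hx, hy]
  | tmul a b => 
    simp only [TensorProduct.assoc_tmul, Algebra.TensorProduct.tmul_mul_tmul, one_mul, mul_one,
      LinearMap.rTensor_tmul, LinearMap.comp_apply, LinearMap.mulRight_apply,
      TensorProduct.lid_tmul, ← TensorProduct.smul_tmul', mul_smul_comm]

theorem targetMap_contract_Δ (h : H) (D : H ⊗[k] H) :
    (TensorProduct.lid k (H ⊗[k] H)) ((ε k H ∘ₗ LinearMap.mulRight k h).rTensor (H ⊗[k] H)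
      ((Δ k H).lTensor H D)) =
    Δ k H (TensorProduct.lid k H ((ε k H).rTensor H (D * (h ⊗ₜ[k] (1 : H))))) := by
  induction D using TensorProduct.induction_on with
  | zero => simp
  | add x y hx hy => simp only [map_add, add_mul, hx, hy]
  | tmul a b => simp

/-- `Δ(z) = z1₁ ⊗ 1₂` on the target space -/
theorem Δ_targetMap (h : H) : Δ k H (targetMap k H h) =
    (targetMap k H h ⊗ₜ[k] (1 : H)) * Δ k H 1 := by
  have := WeakHopfAlgebra.comul_one (k := k) (H := H)
  change (Δ k H).lTensor H (Δ k H 1) = _ at this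
  rw [targetMap_apply, ← targetMap_contract_Δ, this, targetMap_contract]

/-- `Δ(z) = 1₁z ⊗ 1₂` on the target space -/
theorem Δ_targetMap' (h : H) : Δ k H (targetMap k H h) =
    Δ k H 1 * (targetMap k H h ⊗ₜ[k] (1 : H)) := by
  have := WeakHopfAlgebra.comul_one' (k := k) (H := H)
  change (Δ k H).lTensor H (Δ k H 1) = _ at this
  rw [targetMap_apply, ← targetMap_contract_Δ, this, targetMap_contract']

theorem sourceMap_contract (h : H) (D E : H ⊗[k] H) :
    ((TensorProduct.rid k (H ⊗[k] H)) ((ε k H ∘ₗ LinearMap.mulLeft k h).lTensor (H ⊗[k] H)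
      ((TensorProduct.assoc k H H H).symm (
      (((1 : H) ⊗ₜ[k] E) * TensorProduct.assoc k H H H (D ⊗ₜ[k] (1 : H))))))) =
    ((1 : H) ⊗ₜ[k] (TensorProduct.rid k H ((ε k H).lTensor H (((1 : H) ⊗ₜ[k] h) * E)))) * D := by
  induction D using TensorProduct.induction_on with
  | zero => simp
  | add x y hx hy => simp only [map_add, TensorProduct.add_tmul, mul_add, add_mul, hx, hy]
  | tmul a b =>
    induction E using TensorProduct.induction_on with
    | zero => simp
    | add x y hx hy => simp only [map_add, TensorProduct.tmul_add, mul_add, add_mul, hx, hy]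
    | tmul c d => simp

theorem sourceMap_contract' (h : H) (D E : H ⊗[k] H) :
    ((TensorProduct.rid k (H ⊗[k] H)) ((ε k H ∘ₗ LinearMap.mulLeft k h).lTensor (H ⊗[k] H)
      ((TensorProduct.assoc k H H H).symm (
      (TensorProduct.assoc k H H H (D ⊗ₜ[k] (1 : H)) * ((1 : H) ⊗ₜ[k] E)))))) =
    D * ((1 : H) ⊗ₜ[k] (TensorProduct.rid k H ((ε k H).lTensor H (((1 : H) ⊗ₜ[k] h) * E)))) := by
  induction D using TensorProduct.induction_on with
  | zero => simp
  | add x y hx hy => simp only [map_add, TensorProduct.add_tmul, mul_add, add_mul, hx, hy]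
  | tmul a b =>
    induction E using TensorProduct.induction_on with
    | zero => simp
    | add x y hx hy => simp only [map_add, TensorProduct.tmul_add, mul_add, add_mul, hx, hy]
    | tmul c d => simp

theorem sourceMap_contract_Δ (h : H) (D : H ⊗[k] H) :
    (TensorProduct.rid k (H ⊗[k] H)) ((ε k H ∘ₗ LinearMap.mulLeft k h).lTensor (H ⊗[k] H)
      ((Δ k H).rTensor H D)) =
    Δ k H (TensorProduct.rid k H ((ε k H).lTensor H (((1 : H) ⊗ₜ[k] h) * D))) := by
  induction D using TensorProduct.induction_on with
  | zero => simp
  | add x y hx hy => simp only [map_add, mul_add, hx, hy]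
  | tmul a b => simp

/-- `Δ(y) = 1₁ ⊗ y1₂` on the source space -/
theorem Δ_sourceMap (h : H) : Δ k H (sourceMap k H h) =
    ((1 : H) ⊗ₜ[k] sourceMap k H h) * Δ k H 1 := by
  have := WeakHopfAlgebra.comul_one' (k := k) (H := H)
  change (Δ k H).lTensor H (Δ k H 1) = _ at this
  rw [← coassoc', ← LinearEquiv.eq_symm_apply] at this
  rw [sourceMap_apply, ← sourceMap_contract_Δ, this, sourceMap_contract]

/-- `Δ(y) = 1₁ ⊗ 1₂y` on the source space -/
theorem Δ_sourceMap' (h : H) : Δ k H (sourceMap k H h) =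
    Δ k H 1 * ((1 : H) ⊗ₜ[k] sourceMap k H h) := by
  have := WeakHopfAlgebra.comul_one (k := k) (H := H)
  change (Δ k H).lTensor H (Δ k H 1) = _ at this
  rw [← coassoc', ← LinearEquiv.eq_symm_apply] at this
  rw [sourceMap_apply, ← sourceMap_contract_Δ, this, sourceMap_contract']

theorem targetMap_comm_sourceMap (g h : H) :
    targetMap k H h * sourceMap k H g = sourceMap k H g * targetMap k H h := by
  have e := (Δ_targetMap (k := k) h).symm.trans (Δ_targetMap' h)
  have e' := congrArg (fun x => TensorProduct.rid k H
    ((ε k H ∘ₗ LinearMap.mulLeft k g).lTensor H x)) e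
  have a1 : ∀ (z : H) (D : H ⊗[k] H), TensorProduct.rid k H ((ε k H ∘ₗ LinearMap.mulLeft k g).lTensor H
      ((z ⊗ₜ[k] (1 : H)) * D)) =
      z * TensorProduct.rid k H ((ε k H).lTensor H (((1 : H) ⊗ₜ[k] g) * D)) := by
    intro z D
    induction D using TensorProduct.induction_on with
    | zero => simp
    | add x y hx hy => simp only [map_add, mul_add, hx, hy]
    | tmul a b => simp
  have a2 : ∀ (z : H) (D : H ⊗[k] H), TensorProduct.rid k H ((ε k H ∘ₗ LinearMap.mulLeft k g).lTensor H
      (D * (z ⊗ₜ[k] (1 : H)))) =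
      TensorProduct.rid k H ((ε k H).lTensor H (((1 : H) ⊗ₜ[k] g) * D)) * z := by
    intro z D
    induction D using TensorProduct.induction_on with
    | zero => simp
    | add x y hx hy => simp only [map_add, mul_add, add_mul, hx, hy]
    | tmul a b => simp
  simpa only [a1, a2, ← sourceMap_apply] using e'

end Algebra

end WeakHopf

namespace WeakHopf
section Algebra2
variable {k : Type u} {H : Type v} [Field k] [Ring H] [Algebra k H] [WeakHopfAlgebra k H]

theorem lTensor_targetMap_one : (targetMap k H).lTensor H (Δ k H 1) = Δ k H 1 := by
  rw [lTensor_targetMap, ← Algebra.TensorProduct.one_def, mul_one]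

theorem rTensor_sourceMap_one : (sourceMap k H).rTensor H (Δ k H 1) = Δ k H 1 := by
  rw [rTensor_sourceMap, ← Algebra.TensorProduct.one_def, one_mul]

theorem mul_S (h : H) : LinearMap.mul' k H ((S k H).lTensor H (Δ k H h)) = targetMap k H h :=
  WeakHopfAlgebra.mul_antipode h

theorem S_mul (h : H) : LinearMap.mul' k H ((S k H).rTensor H (Δ k H h)) = sourceMap k H h :=
  WeakHopfAlgebra.antipode_mul h

/-- `ε_t(zh) = zε_t(h)` for `z` in the target space -/
theorem targetMap_targetMap_mul (g h : H) :
    targetMap k H (targetMap k H g * h) = targetMap k H g * targetMap k H h := by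
  rw [← mul_S, ← mul_S h, Δ_mul, Δ_targetMap, mul_assoc, Δ_one_mul]
  induction Δ k H h using TensorProduct.induction_on with
  | zero => simp
  | add x y hx hy => simp only [map_add, mul_add, hx, hy]
  | tmul a b => simp [mul_assoc]

/-- `ε_s(hy) = ε_s(h)y` for `y` in the source space -/
theorem sourceMap_mul_sourceMap (g h : H) :
    sourceMap k H (h * sourceMap k H g) = sourceMap k H h * sourceMap k H g := by
  rw [← S_mul, ← S_mul h, Δ_mul, Δ_sourceMap', ← mul_assoc, Δ_mul_one]
  induction Δ k H h using TensorProduct.induction_on with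
  | zero => simp
  | add x y hx hy => simp only [map_add, add_mul, hx, hy]
  | tmul a b => simp [mul_assoc]

theorem S_mul_targetMap (h : H) :
    LinearMap.mul' k H (TensorProduct.map (S k H) (targetMap k H) (Δ k H h)) = S k H h := by
  have e : LinearMap.mul' k H ∘ₗ (S k H).lTensor H ∘ₗ Δ k H = targetMap k H := by
    ext x; exact mul_S x
  rw [← e]
  exact WeakHopfAlgebra.antipode_mul_antipode h

theorem sourceMap_mul_S (h : H) :
    LinearMap.mul' k H (TensorProduct.map (sourceMap k H) (S k H) (Δ k H h)) = S k H h := by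
  have e : LinearMap.mul' k H ∘ₗ (S k H).rTensor H ∘ₗ Δ k H = sourceMap k H := by
    ext x; exact S_mul x
  have e' : LinearMap.mul' k H ∘ₗ (S k H).lTensor H ∘ₗ Δ k H = targetMap k H := by
    ext x; exact mul_S x
  rw [← S_mul_targetMap, ← e, ← e']
  have a1 : ∀ D : H ⊗[k] H, LinearMap.mul' k H (TensorProduct.map
      (LinearMap.mul' k H ∘ₗ (S k H).rTensor H ∘ₗ Δ k H) (S k H) D) =
      LinearMap.mul' k H ((LinearMap.mul' k H).lTensor H
        (TensorProduct.map (S k H) ((S k H).lTensor H)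
          (TensorProduct.assoc k H H H ((Δ k H).rTensor H D)))) := by
    intro D
    induction D using TensorProduct.induction_on with
    | zero => simp
    | add x y hx hy => simp only [map_add, hx, hy]
    | tmul a b =>
      simp only [TensorProduct.map_tmul, LinearMap.rTensor_tmul, LinearMap.comp_apply]
      induction Δ k H a using TensorProduct.induction_on with
      | zero => simp
      | add x y hx hy => simp only [map_add, TensorProduct.add_tmul, hx, hy]
      | tmul c d => simp [mul_assoc]
  have a2 : ∀ D : H ⊗[k] H, LinearMap.mul' k H (TensorProduct.map (S k H)
      (LinearMap.mul' k H ∘ₗ (S k H).lTensor H ∘ₗ Δ k H) D) =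
      LinearMap.mul' k H ((LinearMap.mul' k H).lTensor H
        (TensorProduct.map (S k H) ((S k H).lTensor H) ((Δ k H).lTensor H D))) := by
    intro D
    induction D using TensorProduct.induction_on with
    | zero => simp
    | add x y hx hy => simp only [map_add, hx, hy]
    | tmul a b => simp
  rw [a1, a2, coassoc']

theorem S_targetMap (g : H) : S k H (targetMap k H g) = sourceMap k H (targetMap k H g) := by
  rw [← S_mul_targetMap, ← S_mul, Δ_targetMap]
  congr 1
  have : ∀ D : H ⊗[k] H, TensorProduct.map (S k H) (targetMap k H)
      ((targetMap k H g ⊗ₜ[k] (1 : H)) * D) =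
      (S k H).rTensor H ((targetMap k H g ⊗ₜ[k] (1 : H)) * (targetMap k H).lTensor H D) := by
    intro D
    induction D using TensorProduct.induction_on with
    | zero => simp
    | add x y hx hy => simp only [map_add, mul_add, hx, hy]
    | tmul a b => simp
  rw [this, lTensor_targetMap_one]

theorem S_sourceMap (g : H) : S k H (sourceMap k H g) = targetMap k H (sourceMap k H g) := by
  rw [← sourceMap_mul_S, ← mul_S, Δ_sourceMap]
  congr 1
  have : ∀ D : H ⊗[k] H, TensorProduct.map (sourceMap k H) (S k H)
      (((1 : H) ⊗ₜ[k] sourceMap k H g) * D) =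
      (S k H).lTensor H (((1 : H) ⊗ₜ[k] sourceMap k H g) * (sourceMap k H).rTensor H D) := by
    intro D
    induction D using TensorProduct.induction_on with
    | zero => simp
    | add x y hx hy => simp only [map_add, mul_add, hx, hy]
    | tmul a b => simp
  rw [this, rTensor_sourceMap_one]

theorem targetMap_sourceMap_targetMap [Regular k H] (g : H) :
    targetMap k H (sourceMap k H (targetMap k H g)) = targetMap k H g := by
  rw [← S_sourceMap, ← S_targetMap]
  simpa using Regular.antipode_antipode (k := k) (targetMap k H g) ⟨g, rfl⟩ 1
    ⟨1, sourceMap_one⟩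

theorem sourceMap_targetMap_sourceMap [Regular k H] (g : H) :
    sourceMap k H (targetMap k H (sourceMap k H g)) = sourceMap k H g := by
  rw [← S_targetMap, ← S_sourceMap]
  simpa using Regular.antipode_antipode (k := k) 1 ⟨1, targetMap_one⟩ (sourceMap k H g) ⟨g, rfl⟩

/-- `ε_t(h₁)h₂ = h` -/
theorem targetMap_mul_self (h : H) :
    LinearMap.mul' k H ((targetMap k H).rTensor H (Δ k H h)) = h := by
  have : ∀ D : H ⊗[k] H, LinearMap.mul' k H ((targetMap k H).rTensor H D) =
      TensorProduct.lid k H ((ε k H).rTensor H (Δ k H 1 * D)) := by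
    intro D
    induction D using TensorProduct.induction_on with
    | zero => simp
    | add x y hx hy => simp only [map_add, mul_add, hx, hy]
    | tmul a b =>
      simp only [LinearMap.rTensor_tmul, LinearMap.mul'_apply, targetMap_apply]
      induction Δ k H 1 using TensorProduct.induction_on with
      | zero => simp
      | add x y hx hy => simp only [map_add, add_mul, hx, hy]
      | tmul c d => simp
  rw [this, Δ_one_mul, counit_left]

theorem counit_mul_contract (g h : H) :
    TensorProduct.lid k H ((ε k H ∘ₗ LinearMap.mulLeft k g).rTensor H (Δ k H h)) =
    TensorProduct.lid k H ((ε k H ∘ₗ LinearMap.mulLeft k g).rTensor H (Δ k H 1)) * h := by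
  let K : H ⊗[k] H → H ⊗[k] (H ⊗[k] H) →ₗ[k] H := fun E =>
    (TensorProduct.lid k H).toLinearMap ∘ₗ TensorProduct.map (ε k H ∘ₗ LinearMap.mulLeft k g)
      ((TensorProduct.lid k H).toLinearMap ∘ₗ (ε k H).rTensor H ∘ₗ LinearMap.mulRight k E)
  have a1 : ∀ D E : H ⊗[k] H, K E (TensorProduct.assoc k H H H ((Δ k H).rTensor H D)) =
      TensorProduct.lid k H ((ε k H ∘ₗ LinearMap.mulLeft k g).rTensor H (D * E)) := by
    intro D E
    induction D using TensorProduct.induction_on with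
    | zero => simp
    | add x y hx hy => simp only [map_add, add_mul, hx, hy]
    | tmul a b =>
      induction E using TensorProduct.induction_on with
      | zero => simp [K]
      | add x y hx hy =>
        simp only [map_add, mul_add, ← hx, ← hy]
        have : ∀ T, K (x + y) T = K x T + K y T := by
          intro T
          have : LinearMap.mulRight k (x + y) = LinearMap.mulRight k x + LinearMap.mulRight k y := by
            ext <;> simp [mul_add]
          simp only [K, this, LinearMap.comp_add, TensorProduct.map_add_right, LinearMap.add_apply]
        exact this _
      | tmul c d =>
        have := WeakHopfAlgebra.counit_mul (k := k) g a c
        simp only [Algebra.TensorProduct.tmul_mul_tmul, LinearMap.rTensor_tmul,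
          LinearMap.comp_apply, LinearMap.mulLeft_apply, TensorProduct.lid_tmul, ← mul_assoc]
        change _ = (ε k H (g * a * c)) • _
        rw [this]
        change _ = (LinearMap.mul' k k (TensorProduct.map _ _ (Δ k H a))) • _
        induction Δ k H a using TensorProduct.induction_on with
        | zero => simp
        | add x y hx hy => simp only [map_add, TensorProduct.add_tmul, add_smul, hx, hy]
        | tmul p q => simp [K, smul_smul, mul_comm]
  have a2 : ∀ D : H ⊗[k] H, K (Δ k H h) ((Δ k H).lTensor H D) =
      TensorProduct.lid k H ((ε k H ∘ₗ LinearMap.mulLeft k g).rTensor H D) * h := by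
    intro D
    induction D using TensorProduct.induction_on with
    | zero => simp
    | add x y hx hy => simp only [map_add, add_mul, hx, hy]
    | tmul a b => 
      simp [K, ← Δ_mul]
  rw [← a2, ← coassoc', a1, Δ_one_mul]

/-- `ε_t(h₁) ⊗ h₂ = ε_t(1₁) ⊗ 1₂h` -/
theorem rTensor_targetMap (h : H) : (targetMap k H).rTensor H (Δ k H h) =
    (targetMap k H).rTensor H (Δ k H 1) * ((1 : H) ⊗ₜ[k] h) := by
  let T : H ⊗[k] H → H →ₗ[k] H := fun F => (TensorProduct.lid k H).toLinearMap ∘ₗ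
    (ε k H).rTensor H ∘ₗ LinearMap.mulLeft k F ∘ₗ (TensorProduct.mk k H H).flip 1
  have key : ∀ F : H ⊗[k] H, (T F).rTensor H (Δ k H h) =
      (T F).rTensor H (Δ k H 1) * ((1 : H) ⊗ₜ[k] h) := by
    intro F
    induction F using TensorProduct.induction_on with
    | zero =>
      have : T 0 = 0 := by ext; simp [T]
      simp [this]
    | add x y hx hy =>
      have : T (x + y) = T x + T y := by ext; simp [T, add_mul]
      simp only [this, LinearMap.rTensor_add, LinearMap.add_apply, add_mul, hx, hy]
    | tmul p q =>
      have : ∀ D : H ⊗[k] H, (T (p ⊗ₜ[k] q)).rTensor H D = q ⊗ₜ[k]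
          TensorProduct.lid k H ((ε k H ∘ₗ LinearMap.mulLeft k p).rTensor H D) := by
        intro D
        induction D using TensorProduct.induction_on with
        | zero => simp
        | add x y hx hy => simp only [map_add, TensorProduct.tmul_add, hx, hy]
        | tmul a b => simp [T, TensorProduct.smul_tmul]
      rw [this, this, counit_mul_contract]
      simp
  exact key (Δ k H 1)

/-- `ε_s(1₂)1₁ = 1` in the regular case -/
theorem sourceMap_cop_one [Regular k H] :
    LinearMap.mul' k H (TensorProduct.comm k H H ((sourceMap k H).lTensor H (Δ k H 1))) = 1 := by
  have e1 : TensorProduct.map (sourceMap k H) (targetMap k H) (Δ k H 1) = Δ k H 1 := by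
    have := lTensor_targetMap_one (k := k) (H := H)
    rw [← rTensor_sourceMap_one, ← LinearMap.comp_apply, LinearMap.lTensor_comp_rTensor] at this
    rw [this, rTensor_sourceMap_one]
  have e2 : ∀ D : H ⊗[k] H, targetMap k H (LinearMap.mul' k H (TensorProduct.comm k H H
      ((sourceMap k H).lTensor H ((sourceMap k H).rTensor H D)))) =
      LinearMap.mul' k H (TensorProduct.map (targetMap k H ∘ₗ sourceMap k H)
        (targetMap k H ∘ₗ sourceMap k H) D) := by
    intro D
    induction D using TensorProduct.induction_on with
    | zero => simp
    | add x y hx hy => simp only [map_add, hx, hy]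
    | tmul a b =>
      simp only [LinearMap.rTensor_tmul, LinearMap.lTensor_tmul, TensorProduct.comm_tmul,
        LinearMap.mul'_apply, TensorProduct.map_tmul, LinearMap.comp_apply]
      rw [← targetMap_mul_targetMap, ← targetMap_comm_sourceMap, targetMap_targetMap_mul]
  have e3 : ∀ D : H ⊗[k] H, LinearMap.mul' k H (TensorProduct.map (targetMap k H ∘ₗ sourceMap k H)
      (targetMap k H ∘ₗ sourceMap k H) (TensorProduct.map (sourceMap k H) (targetMap k H) D)) =
      LinearMap.mul' k H ((targetMap k H).rTensor H
        (TensorProduct.map (sourceMap k H) (targetMap k H) D)) := by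
    intro D
    induction D using TensorProduct.induction_on with
    | zero => simp
    | add x y hx hy => simp only [map_add, hx, hy]
    | tmul a b => simp [sourceMap_sourceMap, targetMap_sourceMap_targetMap]
  have e4 : ∀ D : H ⊗[k] H, ∃ g, LinearMap.mul' k H (TensorProduct.comm k H H
      ((sourceMap k H).lTensor H ((sourceMap k H).rTensor H D))) = sourceMap k H g := by
    intro D
    induction D using TensorProduct.induction_on with
    | zero => exact ⟨0, by simp⟩
    | add x y hx hy =>
      obtain ⟨a, ha⟩ := hx
      obtain ⟨b, hb⟩ := hy
      exact ⟨a + b, by simp only [map_add, ha, hb]⟩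
    | tmul a b => exact ⟨b * sourceMap k H a, by simp [sourceMap_mul_sourceMap]⟩
  have t1 := e2 (Δ k H 1)
  rw [← e1, e3, e1, targetMap_mul_self, rTensor_sourceMap_one] at t1
  obtain ⟨g, hg⟩ := e4 (Δ k H 1)
  rw [rTensor_sourceMap_one] at hg
  rw [hg] at t1 ⊢
  rw [← sourceMap_targetMap_sourceMap, t1, sourceMap_one]

end Algebra2
end WeakHopf

namespace WeakHopf

section Act
variable {k : Type u} [Field k]

/-- For families `f a`, `g b` of endomorphisms of `M` and `N`, the family of endomorphisms of
`M ⊗ N` with `a ⊗ b ↦ f a ⊗ g b`. -/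
noncomputable def act₂ {A B M N : Type*} [AddCommGroup A] [Module k A] [AddCommGroup B]
    [Module k B] [AddCommGroup M] [Module k M] [AddCommGroup N] [Module k N]
    (f : A →ₗ[k] Module.End k M) (g : B →ₗ[k] Module.End k N) :
    A ⊗[k] B →ₗ[k] Module.End k (M ⊗[k] N) :=
  TensorProduct.homTensorHomMap (RingHom.id k) M N M N ∘ₗ TensorProduct.map f g

@[simp] theorem act₂_tmul {A B M N : Type*} [AddCommGroup A] [Module k A] [AddCommGroup B]
    [Module k B] [AddCommGroup M] [Module k M] [AddCommGroup N] [Module k N]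
    (f : A →ₗ[k] Module.End k M) (g : B →ₗ[k] Module.End k N) (a : A) (b : B) :
    act₂ f g (a ⊗ₜ[k] b) = TensorProduct.map (f a) (g b) := by
  simp [act₂]

end Act

section Tensor
variable (k : Type u) (H : Type v) [Field k] [Ring H] [Algebra k H]

/-- The action of `H` on an `H`-module as a linear map. -/
noncomputable abbrev lsm (M : Type*) [AddCommGroup M] [Module k M] [Module H M]
    [IsScalarTower k H M] : H →ₗ[k] Module.End k M := (Algebra.lsmul k k M).toLinearMap

/-- The action of `H ⊗ H` on `M ⊗ N`. -/
noncomputable abbrev dact (M N : Type*) [AddCommGroup M] [Module k M] [Module H M]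
    [IsScalarTower k H M] [AddCommGroup N] [Module k N] [Module H N] [IsScalarTower k H N] :
    H ⊗[k] H →ₗ[k] Module.End k (M ⊗[k] N) := act₂ (lsm k H M) (lsm k H N)

variable {k H}
variable {M N P Q : Type*} [AddCommGroup M] [Module k M] [Module H M] [IsScalarTower k H M]
  [AddCommGroup N] [Module k N] [Module H N] [IsScalarTower k H N]
  [AddCommGroup P] [Module k P] [Module H P] [IsScalarTower k H P]
  [AddCommGroup Q] [Module k Q] [Module H Q] [IsScalarTower k H Q]

theorem dact_mul (x y : H ⊗[k] H) (t : M ⊗[k] N) :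
    dact k H M N (x * y) t = dact k H M N x (dact k H M N y t) := by
  induction x using TensorProduct.induction_on with
  | zero => simp
  | add x x' hx hx' => simp only [add_mul, map_add, LinearMap.add_apply, hx, hx']
  | tmul a b =>
    induction y using TensorProduct.induction_on with
    | zero => simp
    | add y y' hy hy' => simp only [mul_add, map_add, LinearMap.add_apply, hy, hy']
    | tmul c d =>
      induction t using TensorProduct.induction_on with
      | zero => simp
      | add y y' hy hy' => simp only [map_add, hy, hy']
      | tmul m n => simp [mul_smul]

theorem map_dact (f : M →ₗ[H] P) (g : N →ₗ[H] Q) (x : H ⊗[k] H) (t : M ⊗[k] N) :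
    TensorProduct.map (f.restrictScalars k) (g.restrictScalars k) (dact k H M N x t) =
    dact k H P Q x (TensorProduct.map (f.restrictScalars k) (g.restrictScalars k) t) := by
  induction x using TensorProduct.induction_on with
  | zero => simp
  | add x x' hx hx' => simp only [map_add, LinearMap.add_apply, hx, hx']
  | tmul a b =>
    induction t using TensorProduct.induction_on with
    | zero => simp
    | add y y' hy hy' => simp only [map_add, hy, hy']
    | tmul m n => simp

variable [WeakHopfAlgebra k H]

variable (k H M N) in
/-- `M ⊗_t N = Δ(1)(M ⊗ N)` -/
noncomputable def TProd : Submodule k (M ⊗[k] N) := LinearMap.range (dact k H M N (Δ k H 1))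

noncomputable instance : AddCommGroup (TProd k H M N) := inferInstance

/-- The inclusion of `M ⊗_t N` in `M ⊗ N`. -/
noncomputable def inc : TProd k H M N →ₗ[k] M ⊗[k] N := (TProd k H M N).subtype

/-- The projection of `M ⊗ N` onto `M ⊗_t N` by the action of `Δ(1)`. -/
noncomputable def prj : M ⊗[k] N →ₗ[k] TProd k H M N := (dact k H M N (Δ k H 1)).rangeRestrict

theorem inc_injective : Function.Injective (inc : TProd k H M N →ₗ[k] M ⊗[k] N) :=
  Subtype.val_injective

theorem inc_prj (t : M ⊗[k] N) : inc (prj t : TProd k H M N) = dact k H M N (Δ k H 1) t := rfl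

theorem dact_inc (t : TProd k H M N) : dact k H M N (Δ k H 1) (inc t) = inc t := by
  obtain ⟨_, ⟨t, rfl⟩⟩ := t
  change dact k H M N (Δ k H 1) (dact k H M N (Δ k H 1) t) = dact k H M N (Δ k H 1) t
  rw [← dact_mul, Δ_one_mul]

theorem prj_inc (t : TProd k H M N) : prj (inc t) = t :=
  inc_injective (by rw [inc_prj, dact_inc])

/-- `h·(m ⊗ n) = h₁·m ⊗ h₂·n` on `M ⊗_t N` -/
noncomputable instance : SMul H (TProd k H M N) where
  smul h t := prj (dact k H M N (Δ k H h) (inc t))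

theorem smul_def (h : H) (t : TProd k H M N) : h • t = prj (dact k H M N (Δ k H h) (inc t)) := rfl

theorem inc_smul (h : H) (t : TProd k H M N) : inc (h • t) = dact k H M N (Δ k H h) (inc t) := by
  rw [smul_def, inc_prj, ← dact_mul, Δ_one_mul]

theorem smul_prj (h : H) (t : M ⊗[k] N) :
    h • (prj t : TProd k H M N) = prj (dact k H M N (Δ k H h) t) := by
  apply inc_injective
  rw [inc_smul, inc_prj, inc_prj, ← dact_mul, ← dact_mul, Δ_one_mul, Δ_mul_one]

noncomputable instance : Module H (TProd k H M N) where
  one_smul t := inc_injective (by rw [inc_smul, dact_inc])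
  mul_smul g h t := inc_injective (by rw [inc_smul, inc_smul, inc_smul, Δ_mul, dact_mul])
  smul_zero h := inc_injective (by simp [inc_smul])
  zero_smul t := inc_injective (by simp [inc_smul])
  smul_add h s t := inc_injective (by simp [inc_smul])
  add_smul g h t := inc_injective (by simp [inc_smul])

instance : IsScalarTower k H (TProd k H M N) where
  smul_assoc c h t := inc_injective (by simp [inc_smul])

variable (k) in
/-- The tensor product of `H`-linear maps. -/
noncomputable def mapT (f : M →ₗ[H] P) (g : N →ₗ[H] Q) : TProd k H M N →ₗ[H] TProd k H P Q where
  toFun t := prj (TensorProduct.map (f.restrictScalars k) (g.restrictScalars k) (inc t))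
  map_add' s t := by simp
  map_smul' h t := by
    rw [RingHom.id_apply, smul_prj, inc_smul, map_dact]

theorem inc_mapT (f : M →ₗ[H] P) (g : N →ₗ[H] Q) (t : TProd k H M N) :
    inc (mapT k f g t) =
      TensorProduct.map (f.restrictScalars k) (g.restrictScalars k) (inc t) := by
  change inc (prj _) = _
  rw [inc_prj, ← map_dact, dact_inc]

/-- The action of `H ⊗ (H ⊗ H)` on `M ⊗ (N ⊗ P)`. -/
noncomputable abbrev tact (M N P : Type*) [AddCommGroup M] [Module k M] [Module H M]
    [IsScalarTower k H M] [AddCommGroup N] [Module k N] [Module H N] [IsScalarTower k H N]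
    [AddCommGroup P] [Module k P] [Module H P] [IsScalarTower k H P] :
    H ⊗[k] (H ⊗[k] H) →ₗ[k] Module.End k (M ⊗[k] (N ⊗[k] P)) := act₂ (lsm k H M) (dact k H N P)

noncomputable def inc₃ : TProd k H M (TProd k H N P) →ₗ[k] M ⊗[k] (N ⊗[k] P) :=
  (inc.lTensor M) ∘ₗ inc

noncomputable def inc₃' : TProd k H (TProd k H M N) P →ₗ[k] (M ⊗[k] N) ⊗[k] P :=
  (inc.rTensor P) ∘ₗ inc

theorem prj_comp_inc : (prj ∘ₗ inc : TProd k H M N →ₗ[k] TProd k H M N) = LinearMap.id :=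
  LinearMap.ext prj_inc

theorem lTensor_inc_injective : Function.Injective
    ((inc : TProd k H N P →ₗ[k] N ⊗[k] P).lTensor M) := by
  apply Function.LeftInverse.injective (g := (prj.lTensor M))
  intro x
  rw [← LinearMap.comp_apply, ← LinearMap.lTensor_comp, prj_comp_inc]; simp

theorem rTensor_inc_injective : Function.Injective
    ((inc : TProd k H M N →ₗ[k] M ⊗[k] N).rTensor P) := by
  apply Function.LeftInverse.injective (g := (prj.rTensor P))
  intro x
  rw [← LinearMap.comp_apply, ← LinearMap.rTensor_comp, prj_comp_inc]; simp

theorem inc₃_injective : Function.Injective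
    (inc₃ : TProd k H M (TProd k H N P) →ₗ[k] M ⊗[k] (N ⊗[k] P)) :=
  lTensor_inc_injective.comp inc_injective

theorem inc₃'_injective : Function.Injective
    (inc₃' : TProd k H (TProd k H M N) P →ₗ[k] (M ⊗[k] N) ⊗[k] P) :=
  rTensor_inc_injective.comp inc_injective

theorem lTensor_inc_dact (x : H ⊗[k] H) (t : M ⊗[k] TProd k H N P) :
    inc.lTensor M (dact k H M (TProd k H N P) x t) =
      tact M N P ((Δ k H).lTensor H x) (inc.lTensor M t) := by
  induction x using TensorProduct.induction_on with
  | zero => simp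
  | add x x' hx hx' => simp only [map_add, LinearMap.add_apply, hx, hx']
  | tmul a b =>
    induction t using TensorProduct.induction_on with
    | zero => simp
    | add y y' hy hy' => simp only [map_add, hy, hy']
    | tmul m n => simp [inc_smul]

theorem lTensor_prj_tact (x : H ⊗[k] H) (t : M ⊗[k] (N ⊗[k] P)) :
    prj.lTensor M (tact M N P ((Δ k H).lTensor H x) t) =
    dact k H M (TProd k H N P) x (prj.lTensor M t) := by
  induction x using TensorProduct.induction_on with
  | zero => simp
  | add x x' hx hx' => simp only [map_add, LinearMap.add_apply, hx, hx']
  | tmul a b =>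
    induction t using TensorProduct.induction_on with
    | zero => simp
    | add y y' hy hy' => simp only [map_add, hy, hy']
    | tmul m n => simp [smul_prj]

theorem assoc_rTensor_inc_dact (x : H ⊗[k] H) (t : TProd k H M N ⊗[k] P) :
    TensorProduct.assoc k M N P (inc.rTensor P (dact k H (TProd k H M N) P x t)) =
      tact M N P (TensorProduct.assoc k H H H ((Δ k H).rTensor H x))
        (TensorProduct.assoc k M N P (inc.rTensor P t)) := by
  induction x using TensorProduct.induction_on with
  | zero => simp
  | add x x' hx hx' => simp only [map_add, LinearMap.add_apply, hx, hx']
  | tmul a b =>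
    induction t using TensorProduct.induction_on with
    | zero => simp
    | add y y' hy hy' => simp only [map_add, hy, hy']
    | tmul m n =>
      simp only [act₂_tmul, TensorProduct.map_tmul, LinearMap.rTensor_tmul,
        AlgHom.toLinearMap_apply, Algebra.lsmul_coe, inc_smul]
      induction Δ k H a using TensorProduct.induction_on with
      | zero => simp
      | add x x' hx hx' =>
        simp only [map_add, LinearMap.add_apply, TensorProduct.add_tmul, hx, hx']
      | tmul c d =>
        induction inc m using TensorProduct.induction_on with
        | zero => simp
        | add y y' hy hy' => simp only [map_add, TensorProduct.add_tmul, hy, hy']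
        | tmul p q => simp

theorem inc₃_smul (h : H) (t : TProd k H M (TProd k H N P)) :
    inc₃ (h • t) = tact M N P ((Δ k H).lTensor H (Δ k H h)) (inc₃ t) := by
  simp only [inc₃, LinearMap.comp_apply, inc_smul, lTensor_inc_dact]

theorem assoc_inc₃'_smul (h : H) (t : TProd k H (TProd k H M N) P) :
    TensorProduct.assoc k M N P (inc₃' (h • t)) =
      tact M N P ((Δ k H).lTensor H (Δ k H h)) (TensorProduct.assoc k M N P (inc₃' t)) := by
  simp only [inc₃', LinearMap.comp_apply, inc_smul, assoc_rTensor_inc_dact, coassoc']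

theorem lTensor_prj_inc₃ (t : TProd k H M (TProd k H N P)) :
    prj (prj.lTensor M (inc₃ t)) = t := by
  simp only [inc₃, LinearMap.comp_apply]
  rw [← LinearMap.comp_apply (prj.lTensor M), ← LinearMap.lTensor_comp, prj_comp_inc]
  simp [prj_inc]

theorem inc₃_prj (t : M ⊗[k] (N ⊗[k] P)) :
    inc₃ (prj ((prj : _ →ₗ[k] TProd k H N P).lTensor M t)) =
      tact M N P ((Δ k H).lTensor H (Δ k H 1)) t := by
  simp only [inc₃, LinearMap.comp_apply, inc_prj, lTensor_inc_dact]
  rw [← LinearMap.comp_apply (inc.lTensor M), ← LinearMap.lTensor_comp]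
  induction Δ k H 1 using TensorProduct.induction_on with
  | zero => simp
  | add x x' hx hx' => simp only [map_add, LinearMap.add_apply, hx, hx']
  | tmul a b =>
    induction t using TensorProduct.induction_on with
    | zero => simp
    | add y y' hy hy' => simp only [map_add, hy, hy']
    | tmul m n => simp [inc_prj, ← dact_mul, Δ_mul_one]

theorem inc₃'_prj (t : (M ⊗[k] N) ⊗[k] P) :
    TensorProduct.assoc k M N P (inc₃' (prj ((prj : _ →ₗ[k] TProd k H M N).rTensor P t))) =
      tact M N P ((Δ k H).lTensor H (Δ k H 1)) (TensorProduct.assoc k M N P t) := by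
  simp only [inc₃', LinearMap.comp_apply, inc_prj, assoc_rTensor_inc_dact, ← coassoc']
  rw [← LinearMap.comp_apply (inc.rTensor P), ← LinearMap.rTensor_comp]
  induction Δ k H 1 using TensorProduct.induction_on with
  | zero => simp
  | add x x' hx hx' => simp only [map_add, LinearMap.add_apply, hx, hx']
  | tmul a b =>
    have e : ∀ (x : H ⊗[k] H) (s : M ⊗[k] N) (p : P),
        tact M N P (TensorProduct.assoc k H H H (x ⊗ₜ[k] b)) (TensorProduct.assoc k M N P
          (s ⊗ₜ[k] p)) = TensorProduct.assoc k M N P (dact k H M N x s ⊗ₜ[k] (b • p)) := by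
      intro x s p
      induction x using TensorProduct.induction_on with
      | zero => simp
      | add x x' hx hx' =>
        simp only [map_add, TensorProduct.add_tmul, LinearMap.add_apply, hx, hx']
      | tmul c d =>
        induction s using TensorProduct.induction_on with
        | zero => simp
        | add x x' hx hx' => simp only [map_add, TensorProduct.add_tmul, hx, hx']
        | tmul m n => simp
    induction t using TensorProduct.induction_on with
    | zero => simp
    | add y y' hy hy' => simp only [map_add, hy, hy']
    | tmul s p =>
      simp only [LinearMap.rTensor_tmul, LinearMap.comp_apply, inc_prj, e, ← dact_mul, Δ_mul_one]

theorem tact_inc₃ (t : TProd k H M (TProd k H N P)) :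
    tact M N P ((Δ k H).lTensor H (Δ k H 1)) (inc₃ t) = inc₃ t := by
  rw [← inc₃_smul]; exact congrArg _ (one_smul H t)

theorem tact_inc₃' (t : TProd k H (TProd k H M N) P) :
    tact M N P ((Δ k H).lTensor H (Δ k H 1)) (TensorProduct.assoc k M N P (inc₃' t)) =
      TensorProduct.assoc k M N P (inc₃' t) := by
  rw [← assoc_inc₃'_smul]; exact congrArg (fun t => TensorProduct.assoc k M N P (inc₃' t)) (one_smul H t)

/-- The associativity constraint, induced by that of the tensor product over `k`. -/
noncomputable def assocT : TProd k H (TProd k H M N) P ≃ₗ[H] TProd k H M (TProd k H N P) where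
  toFun t := prj (prj.lTensor M (TensorProduct.assoc k M N P (inc₃' t)))
  invFun t := prj (prj.rTensor P ((TensorProduct.assoc k M N P).symm (inc₃ t)))
  map_add' s t := by simp
  map_smul' h t := by
    apply inc₃_injective
    rw [RingHom.id_apply, inc₃_smul, inc₃_prj, inc₃_prj, tact_inc₃', tact_inc₃',
      assoc_inc₃'_smul]
  left_inv t := by
    apply inc₃'_injective
    apply (TensorProduct.assoc k M N P).injective
    rw [inc₃'_prj, LinearEquiv.apply_symm_apply, inc₃_prj, tact_inc₃', tact_inc₃']
  right_inv t := by
    apply inc₃_injective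
    rw [inc₃_prj, inc₃'_prj, LinearEquiv.apply_symm_apply, tact_inc₃, tact_inc₃]

theorem inc₃_assocT (t : TProd k H (TProd k H M N) P) :
    inc₃ (assocT t) = TensorProduct.assoc k M N P (inc₃' t) := by
  change inc₃ (prj _) = _
  rw [inc₃_prj, tact_inc₃']

end Tensor
end WeakHopf

namespace WeakHopf

section Unit
variable {k : Type u} {H : Type v} [Field k] [Ring H] [Algebra k H] [WeakHopfAlgebra k H]

theorem targetMap_coe (z : targetSpace k H) : targetMap k H z = z := by
  obtain ⟨_, ⟨z, rfl⟩⟩ := z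
  exact targetMap_targetMap z

theorem Δ_coe (z : targetSpace k H) : Δ k H z = Δ k H 1 * ((z : H) ⊗ₜ[k] (1 : H)) := by
  rw [← targetMap_coe, Δ_targetMap']

noncomputable instance : AddCommGroup (targetSpace k H) := inferInstance

/-- `h·z = ε_t(hz)` on `H_t` -/
noncomputable instance : SMul H (targetSpace k H) where
  smul h z := ⟨targetMap k H (h * z), ⟨_, rfl⟩⟩

theorem coe_smul_target (h : H) (z : targetSpace k H) :
    ((h • z : targetSpace k H) : H) = targetMap k H (h * z) := rfl

noncomputable instance : Module H (targetSpace k H) where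
  one_smul z := Subtype.ext (by rw [coe_smul_target, one_mul, targetMap_coe])
  mul_smul g h z := Subtype.ext (by
    rw [coe_smul_target, coe_smul_target, coe_smul_target, targetMap_mul_targetMap, mul_assoc])
  smul_zero h := Subtype.ext (by simp [coe_smul_target])
  zero_smul z := Subtype.ext (by simp [coe_smul_target])
  smul_add h s t := Subtype.ext (by simp [coe_smul_target, mul_add])
  add_smul g h t := Subtype.ext (by simp [coe_smul_target, add_mul])

instance : IsScalarTower k H (targetSpace k H) where
  smul_assoc c h t := Subtype.ext (by simp [coe_smul_target])

variable (k H) in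
/-- `1 ∈ H_t` -/
noncomputable def oneT : targetSpace k H := ⟨1, ⟨1, targetMap_one⟩⟩

variable {M N : Type*} [AddCommGroup M] [Module k M] [Module H M] [IsScalarTower k H M]
  [AddCommGroup N] [Module k N] [Module H N] [IsScalarTower k H N]

variable (k H M) in
/-- `z ⊗ m ↦ z·m` -/
noncomputable def lmap : targetSpace k H ⊗[k] M →ₗ[k] M :=
  TensorProduct.lift (lsm k H M ∘ₗ (targetSpace k H).subtype)

variable (k H M) in
/-- `m ⊗ z ↦ S(z)·m` -/
noncomputable def rmap : M ⊗[k] targetSpace k H →ₗ[k] M :=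
  TensorProduct.lift (lsm k H M ∘ₗ S k H ∘ₗ (targetSpace k H).subtype) ∘ₗ
    (TensorProduct.comm k M (targetSpace k H)).toLinearMap

@[simp] theorem lmap_tmul (z : targetSpace k H) (m : M) : lmap k H M (z ⊗ₜ[k] m) = (z : H) • m := rfl

@[simp] theorem rmap_tmul (z : targetSpace k H) (m : M) :
    rmap k H M (m ⊗ₜ[k] z) = S k H (z : H) • m := rfl

theorem lmap_dact (h : H) (t : targetSpace k H ⊗[k] M) :
    lmap k H M (dact k H _ M (Δ k H h) t) = h • lmap k H M t := by
  induction t using TensorProduct.induction_on with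
  | zero => simp
  | add x y hx hy => simp only [map_add, smul_add, hx, hy]
  | tmul z m =>
    have : ∀ D : H ⊗[k] H, lmap k H M (dact k H _ M D (z ⊗ₜ[k] m)) =
        LinearMap.mul' k H ((targetMap k H).rTensor H (D * ((z : H) ⊗ₜ[k] (1 : H)))) • m := by
      intro D
      induction D using TensorProduct.induction_on with
      | zero => simp
      | add x y hx hy => simp only [map_add, LinearMap.add_apply, add_mul, add_smul, hx, hy]
      | tmul a b => simp [coe_smul_target, mul_smul]
    have e : Δ k H h * ((z : H) ⊗ₜ[k] (1 : H)) = Δ k H (h * z) := by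
      rw [Δ_mul, Δ_coe, ← mul_assoc, Δ_mul_one]
    rw [this, e, targetMap_mul_self, mul_smul, lmap_tmul]

/-- `ε_t` as a map onto `H_t` -/
noncomputable def toT : H →ₗ[k] targetSpace k H := (targetMap k H).rangeRestrict

theorem rTensor_target_injective : Function.Injective ((targetSpace k H).subtype.rTensor M) := by
  apply Function.LeftInverse.injective (g := toT.rTensor M)
  intro x
  have : (toT : H →ₗ[k] targetSpace k H) ∘ₗ (targetSpace k H).subtype = LinearMap.id := by
    ext z; exact targetMap_coe z
  rw [← LinearMap.comp_apply, ← LinearMap.rTensor_comp]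
  rw [this, LinearMap.rTensor_id, LinearMap.id_apply]

theorem lTensor_target_injective : Function.Injective ((targetSpace k H).subtype.lTensor M) := by
  apply Function.LeftInverse.injective (g := toT.lTensor M)
  intro x
  have : (toT : H →ₗ[k] targetSpace k H) ∘ₗ (targetSpace k H).subtype = LinearMap.id := by
    ext z; exact targetMap_coe z
  rw [← LinearMap.comp_apply, ← LinearMap.lTensor_comp]
  rw [this, LinearMap.lTensor_id, LinearMap.id_apply]

theorem lmap_inv (t : targetSpace k H ⊗[k] M) :
    dact k H (targetSpace k H) M (Δ k H 1) (oneT k H ⊗ₜ[k] lmap k H M t) =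
      dact k H _ M (Δ k H 1) t := by
  induction t using TensorProduct.induction_on with
  | zero => simp
  | add x y hx hy => simp only [map_add, TensorProduct.tmul_add, hx, hy]
  | tmul z m =>
    apply rTensor_target_injective
    have e1 : ∀ D : H ⊗[k] H, (targetSpace k H).subtype.rTensor M
        (dact k H (targetSpace k H) M D (oneT k H ⊗ₜ[k] ((z : H) • m))) =
        TensorProduct.map LinearMap.id ((lsm k H M).flip m)
          ((targetMap k H).rTensor H D * ((1 : H) ⊗ₜ[k] (z : H))) := by
      intro D
      induction D using TensorProduct.induction_on with
      | zero => simp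
      | add x y hx hy => simp only [map_add, LinearMap.add_apply, add_mul, hx, hy]
      | tmul a b => simp [coe_smul_target, mul_smul, oneT]
    have e2 : ∀ D : H ⊗[k] H, (targetSpace k H).subtype.rTensor M
        (dact k H (targetSpace k H) M D (z ⊗ₜ[k] m)) =
        TensorProduct.map LinearMap.id ((lsm k H M).flip m)
          ((targetMap k H).rTensor H (D * ((z : H) ⊗ₜ[k] (1 : H)))) := by
      intro D
      induction D using TensorProduct.induction_on with
      | zero => simp
      | add x y hx hy => simp only [map_add, LinearMap.add_apply, add_mul, hx, hy]
      | tmul a b => simp [coe_smul_target]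
    rw [lmap_tmul, e1, e2, ← Δ_coe, rTensor_targetMap (z : H)]

theorem S_coe (z : targetSpace k H) : S k H z = sourceMap k H z := by
  rw [← targetMap_coe, S_targetMap]

theorem targetMap_S_coe [Regular k H] (z : targetSpace k H) : targetMap k H (S k H z) = z := by
  rw [S_coe, ← targetMap_coe, targetMap_sourceMap_targetMap]

theorem Δ_S_coe (z : targetSpace k H) :
    Δ k H (S k H z) = Δ k H 1 * ((1 : H) ⊗ₜ[k] (S k H z)) := by
  rw [S_coe, Δ_sourceMap']

theorem targetMap_mul_coe [Regular k H] (b : H) (z : targetSpace k H) :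
    targetMap k H (b * z) = targetMap k H (b * S k H z) := by
  conv_lhs => rw [← targetMap_S_coe z, targetMap_mul_targetMap]

theorem rmap_dact [Regular k H] (h : H) (t : M ⊗[k] targetSpace k H) :
    rmap k H M (dact k H M _ (Δ k H h) t) = h • rmap k H M t := by
  induction t using TensorProduct.induction_on with
  | zero => simp
  | add x y hx hy => simp only [map_add, smul_add, hx, hy]
  | tmul m z =>
    have e1 : ∀ D : H ⊗[k] H, rmap k H M (dact k H M _ D (m ⊗ₜ[k] z)) =
        LinearMap.mul' k H (TensorProduct.comm k H H ((sourceMap k H).lTensor H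
          ((targetMap k H).lTensor H (D * ((1 : H) ⊗ₜ[k] (S k H z)))))) • m := by
      intro D
      induction D using TensorProduct.induction_on with
      | zero => simp
      | add x y hx hy => simp only [map_add, LinearMap.add_apply, add_mul, add_smul, hx, hy]
      | tmul a b =>
        have : S k H (targetMap k H (b * S k H z)) =
            sourceMap k H (targetMap k H (b * S k H z)) := S_targetMap _
        simp [coe_smul_target, mul_smul, targetMap_mul_coe, this]
    have e2 : Δ k H h * ((1 : H) ⊗ₜ[k] (S k H z)) = Δ k H (h * S k H z) := by
      rw [Δ_mul, Δ_S_coe, ← mul_assoc, Δ_mul_one]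
    have e3 : ∀ (D : H ⊗[k] H) (x : H), LinearMap.mul' k H (TensorProduct.comm k H H
        ((sourceMap k H).lTensor H (D * (x ⊗ₜ[k] (1 : H))))) =
        LinearMap.mul' k H (TensorProduct.comm k H H ((sourceMap k H).lTensor H D)) * x := by
      intro D x
      induction D using TensorProduct.induction_on with
      | zero => simp
      | add x y hx hy => simp only [map_add, add_mul, hx, hy]
      | tmul a b => simp [mul_assoc]
    rw [e1, e2, lTensor_targetMap, e3, sourceMap_cop_one, one_mul, mul_smul, rmap_tmul]

theorem Δ_one_S_coe (z : targetSpace k H) :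
    (targetMap k H).lTensor H (Δ k H 1 * ((1 : H) ⊗ₜ[k] S k H z)) =
      Δ k H 1 * (S k H z ⊗ₜ[k] (1 : H)) := by
  rw [← Δ_S_coe, lTensor_targetMap]

/-- `1₁S(z) ⊗ 1₂ = 1₁ ⊗ 1₂z` on the target space -/
theorem Δ_one_mul_S_coe [Regular k H] (z : targetSpace k H) :
    Δ k H 1 * (S k H z ⊗ₜ[k] (1 : H)) = Δ k H 1 * ((1 : H) ⊗ₜ[k] (z : H)) := by
  have e : ∀ D : H ⊗[k] H, (targetMap k H).lTensor H
      ((targetMap k H).lTensor H D * ((1 : H) ⊗ₜ[k] S k H z)) =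
      (targetMap k H).lTensor H D * ((1 : H) ⊗ₜ[k] (z : H)) := by
    intro D
    induction D using TensorProduct.induction_on with
    | zero => simp
    | add x y hx hy => simp only [map_add, add_mul, hx, hy]
    | tmul a b => simp [targetMap_targetMap_mul, targetMap_S_coe]
  have := e (Δ k H 1)
  rwa [lTensor_targetMap_one, Δ_one_S_coe] at this

theorem rmap_inv [Regular k H] (t : M ⊗[k] targetSpace k H) :
    dact k H M (targetSpace k H) (Δ k H 1) (rmap k H M t ⊗ₜ[k] oneT k H) =
      dact k H M _ (Δ k H 1) t := by
  induction t using TensorProduct.induction_on with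
  | zero => simp
  | add x y hx hy => simp only [map_add, TensorProduct.add_tmul, hx, hy]
  | tmul m z =>
    apply lTensor_target_injective
    have e1 : ∀ D : H ⊗[k] H, (targetSpace k H).subtype.lTensor M
        (dact k H M (targetSpace k H) D ((S k H (z : H) • m) ⊗ₜ[k] oneT k H)) =
        TensorProduct.map ((lsm k H M).flip m) LinearMap.id
          ((targetMap k H).lTensor H D * (S k H (z : H) ⊗ₜ[k] (1 : H))) := by
      intro D
      induction D using TensorProduct.induction_on with
      | zero => simp
      | add x y hx hy => simp only [map_add, LinearMap.add_apply, add_mul, hx, hy]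
      | tmul a b => simp [coe_smul_target, mul_smul, oneT]
    have e2 : ∀ D : H ⊗[k] H, (targetSpace k H).subtype.lTensor M
        (dact k H M (targetSpace k H) D (m ⊗ₜ[k] z)) =
        TensorProduct.map ((lsm k H M).flip m) LinearMap.id
          ((targetMap k H).lTensor H (D * ((1 : H) ⊗ₜ[k] S k H (z : H)))) := by
      intro D
      induction D using TensorProduct.induction_on with
      | zero => simp
      | add x y hx hy => simp only [map_add, LinearMap.add_apply, add_mul, hx, hy]
      | tmul a b => simp [coe_smul_target, targetMap_mul_coe]
    rw [rmap_tmul, e1, e2, Δ_one_S_coe, lTensor_targetMap_one]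

theorem triangle_dact [Regular k H] (t : (M ⊗[k] targetSpace k H) ⊗[k] N) :
    dact k H M N (Δ k H 1) ((rmap k H M).rTensor N t) =
    dact k H M N (Δ k H 1) ((lmap k H N).lTensor M (TensorProduct.assoc k _ _ _ t)) := by
  induction t using TensorProduct.induction_on with
  | zero => simp
  | add x y hx hy => simp only [map_add, hx, hy]
  | tmul w n =>
    induction w using TensorProduct.induction_on with
    | zero => simp
    | add x y hx hy => simp only [map_add, TensorProduct.add_tmul, hx, hy]
    | tmul m z =>
      have := congrArg (fun D => dact k H M N D (m ⊗ₜ[k] n)) (Δ_one_mul_S_coe (k := k) z)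
      simpa [dact_mul] using this

variable (k H M) in
/-- The left unit constraint `z ⊗ m ↦ z·m`, with inverse `m ↦ 1₁·1 ⊗ 1₂·m`. -/
noncomputable def lunitT : TProd k H (targetSpace k H) M ≃ₗ[H] M where
  toFun t := lmap k H M (inc t)
  invFun m := prj (oneT k H ⊗ₜ[k] m)
  map_add' s t := by simp
  map_smul' h t := by rw [inc_smul, lmap_dact]; rfl
  left_inv t := inc_injective (by rw [inc_prj, lmap_inv, dact_inc])
  right_inv m := by
    beta_reduce
    rw [inc_prj, lmap_dact, one_smul, lmap_tmul]
    exact one_smul H m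

variable (k H M) in
/-- The right unit constraint `m ⊗ z ↦ S(z)·m`, with inverse `m ↦ 1₁·m ⊗ 1₂`. -/
noncomputable def runitT [Regular k H] : TProd k H M (targetSpace k H) ≃ₗ[H] M where
  toFun t := rmap k H M (inc t)
  invFun m := prj (m ⊗ₜ[k] oneT k H)
  map_add' s t := by simp
  map_smul' h t := by rw [inc_smul, rmap_dact]; rfl
  left_inv t := inc_injective (by rw [inc_prj, rmap_inv, dact_inc])
  right_inv m := by
    beta_reduce
    rw [inc_prj, rmap_dact, one_smul, rmap_tmul, S_coe]
    have : sourceMap k H (oneT k H : H) = 1 := sourceMap_one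
    rw [this, one_smul]

end Unit
end WeakHopf

namespace WeakHopf

open CategoryTheory MonoidalCategory

section Cat
variable (k : Type u) (H : Type v) [Field k] [Ring H] [Algebra k H]

/-- A left `H`-module. -/
structure HMod where
  /-- the underlying vector space -/
  carrier : Type v
  [addCommGroup : AddCommGroup carrier]
  [module : Module k carrier]
  [hmodule : Module H carrier]
  [isScalarTower : IsScalarTower k H carrier]

namespace HMod

attribute [instance] addCommGroup module hmodule isScalarTower

variable {k H}

/-- The category of left `H`-modules. -/
instance : Category (HMod k H) where
  Hom M N := M.carrier →ₗ[H] N.carrier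
  id _ := LinearMap.id
  comp f g := g.comp f

theorem comp_apply {M N P : HMod k H} (f : M ⟶ N) (g : N ⟶ P) (m : M.carrier) :
    DFunLike.coe (F := M.carrier →ₗ[H] P.carrier) (f ≫ g) m =
    DFunLike.coe (F := N.carrier →ₗ[H] P.carrier) g
      (DFunLike.coe (F := M.carrier →ₗ[H] N.carrier) f m) := rfl

theorem hom_ext {M N : HMod k H} {f g : M ⟶ N} (h : ∀ m,
    DFunLike.coe (F := M.carrier →ₗ[H] N.carrier) f m =
    DFunLike.coe (F := M.carrier →ₗ[H] N.carrier) g m) : f = g := LinearMap.ext h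

/-- A linear isomorphism as an isomorphism of modules. -/
def mkIso {M N : HMod k H} (e : M.carrier ≃ₗ[H] N.carrier) : M ≅ N where
  hom := e.toLinearMap
  inv := e.symm.toLinearMap
  hom_inv_id := hom_ext fun m => e.symm_apply_apply m
  inv_hom_id := hom_ext fun m => e.apply_symm_apply m

variable [WeakHopfAlgebra k H] [Regular k H]

noncomputable instance : MonoidalCategoryStruct (HMod k H) where
  tensorObj M N := ⟨TProd k H M.carrier N.carrier⟩
  whiskerLeft M _ _ f := mapT k (LinearMap.id : M.carrier →ₗ[H] M.carrier) f
  whiskerRight f N := mapT k f (LinearMap.id : N.carrier →ₗ[H] N.carrier)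
  tensorHom f g := mapT k f g
  tensorUnit := ⟨targetSpace k H⟩
  associator _ _ _ := mkIso assocT
  leftUnitor M := mkIso (lunitT k H M.carrier)
  rightUnitor M := mkIso (runitT k H M.carrier)

end HMod
end Cat

section Laws
variable {k : Type u} {H : Type v} [Field k] [Ring H] [Algebra k H] [WeakHopfAlgebra k H]
variable {M N P Q M' N' P' : Type*}
  [AddCommGroup M] [Module k M] [Module H M] [IsScalarTower k H M]
  [AddCommGroup N] [Module k N] [Module H N] [IsScalarTower k H N]
  [AddCommGroup P] [Module k P] [Module H P] [IsScalarTower k H P]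
  [AddCommGroup Q] [Module k Q] [Module H Q] [IsScalarTower k H Q]
  [AddCommGroup M'] [Module k M'] [Module H M'] [IsScalarTower k H M']
  [AddCommGroup N'] [Module k N'] [Module H N'] [IsScalarTower k H N']
  [AddCommGroup P'] [Module k P'] [Module H P'] [IsScalarTower k H P']

theorem mapT_comp (f : M →ₗ[H] N) (g : N →ₗ[H] P) (f' : M' →ₗ[H] N') (g' : N' →ₗ[H] P')
    (t : TProd k H M M') : mapT k g g' (mapT k f f' t) = mapT k (g.comp f) (g'.comp f') t := by
  apply inc_injective
  simp only [inc_mapT]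
  rw [← LinearMap.comp_apply, ← TensorProduct.map_comp]
  rfl

theorem mapT_id (t : TProd k H M N) :
    mapT k (LinearMap.id : M →ₗ[H] M) (LinearMap.id : N →ₗ[H] N) t = t := by
  apply inc_injective
  rw [inc_mapT]
  exact LinearMap.congr_fun TensorProduct.map_id _

theorem inc_mapT_left (f : M →ₗ[H] N) (t : TProd k H M P) :
    inc (mapT k f (LinearMap.id : P →ₗ[H] P) t) = (f.restrictScalars k).rTensor P (inc t) :=
  inc_mapT f LinearMap.id t

theorem inc_mapT_right (f : M →ₗ[H] N) (t : TProd k H P M) :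
    inc (mapT k (LinearMap.id : P →ₗ[H] P) f t) = (f.restrictScalars k).lTensor P (inc t) :=
  inc_mapT LinearMap.id f t

theorem inc₃_mapT (f : M →ₗ[H] M') (g : N →ₗ[H] N') (h : P →ₗ[H] P')
    (t : TProd k H M (TProd k H N P)) : inc₃ (mapT k f (mapT k g h) t) =
      TensorProduct.map (f.restrictScalars k) (TensorProduct.map (g.restrictScalars k)
        (h.restrictScalars k)) (inc₃ t) := by
  simp only [inc₃, LinearMap.comp_apply, inc_mapT]
  induction inc t using TensorProduct.induction_on with
  | zero => simp
  | add x y hx hy => simp only [map_add, hx, hy]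
  | tmul a b => simp [inc_mapT]

theorem inc₃'_mapT (f : M →ₗ[H] M') (g : N →ₗ[H] N') (h : P →ₗ[H] P')
    (t : TProd k H (TProd k H M N) P) : inc₃' (mapT k (mapT k f g) h t) =
      TensorProduct.map (TensorProduct.map (f.restrictScalars k) (g.restrictScalars k))
        (h.restrictScalars k) (inc₃' t) := by
  simp only [inc₃', LinearMap.comp_apply, inc_mapT]
  induction inc t using TensorProduct.induction_on with
  | zero => simp
  | add x y hx hy => simp only [map_add, hx, hy]
  | tmul a b => simp [inc_mapT]

theorem assocT_naturality (f : M →ₗ[H] M') (g : N →ₗ[H] N') (h : P →ₗ[H] P')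
    (t : TProd k H (TProd k H M N) P) :
    assocT (mapT k (mapT k f g) h t) = mapT k f (mapT k g h) (assocT t) := by
  apply inc₃_injective
  rw [inc₃_assocT, inc₃'_mapT, inc₃_mapT, inc₃_assocT]
  induction inc₃' t using TensorProduct.induction_on with
  | zero => simp
  | add x y hx hy => simp only [map_add, hx, hy]
  | tmul a b =>
    induction a using TensorProduct.induction_on with
    | zero => simp
    | add x y hx hy => simp only [map_add, TensorProduct.add_tmul, hx, hy]
    | tmul a c => simp

theorem lunitT_naturality (f : M →ₗ[H] N) (t : TProd k H (targetSpace k H) M) :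
    lunitT k H N (mapT k LinearMap.id f t) = f (lunitT k H M t) := by
  change lmap k H N (inc _) = f (lmap k H M (inc t))
  rw [inc_mapT]
  induction inc t using TensorProduct.induction_on with
  | zero => simp
  | add x y hx hy => simp only [map_add, hx, hy]
  | tmul a b => simp

theorem runitT_naturality [Regular k H] (f : M →ₗ[H] N) (t : TProd k H M (targetSpace k H)) :
    runitT k H N (mapT k f LinearMap.id t) = f (runitT k H M t) := by
  change rmap k H N (inc _) = f (rmap k H M (inc t))
  rw [inc_mapT]
  induction inc t using TensorProduct.induction_on with
  | zero => simp
  | add x y hx hy => simp only [map_add, hx, hy]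
  | tmul a b => simp

theorem triangleT [Regular k H] (t : TProd k H (TProd k H M (targetSpace k H)) N) :
    mapT k (LinearMap.id : M →ₗ[H] M) (lunitT k H N).toLinearMap (assocT t) =
      mapT k (runitT k H M).toLinearMap (LinearMap.id : N →ₗ[H] N) t := by
  apply inc_injective
  have e1 : inc (mapT k (LinearMap.id : M →ₗ[H] M) (lunitT k H N).toLinearMap (assocT t)) =
      (lmap k H N).lTensor M (inc₃ (assocT t)) := by
    rw [inc_mapT, inc₃, LinearMap.comp_apply]
    rw [← LinearMap.comp_apply (LinearMap.lTensor _ _), ← LinearMap.lTensor_comp]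
    rfl
  have e2 : inc (mapT k (runitT k H M).toLinearMap (LinearMap.id : N →ₗ[H] N) t) =
      (rmap k H M).rTensor N (inc₃' t) := by
    rw [inc_mapT, inc₃', LinearMap.comp_apply]
    rw [← LinearMap.comp_apply (LinearMap.rTensor _ _), ← LinearMap.rTensor_comp]
    rfl
  rw [← dact_inc, e1, ← dact_inc (mapT k (runitT k H M).toLinearMap _ t), e2, triangle_dact,
    inc₃_assocT]

section Linear
variable {A B C D E F : Type*} [AddCommGroup A] [Module k A] [AddCommGroup B] [Module k B]
  [AddCommGroup C] [Module k C] [AddCommGroup D] [Module k D] [AddCommGroup E] [Module k E]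
  [AddCommGroup F] [Module k F]

theorem lin_mid (f : B →ₗ[k] E) (x : (A ⊗[k] B) ⊗[k] C) :
    (f.rTensor C).lTensor A (TensorProduct.assoc k A B C x) =
      TensorProduct.assoc k A E C ((f.lTensor A).rTensor C x) := by
  induction x using TensorProduct.induction_on with
  | zero => simp
  | add x y hx hy => simp only [map_add, hx, hy]
  | tmul a b =>
    induction a using TensorProduct.induction_on with
    | zero => simp
    | add x y hx hy => simp only [map_add, TensorProduct.add_tmul, hx, hy]
    | tmul a c => simp

theorem lin_left (f : A →ₗ[k] E) (x : (A ⊗[k] B) ⊗[k] C) :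
    f.rTensor _ (TensorProduct.assoc k A B C x) =
      TensorProduct.assoc k E B C ((f.rTensor B).rTensor C x) := by
  induction x using TensorProduct.induction_on with
  | zero => simp
  | add x y hx hy => simp only [map_add, hx, hy]
  | tmul a b =>
    induction a using TensorProduct.induction_on with
    | zero => simp
    | add x y hx hy => simp only [map_add, TensorProduct.add_tmul, hx, hy]
    | tmul a c => simp

theorem lin_right (f : C →ₗ[k] E) (x : (A ⊗[k] B) ⊗[k] C) :
    (f.lTensor B).lTensor A (TensorProduct.assoc k A B C x) =
      TensorProduct.assoc k A B E (f.lTensor _ x) := by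
  induction x using TensorProduct.induction_on with
  | zero => simp
  | add x y hx hy => simp only [map_add, hx, hy]
  | tmul a b =>
    induction a using TensorProduct.induction_on with
    | zero => simp
    | add x y hx hy => simp only [map_add, TensorProduct.add_tmul, hx, hy]
    | tmul a c => simp

theorem lin_exchange (f : A →ₗ[k] E) (g : B →ₗ[k] F) (x : A ⊗[k] B) :
    g.lTensor E (f.rTensor B x) = f.rTensor F (g.lTensor A x) := by
  induction x using TensorProduct.induction_on with
  | zero => simp
  | add x y hx hy => simp only [map_add, hx, hy]
  | tmul a b => simp

theorem lin_pentagon (x : ((A ⊗[k] B) ⊗[k] C) ⊗[k] D) :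
    (TensorProduct.assoc k B C D).toLinearMap.lTensor A (TensorProduct.assoc k A _ D
      ((TensorProduct.assoc k A B C).toLinearMap.rTensor D x)) =
      TensorProduct.assoc k A B _ (TensorProduct.assoc k _ C D x) := by
  induction x using TensorProduct.induction_on with
  | zero => simp
  | add x y hx hy => simp only [map_add, hx, hy]
  | tmul a b =>
    induction a using TensorProduct.induction_on with
    | zero => simp
    | add x y hx hy => simp only [map_add, TensorProduct.add_tmul, hx, hy]
    | tmul a c =>
      induction a using TensorProduct.induction_on with
      | zero => simp
      | add x y hx hy => simp only [map_add, TensorProduct.add_tmul, hx, hy]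
      | tmul a d => simp

/-- The pentagon on submodules, from the associators of the ambient tensor products. -/
theorem lin_pentagon_sub {T12 T23 T34 : Type*} [AddCommGroup T12] [Module k T12]
    [AddCommGroup T23] [Module k T23] [AddCommGroup T34] [Module k T34]
    {T123 T123' T234 T234' : Type*} [AddCommGroup T123] [Module k T123]
    [AddCommGroup T123'] [Module k T123'] [AddCommGroup T234] [Module k T234]
    [AddCommGroup T234'] [Module k T234']
    (i12 : T12 →ₗ[k] A ⊗[k] B) (i23 : T23 →ₗ[k] B ⊗[k] C) (i34 : T34 →ₗ[k] C ⊗[k] D)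
    (j123 : T123 →ₗ[k] T12 ⊗[k] C) (j123' : T123' →ₗ[k] A ⊗[k] T23)
    (j234 : T234 →ₗ[k] T23 ⊗[k] D) (j234' : T234' →ₗ[k] B ⊗[k] T34)
    (a123 : T123 →ₗ[k] T123') (a234 : T234 →ₗ[k] T234')
    (h123 : ∀ t, i23.lTensor A (j123' (a123 t)) =
      TensorProduct.assoc k A B C (i12.rTensor C (j123 t)))
    (h234 : ∀ t, i34.lTensor B (j234' (a234 t)) =
      TensorProduct.assoc k B C D (i23.rTensor D (j234 t)))
    (t : T123 ⊗[k] D) (u : T123' ⊗[k] D) (hu : u = a123.rTensor D t)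
    (v : A ⊗[k] T234) (hv : j234.lTensor A v = TensorProduct.assoc k A T23 D (j123'.rTensor D u))
    (w : A ⊗[k] T234') (hw : w = a234.lTensor A v)
    (y : T12 ⊗[k] T34)
    (hy : i34.lTensor T12 y = TensorProduct.assoc k T12 C D (j123.rTensor D t))
    (z : A ⊗[k] T234')
    (hz : j234'.lTensor A z = TensorProduct.assoc k A B T34 (i12.rTensor T34 y)) :
    (i34.lTensor B).lTensor A (j234'.lTensor A w) =
      (i34.lTensor B).lTensor A (j234'.lTensor A z) := by
  have e234 : (i34.lTensor B) ∘ₗ j234' ∘ₗ a234 =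
      (TensorProduct.assoc k B C D).toLinearMap ∘ₗ (i23.rTensor D) ∘ₗ j234 :=
    LinearMap.ext h234
  have e123 : (i23.lTensor A) ∘ₗ j123' ∘ₗ a123 =
      (TensorProduct.assoc k A B C).toLinearMap ∘ₗ (i12.rTensor C) ∘ₗ j123 :=
    LinearMap.ext h123
  have e234' : (i34.lTensor B).lTensor A (j234'.lTensor A (a234.lTensor A v)) =
      (TensorProduct.assoc k B C D).toLinearMap.lTensor A ((i23.rTensor D).lTensor A
        (j234.lTensor A v)) := by
    have := congrArg (fun φ => LinearMap.lTensor A φ v) e234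
    simpa only [LinearMap.lTensor_comp, LinearMap.comp_apply] using this
  have e123' : (i23.lTensor A).rTensor D (j123'.rTensor D (a123.rTensor D t)) =
      (TensorProduct.assoc k A B C).toLinearMap.rTensor D ((i12.rTensor C).rTensor D
        (j123.rTensor D t)) := by
    have := congrArg (fun φ => LinearMap.rTensor D φ t) e123
    simpa only [LinearMap.rTensor_comp, LinearMap.comp_apply] using this
  rw [hw, e234', hv, lin_mid, hu, e123', lin_pentagon, hz, lin_right, lin_exchange, hy, lin_left]

end Linear

theorem pentagon_aux (t : TProd k H (TProd k H (TProd k H M N) P) Q)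
    (u : TProd k H (TProd k H M (TProd k H N P)) Q)
    (h1 : inc u = ((assocT (k := k) (H := H) (M := M) (N := N)
      (P := P)).toLinearMap.restrictScalars k).rTensor Q (inc t))
    (v : TProd k H M (TProd k H (TProd k H N P) Q))
    (h2 : inc.lTensor M (inc v) = TensorProduct.assoc k M _ Q (inc.rTensor Q (inc u)))
    (w : TProd k H M (TProd k H N (TProd k H P Q)))
    (h3 : inc w = ((assocT (k := k) (H := H) (M := N) (N := P)
      (P := Q)).toLinearMap.restrictScalars k).lTensor M (inc v))
    (y : TProd k H (TProd k H M N) (TProd k H P Q))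
    (h4 : inc.lTensor _ (inc y) = TensorProduct.assoc k _ P Q (inc.rTensor Q (inc t)))
    (z : TProd k H M (TProd k H N (TProd k H P Q)))
    (h5 : inc.lTensor M (inc z) = TensorProduct.assoc k M N _ (inc.rTensor _ (inc y))) :
    w = z := by
  have key := lin_pentagon_sub (k := k) (A := M) (B := N) (C := P) (D := Q)
    inc inc inc inc inc inc inc _ _
    (fun t => inc₃_assocT t) (fun t => inc₃_assocT t) _ _ h1 _ h2 _ h3 _ h4 _ h5
  apply inc_injective
  apply lTensor_inc_injective
  exact Module.Flat.lTensor_preserves_injective_linearMap (M := M) _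
    (lTensor_inc_injective (k := k) (H := H) (M := N) (N := P) (P := Q)) key

theorem pentagonT (t : TProd k H (TProd k H (TProd k H M N) P) Q) :
    mapT k (LinearMap.id : M →ₗ[H] M)
      (assocT (k := k) (H := H) (M := N) (N := P) (P := Q)).toLinearMap
      (assocT (mapT k (assocT (k := k) (H := H) (M := M) (N := N) (P := P)).toLinearMap
        (LinearMap.id : Q →ₗ[H] Q) t)) = assocT (assocT t) :=
  pentagon_aux t _ (inc_mapT_left _ t) _ (inc₃_assocT _) _ (inc_mapT_right _ _) _
    (inc₃_assocT t) _ (inc₃_assocT _)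

end Laws

section Monoidal
variable {k : Type u} {H : Type v} [Field k] [Ring H] [Algebra k H] [WeakHopfAlgebra k H]
  [Regular k H]

/-- The monoidal category of left `H`-modules. -/
noncomputable instance : MonoidalCategory (HMod k H) where
  tensorHom_def f g := HMod.hom_ext fun t => (mapT_comp (k := k) f LinearMap.id LinearMap.id g t).symm
  id_tensorHom_id _ _ := HMod.hom_ext fun t => mapT_id t
  tensorHom_comp_tensorHom f g f' g' := HMod.hom_ext fun t => mapT_comp f f' g g' t
  whiskerLeft_id _ _ := HMod.hom_ext fun t => mapT_id t
  id_whiskerRight _ _ := HMod.hom_ext fun t => mapT_id t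
  associator_naturality f g h := HMod.hom_ext fun t => assocT_naturality f g h t
  leftUnitor_naturality f := HMod.hom_ext fun t => lunitT_naturality f t
  rightUnitor_naturality f := HMod.hom_ext fun t => runitT_naturality f t
  pentagon _ _ _ _ := HMod.hom_ext fun t => pentagonT t
  triangle _ _ := HMod.hom_ext fun t => triangleT t

end Monoidal

end WeakHopf

namespace WeakHopf

open CategoryTheory MonoidalCategory

section Coact
variable (k : Type u) (H : Type v) [Field k] [Ring H] [Algebra k H]

/-- A left `H`-module `M` with a `k`-linear map `M → H ⊗ M`, on which no axioms are imposed yet. -/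
structure CoactMod where
  /-- the underlying module -/
  toHMod : HMod k H
  /-- the map `M → H ⊗ M` -/
  coact : toHMod.carrier →ₗ[k] H ⊗[k] toHMod.carrier

variable {k H}

namespace CoactMod

/-- Colinearity: `ρ(f(m)) = (id ⊗ f)(ρ(m))`. -/
def IsColinear (M N : CoactMod k H) (f : M.toHMod.carrier →ₗ[H] N.toHMod.carrier) : Prop :=
  ∀ m, N.coact (f m) = (f.restrictScalars k).lTensor H (M.coact m)

/-- The `H`-linear and colinear maps. -/
@[ext] structure Hom (M N : CoactMod k H) where
  /-- the underlying `H`-linear map -/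
  hom : M.toHMod.carrier →ₗ[H] N.toHMod.carrier
  colinear : IsColinear M N hom

instance : Category (CoactMod k H) where
  Hom := Hom
  id M := ⟨LinearMap.id, fun m => (LinearMap.congr_fun (LinearMap.lTensor_id H _) _).symm⟩
  comp {M N P} f g := ⟨g.hom.comp f.hom, fun m => by
    rw [LinearMap.comp_apply, g.colinear, f.colinear, ← LinearMap.comp_apply,
      ← LinearMap.lTensor_comp]; rfl⟩

/-- The functor forgetting the coaction. -/
def forget : CoactMod k H ⥤ HMod k H where
  obj M := M.toHMod
  map f := f.hom

instance : (forget : CoactMod k H ⥤ HMod k H).Faithful where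
  map_injective h := Hom.ext h

theorem symm_colinear {M N : CoactMod k H} (e : M.toHMod.carrier ≃ₗ[H] N.toHMod.carrier)
    (he : IsColinear M N e.toLinearMap) :
    IsColinear N M e.symm.toLinearMap := by
  intro n
  have := he (e.symm n)
  simp only [LinearEquiv.coe_coe, LinearEquiv.apply_symm_apply] at this ⊢
  rw [this, ← LinearMap.comp_apply, ← LinearMap.lTensor_comp]
  have : (e.symm.toLinearMap.restrictScalars k) ∘ₗ (e.toLinearMap.restrictScalars k) =
      LinearMap.id := by ext; simp
  rw [this]; simp

end CoactMod

variable [WeakHopfAlgebra k H]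

variable (k H) in
/-- A prescription for the coaction of tensor products `M ⊗_t N` and of the unit object `H_t`. -/
structure CoactTensor where
  /-- the coaction of `M ⊗_t N` -/
  tensor : ∀ M N : CoactMod k H, TProd k H M.toHMod.carrier N.toHMod.carrier →ₗ[k]
    H ⊗[k] TProd k H M.toHMod.carrier N.toHMod.carrier
  /-- the coaction of `H_t` -/
  unit : targetSpace k H →ₗ[k] H ⊗[k] targetSpace k H

namespace CoactTensor

variable (T : CoactTensor k H)

/-- `M ⊗_t N` with its coaction -/
noncomputable def obj (M N : CoactMod k H) : CoactMod k H :=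
  ⟨⟨TProd k H M.toHMod.carrier N.toHMod.carrier⟩, T.tensor M N⟩

/-- `H_t` with its coaction -/
noncomputable def unitObj : CoactMod k H := ⟨⟨targetSpace k H⟩, T.unit⟩

variable [Regular k H]

/-- The class `P` of modules with coaction is closed under the tensor product over the monoidal
category of `H`-modules: it contains the tensor product of any two of its members and the unit
object, and tensor products of morphisms, as well as the associativity and unit constraints of
the category of `H`-modules, are colinear. -/
structure Closed (P : ObjectProperty (CoactMod k H)) : Prop where
  tensor : ∀ M N, P M → P N → P (T.obj M N)
  unit : P T.unitObj
  map : ∀ M M' N N' : CoactMod k H, P M → P M' → P N → P N' → ∀ (f : M ⟶ M') (g : N ⟶ N'),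
    CoactMod.IsColinear (T.obj M N) (T.obj M' N') (mapT k f.hom g.hom)
  assoc : ∀ M N L : CoactMod k H, P M → P N → P L →
    CoactMod.IsColinear (T.obj (T.obj M N) L) (T.obj M (T.obj N L))
      (assocT (k := k) (H := H) (M := M.toHMod.carrier) (N := N.toHMod.carrier)
        (P := L.toHMod.carrier)).toLinearMap
  left_unit : ∀ M : CoactMod k H, P M →
    CoactMod.IsColinear (T.obj T.unitObj M) M (lunitT k H M.toHMod.carrier).toLinearMap
  right_unit : ∀ M : CoactMod k H, P M →
    CoactMod.IsColinear (T.obj M T.unitObj) M (runitT k H M.toHMod.carrier).toLinearMap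

/-- A colinear isomorphism of modules as an isomorphism. -/
def mkIso {P : ObjectProperty (CoactMod k H)} {M N : P.FullSubcategory}
    (e : M.obj.toHMod.carrier ≃ₗ[H] N.obj.toHMod.carrier)
    (he : CoactMod.IsColinear M.obj N.obj e.toLinearMap) : M ≅ N where
  hom := ⟨⟨e.toLinearMap, he⟩⟩
  inv := ⟨⟨e.symm.toLinearMap, CoactMod.symm_colinear e he⟩⟩
  hom_inv_id := ObjectProperty.hom_ext _ (CoactMod.Hom.ext
    (LinearMap.ext fun m => e.symm_apply_apply m))
  inv_hom_id := ObjectProperty.hom_ext _ (CoactMod.Hom.ext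
    (LinearMap.ext fun m => e.apply_symm_apply m))

variable {T} {P : ObjectProperty (CoactMod k H)}

theorem id_colinear (M : CoactMod k H) : CoactMod.IsColinear M M LinearMap.id :=
  (𝟙 M : M ⟶ M).colinear

/-- Tensor product, unit object and constraints are those of the category of `H`-modules. -/
@[reducible] noncomputable def Closed.struct (h : T.Closed P) :
    MonoidalCategoryStruct P.FullSubcategory where
  tensorObj M N := ⟨T.obj M.obj N.obj, h.tensor _ _ M.property N.property⟩
  whiskerLeft M N N' f := ⟨⟨mapT k (LinearMap.id) f.hom.hom,
    h.map _ _ _ _ M.property M.property N.property N'.property (𝟙 M.obj) f.hom⟩⟩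
  whiskerRight {M M'} f N := ⟨⟨mapT k f.hom.hom (LinearMap.id),
    h.map _ _ _ _ M.property M'.property N.property N.property f.hom (𝟙 N.obj)⟩⟩
  tensorHom {M M' N N'} f g := ⟨⟨mapT k f.hom.hom g.hom.hom,
    h.map _ _ _ _ M.property M'.property N.property N'.property f.hom g.hom⟩⟩
  tensorUnit := ⟨T.unitObj, h.unit⟩
  associator M N L := mkIso assocT (h.assoc _ _ _ M.property N.property L.property)
  leftUnitor M := mkIso (lunitT k H _) (h.left_unit _ M.property)
  rightUnitor M := mkIso (runitT k H _) (h.right_unit _ M.property)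

/-- The monoidal category of the objects in `P`. -/
@[reducible] noncomputable def Closed.monoidal (h : T.Closed P) :
    MonoidalCategory P.FullSubcategory :=
  letI := h.struct
  { tensorHom_def := fun f g => ObjectProperty.hom_ext _ (CoactMod.Hom.ext
      (MonoidalCategory.tensorHom_def (C := HMod k H) f.hom.hom g.hom.hom))
    id_tensorHom_id := fun M N => ObjectProperty.hom_ext _ (CoactMod.Hom.ext
      (MonoidalCategory.id_tensorHom_id (C := HMod k H) M.obj.toHMod N.obj.toHMod))
    tensorHom_comp_tensorHom := fun f g f' g' => ObjectProperty.hom_ext _ (CoactMod.Hom.ext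
      (MonoidalCategory.tensorHom_comp_tensorHom (C := HMod k H) f.hom.hom g.hom.hom
        f'.hom.hom g'.hom.hom))
    whiskerLeft_id := fun M N => ObjectProperty.hom_ext _ (CoactMod.Hom.ext
      (MonoidalCategory.whiskerLeft_id (C := HMod k H) M.obj.toHMod N.obj.toHMod))
    id_whiskerRight := fun M N => ObjectProperty.hom_ext _ (CoactMod.Hom.ext
      (MonoidalCategory.id_whiskerRight (C := HMod k H) M.obj.toHMod N.obj.toHMod))
    associator_naturality := fun f g l => ObjectProperty.hom_ext _ (CoactMod.Hom.ext
      (MonoidalCategory.associator_naturality (C := HMod k H) f.hom.hom g.hom.hom l.hom.hom))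
    leftUnitor_naturality := fun f => ObjectProperty.hom_ext _ (CoactMod.Hom.ext
      (MonoidalCategory.leftUnitor_naturality (C := HMod k H) f.hom.hom))
    rightUnitor_naturality := fun f => ObjectProperty.hom_ext _ (CoactMod.Hom.ext
      (MonoidalCategory.rightUnitor_naturality (C := HMod k H) f.hom.hom))
    pentagon := fun M N L Q => ObjectProperty.hom_ext _ (CoactMod.Hom.ext
      (MonoidalCategory.pentagon (C := HMod k H) M.obj.toHMod N.obj.toHMod L.obj.toHMod
        Q.obj.toHMod))
    triangle := fun M N => ObjectProperty.hom_ext _ (CoactMod.Hom.ext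
      (MonoidalCategory.triangle (C := HMod k H) M.obj.toHMod N.obj.toHMod)) }

end CoactTensor
end Coact

section Structures
variable {k : Type u} {H : Type v} [Field k] [Ring H] [Algebra k H] [WeakHopfAlgebra k H]

variable (k H) in
/-- `a ⊗ b ↦ (x ↦ a x S(b))` -/
noncomputable def sandwich : H ⊗[k] H →ₗ[k] Module.End k H :=
  TensorProduct.lift (LinearMap.mk₂ k
    (fun a b => LinearMap.mulLeft k a ∘ₗ LinearMap.mulRight k (S k H b))
    (fun a a' b => by ext; simp [add_mul]) (fun c a b => by ext; simp)
    (fun a b b' => by ext; simp [mul_add]) (fun c a b => by ext; simp))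

variable (k H) in
/-- The adjoint action `h·x = h₁xS(h₂)`. -/
noncomputable def ad : H →ₗ[k] Module.End k H := sandwich k H ∘ₗ Δ k H

variable (k H) in
/-- `b ↦ (x ↦ xb)` -/
noncomputable def rmul : H →ₗ[k] Module.End k H := (LinearMap.mul k H).flip

/-- `M` is a left Yetter–Drinfeld module with the coaction `m ↦ m₍₋₁₎ ⊗ m₍₀₎`. -/
structure IsYetterDrinfeld (M : CoactMod k H) : Prop where
  /-- `m₍₋₁₎₁ ⊗ m₍₋₁₎₂ ⊗ m₍₀₎ = m₍₋₁₎ ⊗ m₍₀₎₍₋₁₎ ⊗ m₍₀₎₍₀₎` -/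
  coassoc : ∀ m, TensorProduct.assoc k H H M.toHMod.carrier ((Δ k H).rTensor _ (M.coact m)) =
    M.coact.lTensor H (M.coact m)
  /-- `ε(m₍₋₁₎)m₍₀₎ = m` -/
  counit : ∀ m, TensorProduct.lid k M.toHMod.carrier ((ε k H).rTensor _ (M.coact m)) = m
  /-- `m₍₋₁₎ ⊗ m₍₀₎ ∈ H ⊗_t M` -/
  mem_tensor : ∀ m, M.coact m ∈ TProd k H H M.toHMod.carrier
  /-- `(h·m)₍₋₁₎ ⊗ (h·m)₍₀₎ = h₁m₍₋₁₎S(h₃) ⊗ h₂·m₍₀₎` -/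
  compat : ∀ (h : H) m, M.coact (h • m) =
    act₂ (sandwich k H) (lsm k H M.toHMod.carrier)
      ((TensorProduct.assoc k H H H).symm ((TensorProduct.comm k H H).toLinearMap.lTensor H
        ((Δ k H).lTensor H (Δ k H h)))) (M.coact m)

variable (k H) in
/-- The monoidal structure of Yetter–Drinfeld modules: the coaction of `M ⊗_t N` is
`m ⊗ n ↦ m₍₋₁₎n₍₋₁₎ ⊗ (m₍₀₎ ⊗ n₍₀₎)`, and that of `H_t` is `z ↦ z₁ ⊗ z₂`. -/
noncomputable def ydTensor : CoactTensor k H where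
  tensor M N := prj.lTensor H ∘ₗ
    (LinearMap.mul' k H).rTensor (M.toHMod.carrier ⊗[k] N.toHMod.carrier) ∘ₗ
    (TensorProduct.tensorTensorTensorComm k H M.toHMod.carrier H N.toHMod.carrier).toLinearMap ∘ₗ
    TensorProduct.map M.coact N.coact ∘ₗ inc
  unit := toT.lTensor H ∘ₗ Δ k H ∘ₗ (targetSpace k H).subtype

/-- `R` is an `R`-matrix of the weak Hopf algebra `H`, and the antipode of `H` is bijective. -/
structure IsQuasitriangular (R : H ⊗[k] H) : Prop where
  bijective : Function.Bijective (S k H)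
  /-- `R ∈ Δᶜᵒᵖ(1)(H ⊗ H)Δ(1)` -/
  mem : ∃ x : H ⊗[k] H, R = TensorProduct.comm k H H (Δ k H 1) * x * Δ k H 1
  /-- `(id ⊗ Δ)(R) = R₁₃R₁₂` -/
  comul_right : (Δ k H).lTensor H R = (TensorProduct.mk k H H 1).lTensor H R *
    TensorProduct.assoc k H H H (R ⊗ₜ[k] (1 : H))
  /-- `(Δ ⊗ id)(R) = R₁₃R₂₃` -/
  comul_left : TensorProduct.assoc k H H H ((Δ k H).rTensor H R) =
    (TensorProduct.mk k H H 1).lTensor H R * ((1 : H) ⊗ₜ[k] R)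
  /-- `Δᶜᵒᵖ(h)R = RΔ(h)` -/
  intertwine : ∀ h : H, TensorProduct.comm k H H (Δ k H h) * R = R * Δ k H h
  /-- there is `R' ∈ Δ(1)(H ⊗ H)Δᶜᵒᵖ(1)` with `RR' = Δᶜᵒᵖ(1)` and `R'R = Δ(1)` -/
  exists_inv : ∃ R' : H ⊗[k] H,
    (∃ x : H ⊗[k] H, R' = Δ k H 1 * x * TensorProduct.comm k H H (Δ k H 1)) ∧
    R * R' = TensorProduct.comm k H H (Δ k H 1) ∧ R' * R = Δ k H 1

/-- The underlying algebra `C_H(H_s)` of the braided Hopf algebra `_RH`, whose `H`-action is the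
adjoint action. -/
noncomputable def centralizer (k : Type u) (H : Type v) [Field k] [Ring H] [Algebra k H]
    [WeakHopfAlgebra k H] : Subalgebra k H :=
  Subalgebra.centralizer k (sourceSpace k H : Set H)

variable (R : H ⊗[k] H)

/-- The comultiplication `x ↦ x₁S(R²) ⊗ R¹·x₂` of `_RH`. -/
noncomputable def braidedΔ : H →ₗ[k] H ⊗[k] H :=
  act₂ (rmul k H ∘ₗ S k H) (ad k H) (TensorProduct.comm k H H R) ∘ₗ Δ k H

/-- `M` is a left comodule over `_RH = C_H(H_s)` in the category of left `H`-modules, with the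
coaction `m ↦ m₍₋₁₎ ⊗ m₍₀₎ ∈ _RH ⊗_t M ⊆ H ⊗ M`. -/
structure IsBraidedComodule (M : CoactMod k H) : Prop where
  /-- `m₍₋₁₎ ⊗ m₍₀₎ ∈ C_H(H_s) ⊗ M` -/
  mem_centralizer : ∀ m, M.coact m ∈
    LinearMap.range ((centralizer k H).val.toLinearMap.rTensor M.toHMod.carrier)
  /-- `1₁·m₍₋₁₎ ⊗ 1₂·m₍₀₎ = m₍₋₁₎ ⊗ m₍₀₎` -/
  mem_tensor : ∀ m, act₂ (ad k H) (lsm k H M.toHMod.carrier) (Δ k H 1) (M.coact m) = M.coact m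
  /-- `(h·m)₍₋₁₎ ⊗ (h·m)₍₀₎ = h₁·m₍₋₁₎ ⊗ h₂·m₍₀₎` -/
  linear : ∀ (h : H) m, M.coact (h • m) =
    act₂ (ad k H) (lsm k H M.toHMod.carrier) (Δ k H h) (M.coact m)
  /-- coassociativity with respect to the comultiplication of `_RH` -/
  coassoc : ∀ m, TensorProduct.assoc k H H M.toHMod.carrier
    ((braidedΔ R).rTensor _ (M.coact m)) = M.coact.lTensor H (M.coact m)
  /-- `ε_t(m₍₋₁₎)·m₍₀₎ = m`, the counit of `_RH` being `ε_t` -/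
  counit : ∀ m, TensorProduct.lift (lsm k H M.toHMod.carrier ∘ₗ targetMap k H) (M.coact m) = m

/-- The braiding `m ⊗ n ↦ R²·n ⊗ R¹·m`, for actions `f` and `g` of `H` on `M` and `N`. -/
noncomputable def braid {M N : Type*} [AddCommGroup M] [Module k M] [AddCommGroup N] [Module k N]
    (f : H →ₗ[k] Module.End k M) (g : H →ₗ[k] Module.End k N) : M ⊗[k] N →ₗ[k] N ⊗[k] M :=
  (TensorProduct.comm k M N).toLinearMap ∘ₗ act₂ f g R

/-- The monoidal structure of left `_RH`-comodules. The coaction of `M ⊗_t N` is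
`(μ ⊗ 1 ⊗ 1)(1 ⊗ C ⊗ 1)(ρ ⊗ ρ)`, where `C` is the braiding and `μ` the product of `_RH`, which is
that of `H`; that of `H_t` is `z ↦ 1₁·1 ⊗ 1₂·z`. -/
noncomputable def braidedTensor : CoactTensor k H where
  tensor M N :=
    letI X := M.toHMod.carrier
    letI Y := N.toHMod.carrier
    prj.lTensor H ∘ₗ (LinearMap.mul' k H).rTensor (X ⊗[k] Y) ∘ₗ
    (TensorProduct.assoc k H H (X ⊗[k] Y)).symm.toLinearMap ∘ₗ
    ((TensorProduct.assoc k H X Y).toLinearMap ∘ₗ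
      (braid R (lsm k H X) (ad k H)).rTensor Y ∘ₗ
      (TensorProduct.assoc k X H Y).symm.toLinearMap).lTensor H ∘ₗ
    (TensorProduct.assoc k H X (H ⊗[k] Y)).toLinearMap ∘ₗ
    TensorProduct.map M.coact N.coact ∘ₗ inc
  unit := (targetSpace k H).subtype.rTensor (targetSpace k H) ∘ₗ inc ∘ₗ
    (lunitT k H (targetSpace k H)).symm.toLinearMap.restrictScalars k

/-- The category of left Yetter–Drinfeld modules over `H`. -/
abbrev YDCat (k : Type u) (H : Type v) [Field k] [Ring H] [Algebra k H] [WeakHopfAlgebra k H] :=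
  ObjectProperty.FullSubcategory (C := CoactMod k H) IsYetterDrinfeld

/-- The category of left comodules over `_RH` in the category of left `H`-modules. -/
abbrev BraidedComodCat (R : H ⊗[k] H) :=
  ObjectProperty.FullSubcategory (C := CoactMod k H) (IsBraidedComodule R)

/-- For an action `f` of `H` on `H` the change of coaction
`x ⊗ m ↦ f(R²)(x) ⊗ R¹·m`. -/
noncomputable def twist (f : H →ₗ[k] Module.End k H) (M : CoactMod k H) : CoactMod k H :=
  ⟨M.toHMod, act₂ f (lsm k H M.toHMod.carrier) (TensorProduct.comm k H H R) ∘ₗ M.coact⟩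

theorem twist_colinear (f : H →ₗ[k] Module.End k H) {M N : CoactMod k H} (g : M ⟶ N) :
    CoactMod.IsColinear (twist R f M) (twist R f N) g.hom := by
  intro m
  change act₂ f _ _ (N.coact (g.hom m)) = LinearMap.lTensor H _ (act₂ f _ _ (M.coact m))
  rw [g.colinear m]
  induction TensorProduct.comm k H H R using TensorProduct.induction_on with
  | zero => simp
  | add x y hx hy => simp only [map_add, LinearMap.add_apply, hx, hy]
  | tmul a b =>
    induction M.coact m using TensorProduct.induction_on with
    | zero => simp
    | add x y hx hy => simp only [map_add, hx, hy]
    | tmul x y =>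
      simp only [act₂_tmul, LinearMap.lTensor_tmul]
      exact congrArg (fun z => f a x ⊗ₜ[k] z) (g.hom.map_smul b y).symm

/-- `m ↦ m₍₋₁₎R² ⊗ R¹·m₍₀₎` -/
noncomputable abbrev toYD (M : CoactMod k H) : CoactMod k H := twist R (rmul k H) M

/-- `n ↦ n₍₋₁₎S(R²) ⊗ R¹·n₍₀₎` -/
noncomputable abbrev toBraided (N : CoactMod k H) : CoactMod k H :=
  twist R (rmul k H ∘ₗ S k H) N

/-- The functor `(M, ρ) ↦ (M, ρ')` from left `_RH`-comodules to Yetter–Drinfeld modules with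
`ρ'(m) = m₍₋₁₎R² ⊗ R¹·m₍₀₎`, the identity on underlying maps. -/
noncomputable def functorF (h : ∀ M : CoactMod k H, IsBraidedComodule R M →
    IsYetterDrinfeld (toYD R M)) : BraidedComodCat R ⥤ YDCat k H where
  obj M := ⟨toYD R M.obj, h _ M.property⟩
  map f := ⟨⟨f.hom.hom, twist_colinear R _ f.hom⟩⟩

/-- The functor `(N, ρ) ↦ (N, ρ')` from Yetter–Drinfeld modules to left `_RH`-comodules with
`ρ'(n) = n₍₋₁₎S(R²) ⊗ R¹·n₍₀₎`, the identity on underlying maps. -/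
noncomputable def functorG (h : ∀ N : CoactMod k H, IsYetterDrinfeld N →
    IsBraidedComodule R (toBraided R N)) : YDCat k H ⥤ BraidedComodCat R where
  obj N := ⟨toBraided R N.obj, h _ N.property⟩
  map f := ⟨⟨f.hom.hom, twist_colinear R _ f.hom⟩⟩

end Structures
end WeakHopf

open WeakHopf CategoryTheory

/-!
The functors change the coaction of a module `M` by the operators
`P(x ⊗ m) = xR² ⊗ R¹·m` and `Q(x ⊗ m) = xS(R²) ⊗ R¹·m` on `H ⊗ M`, and are the identity otherwise.
So the theorem is about how `P` and `Q` interact with the structure of `H ⊗ M`.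

*Language.* Sweedler expressions are written as values `pairing f g t` of linear maps at a tensor
`t`, such as `Δ(h)` or `R`, in the algebra of endomorphisms of `H ⊗ M`; `conv f g` is the convolution
product `h ↦ f(h₁)g(h₂)`. On `H ⊗ M` there are three commuting actions of `H`: the left and right
multiplications `L` and `r` of `H`, and the action `a` on `M` (`CommutingActions`). In these terms,
the action on `_RH ⊗_t M` is `L(h₁)r(S(h₂))a(h₃)`, the compatibility of a Yetter–Drinfeld module is
expressed by `L(h₁)a(h₂)r(S(h₃))`, and `P = a(R¹)r(R²)`, `Q = a(R¹)r(S(R²))`.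

*The twists are mutually inverse* on coactions. The hexagon `(id ⊗ Δ)(R) = R₁₃R₁₂` turns `QP` and `PQ`
into expressions in `R¹ ⊗ ε_t(R²) = S(1₁) ⊗ 1₂` and `R¹ ⊗ ε_s(R²) = S(1₂) ⊗ 1₁`, that is, into
operators which fix the coactions of braided comodules and of Yetter–Drinfeld modules
(`IsYetterDrinfeld.twist_untwist`, `IsBraidedComodule.untwist_twist`).

*The twists preserve the axioms* (`IsBraidedComodule.isYetterDrinfeld`,
`IsYetterDrinfeld.isBraidedComodule`). Linearity is the relation `Δᶜᵒᵖ(h)R = RΔ(h)`, in the form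
`pairing_mul_conv`: `P` carries `r(S(h₁))a(h₂)` to `a(h₁)r(S(h₂))`. Coassociativity follows from the two
hexagons, which compute `(Δ ⊗ id)P` and `(id ⊗ ρ)P`; the comultiplication of `_RH` accounts
for the difference between the two.

*Yetter–Drinfeld modules form a monoidal category* (`ydTensor_closed`): the coaction of `M ⊗_t N` is the
restriction of `m ⊗ n ↦ m₍₋₁₎n₍₋₁₎ ⊗ m₍₀₎ ⊗ n₍₀₎` to `M ⊗_t N ⊆ M ⊗ N` (`lTensor_inc_ydTensor`), so that
the axioms can be checked in `H ⊗ (M ⊗ N)`; the compatibility uses the cancellation of `S(h₃)h₄`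
(`map_conv_cancel`).

*The twists are compatible with tensor products* (`braidedTensor_obj`, `braidedTensor_unitObj`): in the
coaction `(μ ⊗ 1 ⊗ 1)(1 ⊗ C ⊗ 1)(ρ ⊗ ρ)`, the adjoint action of `R²` in the braiding consists of a left
and a right multiplication. The former twists the first coaction by `P`, which undoes `Q`, and the latter
is the factor for `M` in the operator `Q` for `M ⊗ N`, again by a hexagon. Hence the tensor product of
braided comodules is that of Yetter–Drinfeld modules transported along the twist, and the monoidal
structure of braided comodules (`braidedTensor_closed`), the equivalence and its compatibility with
tensor products, with identities as structure maps, follow.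
-/

namespace WeakHopf

/-! ### Convolution and pairings -/

section Pairing
variable {k : Type u} {C D A B : Type*} [Field k]
  [AddCommGroup C] [Module k C] [AddCommGroup D] [Module k D]
  [Ring A] [Algebra k A] [Ring B] [Algebra k B]

/-- `∑ f(c)g(d)` for a tensor `∑ c ⊗ d`. Expressions in Sweedler notation are written as values
of such pairings, at `Δ(h)` or at the `R`-matrix. -/
noncomputable def pairing (f : C →ₗ[k] A) (g : D →ₗ[k] A) : C ⊗[k] D →ₗ[k] A :=
  LinearMap.mul' k A ∘ₗ TensorProduct.map f g

@[simp] theorem pairing_tmul (f : C →ₗ[k] A) (g : D →ₗ[k] A) (c : C) (d : D) :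
    pairing f g (c ⊗ₜ[k] d) = f c * g d := rfl

theorem pairing_congr {f f' : C →ₗ[k] A} {g g' : D →ₗ[k] A}
    (h : ∀ c d, f c * g d = f' c * g' d) (t : C ⊗[k] D) : pairing f g t = pairing f' g' t :=
  LinearMap.congr_fun (TensorProduct.ext' (by simpa using h)) t

theorem pairing_comm {f : C →ₗ[k] A} {g : D →ₗ[k] A} (h : ∀ c d, Commute (f c) (g d))
    (t : C ⊗[k] D) : pairing f g t = pairing g f (TensorProduct.comm k C D t) := by
  induction t using TensorProduct.induction_on with
  | zero => simp
  | add x y hx hy => simp only [map_add, hx, hy]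
  | tmul x y => exact h x y

theorem commute_pairing {a : A} {f : C →ₗ[k] A} {g : D →ₗ[k] A} (hf : ∀ c, Commute a (f c))
    (hg : ∀ d, Commute a (g d)) (t : C ⊗[k] D) : Commute a (pairing f g t) := by
  induction t using TensorProduct.induction_on with
  | zero => simp
  | add x y hx hy => rw [map_add]; exact hx.add_right hy
  | tmul x y => exact (hf x).mul_right (hg y)

theorem commute_pairing_right {a : A} {f : C →ₗ[k] A} {g : D →ₗ[k] A}
    (hf : ∀ c, Commute (f c) a) (hg : ∀ d, Commute (g d) a) (t : C ⊗[k] D) :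
    Commute (pairing f g t) a :=
  (commute_pairing (fun c => (hf c).symm) (fun d => (hg d).symm) t).symm

theorem mul_pairing (a : A) (f : C →ₗ[k] A) (g : D →ₗ[k] A) (t : C ⊗[k] D) :
    a * pairing f g t = pairing (LinearMap.mulLeft k a ∘ₗ f) g t := by
  induction t using TensorProduct.induction_on with
  | zero => simp
  | add x y hx hy => simp only [map_add, mul_add, hx, hy]
  | tmul x y => simp [mul_assoc]

theorem pairing_mul (a : A) (f : C →ₗ[k] A) (g : D →ₗ[k] A) (t : C ⊗[k] D) :
    pairing f g t * a = pairing f (LinearMap.mulRight k a ∘ₗ g) t := by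
  induction t using TensorProduct.induction_on with
  | zero => simp
  | add x y hx hy => simp only [map_add, add_mul, hx, hy]
  | tmul x y => simp [mul_assoc]

theorem pairing_rTensor {C' : Type*} [AddCommGroup C'] [Module k C'] (f : C →ₗ[k] A)
    (g : D →ₗ[k] A) (u : C' →ₗ[k] C) (t : C' ⊗[k] D) :
    pairing f g (u.rTensor D t) = pairing (f ∘ₗ u) g t := by
  induction t using TensorProduct.induction_on with
  | zero => simp
  | add x y hx hy => simp only [map_add, hx, hy]
  | tmul x y => simp

theorem pairing_lTensor {D' : Type*} [AddCommGroup D'] [Module k D'] (f : C →ₗ[k] A)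
    (g : D →ₗ[k] A) (u : D' →ₗ[k] D) (t : C ⊗[k] D') :
    pairing f g (u.lTensor C t) = pairing f (g ∘ₗ u) t := by
  induction t using TensorProduct.induction_on with
  | zero => simp
  | add x y hx hy => simp only [map_add, hx, hy]
  | tmul x y => simp

section Conv
variable [Coalgebra k C]

/-- The convolution product `(f * g)(c) = f(c₁)g(c₂)`. -/
noncomputable def conv (f g : C →ₗ[k] A) : C →ₗ[k] A := pairing f g ∘ₗ Coalgebra.comul

theorem conv_apply (f g : C →ₗ[k] A) (c : C) : conv f g c = pairing f g (Coalgebra.comul c) := rfl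

theorem conv_assoc (f g h : C →ₗ[k] A) : conv (conv f g) h = conv f (conv g h) :=
  congrArg WithConv.ofConv (mul_assoc (WithConv.toConv f) (WithConv.toConv g) (WithConv.toConv h))

theorem conv_congr {f f' g g' : C →ₗ[k] A} (h : ∀ c d, f c * g d = f' c * g' d) :
    conv f g = conv f' g' := LinearMap.ext fun _ => pairing_congr h _

theorem mul_conv (a : A) (f g : C →ₗ[k] A) :
    LinearMap.mulLeft k a ∘ₗ conv f g = conv (LinearMap.mulLeft k a ∘ₗ f) g :=
  LinearMap.ext fun _ => mul_pairing a f g _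

theorem conv_mul (a : A) (f g : C →ₗ[k] A) :
    LinearMap.mulRight k a ∘ₗ conv f g = conv f (LinearMap.mulRight k a ∘ₗ g) :=
  LinearMap.ext fun _ => pairing_mul a f g _

/-- An element in the middle of a convolution product belongs to either factor:
`f(c₁)a · g(c₂) = f(c₁) · ag(c₂)`. -/
theorem conv_mulRight_left (a : A) (f g : C →ₗ[k] A) :
    conv (LinearMap.mulRight k a ∘ₗ f) g = conv f (LinearMap.mulLeft k a ∘ₗ g) :=
  conv_congr fun c d => by simp [mul_assoc]

theorem conv_comm_apply {f g : C →ₗ[k] A} (h : ∀ c d, Commute (f c) (g d)) (c : C) :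
    conv f g c = pairing g f (TensorProduct.comm k C C (Coalgebra.comul c)) :=
  pairing_comm h _

end Conv

end Pairing

/-! ### The antipode -/

section Antipode
variable {k : Type u} {H : Type v} [Field k] [Ring H] [Algebra k H] [WeakHopfAlgebra k H]

theorem conv_id_S : conv LinearMap.id (S k H) = targetMap k H := LinearMap.ext fun h => mul_S h

theorem conv_S_id : conv (S k H) LinearMap.id = sourceMap k H := LinearMap.ext fun h => S_mul h

theorem conv_S_targetMap : conv (S k H) (targetMap k H) = S k H :=
  LinearMap.ext fun h => S_mul_targetMap h

theorem conv_sourceMap_S : conv (sourceMap k H) (S k H) = S k H :=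
  LinearMap.ext fun h => sourceMap_mul_S h

/-- Convolution products of maps on `H ⊗ H` factoring through the product of `H`. -/
theorem conv_comp_mul' (f g : H →ₗ[k] H) :
    conv (f ∘ₗ LinearMap.mul' k H) (g ∘ₗ LinearMap.mul' k H) = conv f g ∘ₗ LinearMap.mul' k H := by
  refine TensorProduct.ext' fun x y => ?_
  rw [LinearMap.comp_apply, LinearMap.mul'_apply, conv_apply, conv_apply, TensorProduct.comul_tmul]
  change _ = pairing f g (Δ k H (x * y))
  rw [Δ_mul]
  change pairing _ _ (TensorProduct.tensorTensorTensorComm k H H H H (Δ k H x ⊗ₜ[k] Δ k H y)) = _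
  induction Δ k H x using TensorProduct.induction_on with
  | zero => simp
  | add a b ha hb => simp only [map_add, add_mul, TensorProduct.add_tmul, ha, hb]
  | tmul a b =>
    induction Δ k H y using TensorProduct.induction_on with
    | zero => simp
    | add c d hc hd => simp only [map_add, mul_add, TensorProduct.tmul_add, hc, hd]
    | tmul c d => simp

variable (k H) in
/-- `g ⊗ h ↦ S(h)S(g)` -/
noncomputable def SmulS : H ⊗[k] H →ₗ[k] H :=
  LinearMap.mul' k H ∘ₗ TensorProduct.map (S k H) (S k H) ∘ₗ (TensorProduct.comm k H H).toLinearMap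

theorem conv_tmul (f g : H ⊗[k] H →ₗ[k] H) (x y : H) : conv f g (x ⊗ₜ[k] y) =
    pairing f g (TensorProduct.tensorTensorTensorComm k H H H H (Δ k H x ⊗ₜ[k] Δ k H y)) := rfl

theorem conv_SmulS_mul' :
    conv (SmulS k H) (LinearMap.mul' k H) = sourceMap k H ∘ₗ LinearMap.mul' k H := by
  refine TensorProduct.ext' fun x y => ?_
  -- `ε_s(xy) = ε_s(ε_s(x)y) = S(y₁)ε_s(x)y₂`
  have e1 : sourceMap k H (x * y) =
      pairing (S k H) (LinearMap.mulLeft k (sourceMap k H x)) (Δ k H y) := by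
    rw [← sourceMap_sourceMap_mul, ← conv_S_id, conv_apply]
    change pairing (S k H) LinearMap.id (Δ k H (_ * y)) = _
    rw [conv_S_id, Δ_mul, Δ_sourceMap, mul_assoc, Δ_one_mul]
    induction Δ k H y using TensorProduct.induction_on with
    | zero => simp
    | add a b ha hb => simp only [map_add, mul_add, ha, hb]
    | tmul a b => simp
  rw [LinearMap.comp_apply, LinearMap.mul'_apply, e1, conv_tmul, ← conv_S_id, conv_apply]
  change _ = pairing (S k H) (LinearMap.mulLeft k (pairing (S k H) LinearMap.id (Δ k H x))) _
  induction Δ k H y using TensorProduct.induction_on with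
  | zero => simp
  | add a b ha hb => simp only [map_add, TensorProduct.tmul_add, ha, hb]
  | tmul a b =>
    induction Δ k H x using TensorProduct.induction_on with
    | zero => simp
    | add c d hc hd =>
      simp only [map_add, TensorProduct.add_tmul, hc, hd, pairing_tmul, LinearMap.mulLeft_apply,
        add_mul, mul_add]
    | tmul c d => simp [SmulS, mul_assoc]

theorem conv_mul'_SmulS :
    conv (LinearMap.mul' k H) (SmulS k H) = targetMap k H ∘ₗ LinearMap.mul' k H := by
  refine TensorProduct.ext' fun x y => ?_
  -- `ε_t(xy) = ε_t(xε_t(y)) = x₁ε_t(y)S(x₂)`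
  have e1 : targetMap k H (x * y) =
      pairing (LinearMap.mulRight k (targetMap k H y)) (S k H) (Δ k H x) := by
    rw [← targetMap_mul_targetMap, ← conv_id_S, conv_apply]
    change pairing LinearMap.id (S k H) (Δ k H (x * _)) = _
    rw [conv_id_S, Δ_mul, Δ_targetMap', ← mul_assoc, Δ_mul_one]
    induction Δ k H x using TensorProduct.induction_on with
    | zero => simp
    | add a b ha hb => simp only [map_add, add_mul, ha, hb]
    | tmul a b => simp
  rw [LinearMap.comp_apply, LinearMap.mul'_apply, e1, conv_tmul, ← conv_id_S, conv_apply]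
  change _ = pairing (LinearMap.mulRight k (pairing LinearMap.id (S k H) (Δ k H y))) _ _
  induction Δ k H x using TensorProduct.induction_on with
  | zero => simp
  | add a b ha hb => simp only [map_add, TensorProduct.add_tmul, ha, hb]
  | tmul a b =>
    induction Δ k H y using TensorProduct.induction_on with
    | zero => simp
    | add c d hc hd =>
      simp only [map_add, TensorProduct.tmul_add, hc, hd, pairing_tmul, LinearMap.mulRight_apply,
        add_mul, mul_add]
    | tmul c d => simp [SmulS, mul_assoc]

/-- `S(h₁)c h₂S(h₃) = S(h)c` if `c` commutes with the target space. -/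
theorem S_conv_conv_S (c : H) (hc : ∀ h, targetMap k H h * c = c * targetMap k H h) :
    conv (conv (S k H) (LinearMap.mulLeft k c)) (S k H) = LinearMap.mulRight k c ∘ₗ S k H := by
  have e : (LinearMap.mulLeft k c : H →ₗ[k] H) = LinearMap.mulLeft k c ∘ₗ LinearMap.id := rfl
  rw [conv_assoc, e, ← mul_conv, conv_id_S, ← conv_S_targetMap, conv_mul, conv_S_targetMap]
  exact conv_congr fun x y => by simp [hc]

/-- The antipode is antimultiplicative: `g ⊗ h ↦ S(gh)` and `g ⊗ h ↦ S(h)S(g)` have the same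
convolution products with the multiplication `μ`, from the left and from the right, and both satisfy
`f * μ * f = f`. -/
theorem S_mul_rev (g h : H) : S k H (g * h) = S k H h * S k H g := by
  have h1 : conv (conv (SmulS k H) (LinearMap.mul' k H)) (SmulS k H) = SmulS k H := by
    refine TensorProduct.ext' fun x y => ?_
    have e0 : ∀ D : H ⊗[k] H, pairing (conv (SmulS k H) (LinearMap.mul' k H)) (SmulS k H)
        (TensorProduct.tensorTensorTensorComm k H H H H (D ⊗ₜ[k] Δ k H y)) =
        S k H y * pairing (sourceMap k H) (S k H) D := by
      intro D
      induction D using TensorProduct.induction_on with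
      | zero => simp
      | add a b ha hb => simp only [map_add, TensorProduct.add_tmul, mul_add, ha, hb]
      | tmul a b =>
        have e1 : ∀ E : H ⊗[k] H, pairing (conv (SmulS k H) (LinearMap.mul' k H)) (SmulS k H)
            (TensorProduct.tensorTensorTensorComm k H H H H ((a ⊗ₜ[k] b) ⊗ₜ[k] E)) =
            pairing (conv (S k H) (LinearMap.mulLeft k (sourceMap k H a))) (S k H) E * S k H b := by
          intro E
          induction E using TensorProduct.induction_on with
          | zero => simp
          | add c d hc hd => simp only [map_add, TensorProduct.tmul_add, add_mul, hc, hd]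
          | tmul c d =>
            have e2 : ∀ F : H ⊗[k] H, pairing (SmulS k H) (LinearMap.mul' k H)
                (TensorProduct.tensorTensorTensorComm k H H H H (Δ k H a ⊗ₜ[k] F)) =
                pairing (S k H) (LinearMap.mulLeft k (sourceMap k H a)) F := by
              intro F
              rw [← conv_S_id, conv_apply]
              change _ = pairing (S k H)
                (LinearMap.mulLeft k (pairing (S k H) LinearMap.id (Δ k H a))) _
              induction F using TensorProduct.induction_on with
              | zero => simp
              | add p q hp hq => simp only [map_add, TensorProduct.tmul_add, hp, hq]
              | tmul p q =>
                induction Δ k H a using TensorProduct.induction_on with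
                | zero => simp
                | add c d hc hd =>
                  simp only [map_add, TensorProduct.add_tmul, hc, hd, pairing_tmul,
                    LinearMap.mulLeft_apply, add_mul, mul_add]
                | tmul c d => simp [SmulS, mul_assoc]
            have e3 : conv (SmulS k H) (LinearMap.mul' k H) (a ⊗ₜ[k] c) =
                conv (S k H) (LinearMap.mulLeft k (sourceMap k H a)) c := by
              rw [conv_tmul, e2, conv_apply]
            have e5 : SmulS k H (b ⊗ₜ[k] d) = S k H d * S k H b := rfl
            simp [e3, e5, mul_assoc]
        rw [e1]
        have e4 := LinearMap.congr_fun (S_conv_conv_S (k := k) (sourceMap k H a)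
          (fun h => targetMap_comm_sourceMap a h)) y
        rw [conv_apply] at e4
        rw [e4]
        simp [mul_assoc]
    rw [conv_tmul, e0, ← conv_apply, conv_sourceMap_S]
    simp [SmulS]
  have h2 : conv (conv (S k H ∘ₗ LinearMap.mul' k H) (LinearMap.mul' k H))
      (S k H ∘ₗ LinearMap.mul' k H) = S k H ∘ₗ LinearMap.mul' k H := by
    have := conv_comp_mul' (k := k) (H := H) (S k H) LinearMap.id
    rw [LinearMap.id_comp] at this
    rw [this, conv_S_id, conv_comp_mul', conv_sourceMap_S]
  have h3 : conv (S k H ∘ₗ LinearMap.mul' k H) (LinearMap.mul' k H) =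
      conv (SmulS k H) (LinearMap.mul' k H) := by
    have := conv_comp_mul' (k := k) (H := H) (S k H) LinearMap.id
    rw [LinearMap.id_comp] at this
    rw [this, conv_S_id, conv_SmulS_mul']
  have h4 : conv (LinearMap.mul' k H) (S k H ∘ₗ LinearMap.mul' k H) =
      conv (LinearMap.mul' k H) (SmulS k H) := by
    have := conv_comp_mul' (k := k) (H := H) LinearMap.id (S k H)
    rw [LinearMap.id_comp] at this
    rw [this, conv_id_S, conv_mul'_SmulS]
  have h5 : S k H ∘ₗ LinearMap.mul' k H = SmulS k H := by
    rw [← h2, conv_assoc, h4, ← conv_assoc, h3, h1]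
  exact LinearMap.congr_fun h5 (g ⊗ₜ[k] h)

end Antipode

/-! ### The target and source spaces -/

section Spaces
variable {k : Type u} {H : Type v} [Field k] [Ring H] [Algebra k H] [WeakHopfAlgebra k H]

theorem targetMap_mem (h : H) : targetMap k H h ∈ targetSpace k H := ⟨h, rfl⟩

theorem sourceMap_mem (h : H) : sourceMap k H h ∈ sourceSpace k H := ⟨h, rfl⟩

theorem targetMap_eq_self {z : H} (hz : z ∈ targetSpace k H) : targetMap k H z = z := by
  obtain ⟨z, rfl⟩ := hz
  exact targetMap_targetMap z

theorem sourceMap_eq_self {y : H} (hy : y ∈ sourceSpace k H) : sourceMap k H y = y := by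
  obtain ⟨y, rfl⟩ := hy
  exact sourceMap_sourceMap y

theorem S_mem_sourceSpace {z : H} (hz : z ∈ targetSpace k H) : S k H z ∈ sourceSpace k H := by
  rw [← targetMap_eq_self hz, S_targetMap]
  exact sourceMap_mem _

theorem S_mem_targetSpace {y : H} (hy : y ∈ sourceSpace k H) : S k H y ∈ targetSpace k H := by
  rw [← sourceMap_eq_self hy, S_sourceMap]
  exact targetMap_mem _

theorem targetMap_of_source {y : H} (hy : y ∈ sourceSpace k H) : targetMap k H y = S k H y := by
  rw [← sourceMap_eq_self hy, S_sourceMap]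

theorem one_mem_targetSpace : (1 : H) ∈ targetSpace k H := ⟨1, targetMap_one⟩

theorem one_mem_sourceSpace : (1 : H) ∈ sourceSpace k H := ⟨1, sourceMap_one⟩

theorem targetSpace_comm_sourceSpace {z y : H} (hz : z ∈ targetSpace k H)
    (hy : y ∈ sourceSpace k H) : Commute z y := by
  obtain ⟨z, rfl⟩ := hz
  obtain ⟨y, rfl⟩ := hy
  exact targetMap_comm_sourceMap y z

theorem Δ_of_target {z : H} (hz : z ∈ targetSpace k H) :
    Δ k H z = (z ⊗ₜ[k] (1 : H)) * Δ k H 1 := by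
  rw [← targetMap_eq_self hz, Δ_targetMap]

theorem Δ_of_target' {z : H} (hz : z ∈ targetSpace k H) :
    Δ k H z = Δ k H 1 * (z ⊗ₜ[k] (1 : H)) := by
  rw [← targetMap_eq_self hz, Δ_targetMap']

theorem Δ_of_source {y : H} (hy : y ∈ sourceSpace k H) :
    Δ k H y = ((1 : H) ⊗ₜ[k] y) * Δ k H 1 := by
  rw [← sourceMap_eq_self hy, Δ_sourceMap]

theorem Δ_of_source' {y : H} (hy : y ∈ sourceSpace k H) :
    Δ k H y = Δ k H 1 * ((1 : H) ⊗ₜ[k] y) := by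
  rw [← sourceMap_eq_self hy, Δ_sourceMap']

theorem targetMap_mul_of_mem {z : H} (hz : z ∈ targetSpace k H) (h : H) :
    targetMap k H (z * h) = z * targetMap k H h := by
  rw [← targetMap_eq_self hz, targetMap_targetMap_mul]

/-- `Δ(1)` lies in `H_s ⊗ H_t`, in the form of an induction principle. -/
theorem Δ_one_induction {p : H ⊗[k] H → Prop} (zero : p 0)
    (add : ∀ s t, p s → p t → p (s + t))
    (tmul : ∀ y ∈ sourceSpace k H, ∀ z ∈ targetSpace k H, p (y ⊗ₜ[k] z)) : p (Δ k H 1) := by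
  rw [← lTensor_targetMap_one, ← rTensor_sourceMap_one]
  induction Δ k H 1 using TensorProduct.induction_on with
  | zero => simpa using zero
  | add x y hx hy => simpa only [map_add] using add _ _ hx hy
  | tmul a b => simpa using tmul _ (sourceMap_mem a) _ (targetMap_mem b)

/-- `S(z)1₁ ⊗ 1₂ = 1₁ ⊗ z1₂` -/
theorem S_mul_Δ_one {z : H} (hz : z ∈ targetSpace k H) :
    (S k H z ⊗ₜ[k] (1 : H)) * Δ k H 1 = ((1 : H) ⊗ₜ[k] z) * Δ k H 1 := by
  rw [← rTensor_sourceMap z, Δ_of_target hz]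
  refine Δ_one_induction (p := fun D => (S k H z ⊗ₜ[k] (1 : H)) * D =
    (sourceMap k H).rTensor H ((z ⊗ₜ[k] (1 : H)) * D)) (by simp)
    (fun s t hs ht => by simp only [map_add, mul_add, hs, ht]) fun y hy w _ => ?_
  obtain ⟨y, rfl⟩ := hy
  have e : sourceMap k H z = S k H z := by rw [← targetMap_eq_self hz, S_targetMap]
  simp [sourceMap_mul_sourceMap, e]

variable [Regular k H]

theorem S_S_of_target {z : H} (hz : z ∈ targetSpace k H) : S k H (S k H z) = z := by
  simpa using Regular.antipode_antipode (k := k) z hz 1 one_mem_sourceSpace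

theorem S_S_of_source {y : H} (hy : y ∈ sourceSpace k H) : S k H (S k H y) = y := by
  simpa using Regular.antipode_antipode (k := k) 1 one_mem_targetSpace y hy

/-- `y1₁ ⊗ 1₂ = 1₁ ⊗ S(y)1₂` -/
theorem source_mul_Δ_one {y : H} (hy : y ∈ sourceSpace k H) :
    (y ⊗ₜ[k] (1 : H)) * Δ k H 1 = ((1 : H) ⊗ₜ[k] S k H y) * Δ k H 1 := by
  rw [← S_mul_Δ_one (S_mem_targetSpace hy), S_S_of_source hy]

/-- `1₁S(z) ⊗ 1₂ = 1₁ ⊗ 1₂z` -/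
theorem Δ_one_mul_S {z : H} (hz : z ∈ targetSpace k H) :
    Δ k H 1 * (S k H z ⊗ₜ[k] (1 : H)) = Δ k H 1 * ((1 : H) ⊗ₜ[k] z) :=
  Δ_one_mul_S_coe ⟨z, hz⟩

omit [Regular k H] in
/-- `1₁S(1₂) = 1` -/
theorem Δ_one_mul_S_sum : pairing LinearMap.id (S k H) (Δ k H 1) = 1 :=
  (mul_S 1).trans targetMap_one

omit [Regular k H] in
/-- `S(1₁)1₂ = 1` -/
theorem S_Δ_one_mul_sum : pairing (S k H) LinearMap.id (Δ k H 1) = 1 :=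
  (S_mul 1).trans sourceMap_one

/-- `S(1₂)1₁ = 1` -/
theorem S_Δ_one_cop_sum :
    pairing (S k H) LinearMap.id (TensorProduct.comm k H H (Δ k H 1)) = 1 := by
  refine Eq.trans ?_ (sourceMap_cop_one (k := k) (H := H))
  refine Δ_one_induction (p := fun D => pairing (S k H) LinearMap.id (TensorProduct.comm k H H D) =
    LinearMap.mul' k H (TensorProduct.comm k H H ((sourceMap k H).lTensor H D))) (by simp)
    (fun s t hs ht => by simp only [map_add, hs, ht]) fun y _ z hz => ?_
  obtain ⟨z, rfl⟩ := hz
  simp [S_targetMap]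

/-- `S(1₂) ⊗ S(1₁) = Δ(1)` -/
theorem map_S_S_Δ_one : TensorProduct.comm k H H (TensorProduct.map (S k H) (S k H) (Δ k H 1)) =
    Δ k H 1 := by
  have e1 : Δ k H 1 =
      TensorProduct.comm k H H (TensorProduct.map (S k H) (S k H) (Δ k H 1)) * Δ k H 1 := by
    have e0 : Δ k H 1 = (pairing (S k H) LinearMap.id
        (TensorProduct.comm k H H (Δ k H 1)) ⊗ₜ[k] (1 : H)) * Δ k H 1 := by
      rw [S_Δ_one_cop_sum, ← Algebra.TensorProduct.one_def, one_mul]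
    refine e0.trans ?_
    refine Δ_one_induction (p := fun D => (pairing (S k H) LinearMap.id
      (TensorProduct.comm k H H D) ⊗ₜ[k] (1 : H)) * Δ k H 1 =
      TensorProduct.comm k H H (TensorProduct.map (S k H) (S k H) D) * Δ k H 1) (by simp)
      (fun s t hs ht => by simp only [map_add, TensorProduct.add_tmul, add_mul, hs, ht])
      fun y hy z hz => ?_
    have e2 : (pairing (S k H) LinearMap.id (TensorProduct.comm k H H (y ⊗ₜ[k] z))) ⊗ₜ[k] (1 : H) =
        (S k H z ⊗ₜ[k] (1 : H)) * (y ⊗ₜ[k] (1 : H)) := by simp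
    rw [e2, mul_assoc, source_mul_Δ_one hy, ← mul_assoc]
    simp
  have e3 : ∀ y ∈ sourceSpace k H,
      TensorProduct.comm k H H (TensorProduct.map (S k H) (S k H) (Δ k H 1)) * (y ⊗ₜ[k] (1 : H)) =
      TensorProduct.comm k H H (TensorProduct.map (S k H) (S k H) (Δ k H 1)) *
        ((1 : H) ⊗ₜ[k] S k H y) := by
    intro y hy
    have a1 : ∀ D : H ⊗[k] H, TensorProduct.comm k H H (TensorProduct.map (S k H) (S k H) D) *
        (y ⊗ₜ[k] (1 : H)) = TensorProduct.comm k H H (TensorProduct.map (S k H) (S k H)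
          (((1 : H) ⊗ₜ[k] S k H y) * D)) := by
      intro D
      induction D using TensorProduct.induction_on with
      | zero => simp
      | add s t hs ht => simp only [map_add, mul_add, add_mul, hs, ht]
      | tmul a b => simp [S_mul_rev, S_S_of_source hy]
    have a2 : ∀ D : H ⊗[k] H, TensorProduct.comm k H H (TensorProduct.map (S k H) (S k H) D) *
        ((1 : H) ⊗ₜ[k] S k H y) = TensorProduct.comm k H H (TensorProduct.map (S k H) (S k H)
          ((y ⊗ₜ[k] (1 : H)) * D)) := by
      intro D
      induction D using TensorProduct.induction_on with
      | zero => simp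
      | add s t hs ht => simp only [map_add, mul_add, add_mul, hs, ht]
      | tmul a b => simp [S_mul_rev]
    rw [a1, a2, source_mul_Δ_one hy]
  have e4 : TensorProduct.comm k H H (TensorProduct.map (S k H) (S k H) (Δ k H 1)) *
      ((1 : H) ⊗ₜ[k] pairing (S k H) LinearMap.id (Δ k H 1)) =
      TensorProduct.comm k H H (TensorProduct.map (S k H) (S k H) (Δ k H 1)) * Δ k H 1 := by
    revert e3
    generalize TensorProduct.comm k H H (TensorProduct.map (S k H) (S k H) (Δ k H 1)) = F
    intro e3
    refine Δ_one_induction (p := fun D => F * ((1 : H) ⊗ₜ[k] pairing (S k H) LinearMap.id D) =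
      F * D) (by simp)
      (fun s t hs ht => by simp only [map_add, TensorProduct.tmul_add, mul_add, hs, ht])
      fun y hy z hz => ?_
    have := congrArg (· * ((1 : H) ⊗ₜ[k] z)) (e3 y hy)
    simpa [mul_assoc] using this.symm
  rw [S_Δ_one_mul_sum, ← Algebra.TensorProduct.one_def, mul_one] at e4
  rw [e4, ← e1]

/-- `S(1₁) ⊗ 1₂ = 1₂ ⊗ S(1₁)` -/
theorem rTensor_S_Δ_one : (S k H).rTensor H (Δ k H 1) =
    TensorProduct.comm k H H ((S k H).rTensor H (Δ k H 1)) := by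
  conv_lhs => rw [← map_S_S_Δ_one]
  refine Δ_one_induction (p := fun D => (S k H).rTensor H (TensorProduct.comm k H H
    (TensorProduct.map (S k H) (S k H) D)) = TensorProduct.comm k H H ((S k H).rTensor H D))
    (by simp) (fun s t hs ht => by simp only [map_add, hs, ht]) fun y hy z hz => ?_
  simp [S_S_of_target hz]

omit [Regular k H] in
/-- `h₁ε(h₂g) = h1₁ε(1₂g)` -/
theorem counit_mulRight_contract (g h : H) :
    TensorProduct.rid k H ((ε k H ∘ₗ LinearMap.mulRight k g).lTensor H (Δ k H h)) =
    h * TensorProduct.rid k H ((ε k H ∘ₗ LinearMap.mulRight k g).lTensor H (Δ k H 1)) := by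
  let K : H ⊗[k] H → H ⊗[k] (H ⊗[k] H) →ₗ[k] H := fun E =>
    (TensorProduct.rid k H).toLinearMap ∘ₗ (TensorProduct.map
      ((TensorProduct.rid k H).toLinearMap ∘ₗ (ε k H).lTensor H ∘ₗ LinearMap.mulLeft k E)
      (ε k H ∘ₗ LinearMap.mulRight k g)) ∘ₗ (TensorProduct.assoc k H H H).symm.toLinearMap
  have a1 : ∀ D E : H ⊗[k] H, K E ((Δ k H).lTensor H D) =
      TensorProduct.rid k H ((ε k H ∘ₗ LinearMap.mulRight k g).lTensor H (E * D)) := by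
    intro D E
    induction D using TensorProduct.induction_on with
    | zero => simp
    | add x y hx hy => simp only [map_add, mul_add, hx, hy]
    | tmul a b =>
      induction E using TensorProduct.induction_on with
      | zero => simp [K]
      | add x y hx hy =>
        simp only [map_add, add_mul, ← hx, ← hy]
        have : ∀ T, K (x + y) T = K x T + K y T := by
          intro T
          have : LinearMap.mulLeft k (x + y) = LinearMap.mulLeft k x + LinearMap.mulLeft k y := by
            ext; simp [add_mul]
          simp only [K, this, LinearMap.comp_add, TensorProduct.map_add_left, LinearMap.add_apply,
            LinearMap.add_comp]
        exact this _
      | tmul c d =>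
        have := WeakHopfAlgebra.counit_mul (k := k) d b g
        simp only [Algebra.TensorProduct.tmul_mul_tmul, LinearMap.lTensor_tmul,
          LinearMap.comp_apply, LinearMap.mulRight_apply, TensorProduct.rid_tmul]
        change _ = (ε k H (d * b * g)) • _
        rw [this]
        change _ = (LinearMap.mul' k k (TensorProduct.map _ _ (Δ k H b))) • _
        induction Δ k H b using TensorProduct.induction_on with
        | zero => simp
        | add x y hx hy => simp only [map_add, TensorProduct.tmul_add, add_smul, hx, hy]
        | tmul p q => simp [K, smul_smul, mul_comm]
  have a2 : ∀ D : H ⊗[k] H, K (Δ k H h) (TensorProduct.assoc k H H H ((Δ k H).rTensor H D)) =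
      h * TensorProduct.rid k H ((ε k H ∘ₗ LinearMap.mulRight k g).lTensor H D) := by
    intro D
    induction D using TensorProduct.induction_on with
    | zero => simp
    | add x y hx hy => simp only [map_add, mul_add, hx, hy]
    | tmul a b => simp [K, ← Δ_mul]
  rw [← a2, coassoc', a1, Δ_mul_one]

omit [Regular k H] in
/-- `h₁ ⊗ ε_s(h₂) = h1₁ ⊗ S(1₂)` -/
theorem lTensor_sourceMap (h : H) : (sourceMap k H).lTensor H (Δ k H h) =
    (h ⊗ₜ[k] (1 : H)) * (S k H).lTensor H (Δ k H 1) := by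
  have e : (S k H).lTensor H (Δ k H 1) = (sourceMap k H).lTensor H (Δ k H 1) := by
    refine Δ_one_induction (p := fun D => (S k H).lTensor H D = (sourceMap k H).lTensor H D)
      (by simp) (fun s t hs ht => by simp only [map_add, hs, ht]) fun y _ z hz => ?_
    obtain ⟨z, rfl⟩ := hz
    simp [S_targetMap]
  rw [e]
  let T : H ⊗[k] H → H →ₗ[k] H := fun F => (TensorProduct.rid k H).toLinearMap ∘ₗ
    (ε k H).lTensor H ∘ₗ LinearMap.mulRight k F ∘ₗ TensorProduct.mk k H H 1
  have key : ∀ F : H ⊗[k] H, (T F).lTensor H (Δ k H h) =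
      (h ⊗ₜ[k] (1 : H)) * (T F).lTensor H (Δ k H 1) := by
    intro F
    induction F using TensorProduct.induction_on with
    | zero =>
      have : T 0 = 0 := by ext; simp [T]
      simp [this]
    | add x y hx hy =>
      have : T (x + y) = T x + T y := by ext; simp [T, mul_add]
      simp only [this, LinearMap.lTensor_add, LinearMap.add_apply, mul_add, hx, hy]
    | tmul p q =>
      have : ∀ D : H ⊗[k] H, (T (p ⊗ₜ[k] q)).lTensor H D =
          TensorProduct.rid k H ((ε k H ∘ₗ LinearMap.mulRight k q).lTensor H D) ⊗ₜ[k] p := by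
        intro D
        induction D using TensorProduct.induction_on with
        | zero => simp
        | add x y hx hy => simp only [map_add, TensorProduct.add_tmul, hx, hy]
        | tmul a b => simp [T, TensorProduct.smul_tmul]
      rw [this, this, counit_mulRight_contract]
      simp
  exact key (Δ k H 1)

end Spaces

/-! ### Pairings of multiplicative and antimultiplicative maps -/

section PairingMul
variable {k : Type u} {H E : Type*} [Field k] [Ring H] [Algebra k H] [Ring E] [Algebra k E]
variable {f g : H →ₗ[k] E}

theorem pairing_fst_mul (hf : ∀ x y, f (x * y) = f x * f y) (x : H) (D : H ⊗[k] H) :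
    pairing f g ((x ⊗ₜ[k] (1 : H)) * D) = f x * pairing f g D := by
  induction D using TensorProduct.induction_on with
  | zero => simp
  | add s t hs ht => simp only [map_add, mul_add, hs, ht]
  | tmul a b => simp [hf, mul_assoc]

theorem pairing_mul_fst (hf : ∀ x y, f (x * y) = f x * f y) {x : H}
    (h : ∀ y, Commute (f x) (g y)) (D : H ⊗[k] H) :
    pairing f g (D * (x ⊗ₜ[k] (1 : H))) = pairing f g D * f x := by
  induction D using TensorProduct.induction_on with
  | zero => simp
  | add s t hs ht => simp only [map_add, add_mul, hs, ht]
  | tmul a b => simp [hf, mul_assoc, (h b).eq]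

theorem pairing_snd_mul (hg : ∀ x y, g (x * y) = g x * g y) {x : H}
    (h : ∀ y, Commute (f y) (g x)) (D : H ⊗[k] H) :
    pairing f g (((1 : H) ⊗ₜ[k] x) * D) = g x * pairing f g D := by
  induction D using TensorProduct.induction_on with
  | zero => simp
  | add s t hs ht => simp only [map_add, mul_add, hs, ht]
  | tmul a b => simp [hg, ← mul_assoc, (h a).eq]

theorem pairing_snd_mul_of_anti (hg : ∀ x y, g (x * y) = g y * g x) (x : H) (D : H ⊗[k] H) :
    pairing f g (((1 : H) ⊗ₜ[k] x) * D) = pairing f g D * g x := by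
  induction D using TensorProduct.induction_on with
  | zero => simp
  | add s t hs ht => simp only [map_add, mul_add, add_mul, hs, ht]
  | tmul a b => simp [hg, ← mul_assoc]

theorem pairing_mul_snd_of_anti (hg : ∀ x y, g (x * y) = g y * g x) {x : H}
    (h : ∀ y, Commute (f y) (g x)) (D : H ⊗[k] H) :
    pairing f g (D * ((1 : H) ⊗ₜ[k] x)) = g x * pairing f g D := by
  induction D using TensorProduct.induction_on with
  | zero => simp
  | add s t hs ht => simp only [map_add, mul_add, add_mul, hs, ht]
  | tmul a b => simp [hg, ← mul_assoc, (h a).eq]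

theorem pairing_mul_pairing (hf : ∀ x y, f (x * y) = f x * f y)
    (hg : ∀ x y, g (x * y) = g x * g y) (h : ∀ x y, Commute (f x) (g y)) (s t : H ⊗[k] H) :
    pairing f g (s * t) = pairing f g s * pairing f g t := by
  induction s using TensorProduct.induction_on with
  | zero => simp
  | add x y hx hy => simp only [map_add, add_mul, hx, hy]
  | tmul a b =>
    have : a ⊗ₜ[k] b = (a ⊗ₜ[k] (1 : H)) * ((1 : H) ⊗ₜ[k] b) := by simp
    rw [this, mul_assoc, pairing_fst_mul hf, pairing_snd_mul hg (fun y => h y b), ← mul_assoc,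
      ← this, pairing_tmul]

end PairingMul

/-! ### The reversed convolution product -/

section RConv
variable {k : Type u} {C E : Type*} [Field k] [AddCommGroup C] [Module k C] [Coalgebra k C]
  [Ring E] [Algebra k E]

/-- The reversed convolution product `c ↦ f(c₂)g(c₁)`. -/
noncomputable def rconv (f g : C →ₗ[k] E) : C →ₗ[k] E :=
  pairing f g ∘ₗ (TensorProduct.comm k C C).toLinearMap ∘ₗ Coalgebra.comul

theorem rconv_apply (f g : C →ₗ[k] E) (c : C) :
    rconv f g c = pairing f g (TensorProduct.comm k C C (Coalgebra.comul c)) := rfl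

theorem rconv_eq_conv_op (f g : C →ₗ[k] E) : rconv f g =
    (MulOpposite.opLinearEquiv k).symm.toLinearMap ∘ₗ
      conv ((MulOpposite.opLinearEquiv k).toLinearMap ∘ₗ g)
        ((MulOpposite.opLinearEquiv k).toLinearMap ∘ₗ f) := by
  ext c
  rw [rconv_apply, LinearMap.comp_apply, conv_apply]
  induction (Coalgebra.comul c : C ⊗[k] C) using TensorProduct.induction_on with
  | zero => simp
  | add s t hs ht => simp only [map_add, hs, ht]
  | tmul a b => simp

theorem rconv_assoc (f g h : C →ₗ[k] E) : rconv (rconv f g) h = rconv f (rconv g h) := by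
  have e : ∀ u : C →ₗ[k] Eᵐᵒᵖ, (MulOpposite.opLinearEquiv k).toLinearMap ∘ₗ
      ((MulOpposite.opLinearEquiv k).symm.toLinearMap ∘ₗ u) = u := fun u => by ext; simp
  rw [rconv_eq_conv_op, rconv_eq_conv_op f (rconv g h), rconv_eq_conv_op f g,
    rconv_eq_conv_op g h, e, e, conv_assoc]

theorem mul_rconv (a : E) (f g : C →ₗ[k] E) :
    LinearMap.mulLeft k a ∘ₗ rconv f g = rconv (LinearMap.mulLeft k a ∘ₗ f) g :=
  LinearMap.ext fun _ => mul_pairing a f g _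

theorem rconv_mul (a : E) (f g : C →ₗ[k] E) :
    LinearMap.mulRight k a ∘ₗ rconv f g = rconv f (LinearMap.mulRight k a ∘ₗ g) :=
  LinearMap.ext fun _ => pairing_mul a f g _

theorem conv_eq_rconv {f g : C →ₗ[k] E} (h : ∀ c d, Commute (f c) (g d)) :
    conv f g = rconv g f := LinearMap.ext (conv_comm_apply h)

end RConv

/-! ### Convolution products with the antipode -/

section Antipode
variable {k : Type u} {H : Type v} {E : Type*} [Field k] [Ring H] [Algebra k H]
  [WeakHopfAlgebra k H] [Ring E] [Algebra k E]

theorem comp_S_conv_of_mul {f : H →ₗ[k] E} (hf : ∀ x y, f (x * y) = f x * f y) :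
    conv (f ∘ₗ S k H) f = f ∘ₗ sourceMap k H := by
  ext h
  rw [← conv_S_id, conv_apply, LinearMap.comp_apply, conv_apply]
  induction Coalgebra.comul (R := k) h using TensorProduct.induction_on with
  | zero => simp
  | add s t hs ht => simp only [map_add, hs, ht]
  | tmul a b => simp [hf]

theorem comp_S_rconv {f : H →ₗ[k] E} (hf : ∀ x y, f (x * y) = f y * f x) :
    rconv (f ∘ₗ S k H) f = f ∘ₗ targetMap k H := by
  ext h
  rw [← conv_id_S, rconv_apply, LinearMap.comp_apply, conv_apply]
  induction Coalgebra.comul (R := k) h using TensorProduct.induction_on with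
  | zero => simp
  | add s t hs ht => simp only [map_add, hs, ht]
  | tmul a b => simp [hf]

theorem rconv_comp_S {f : H →ₗ[k] E} (hf : ∀ x y, f (x * y) = f y * f x) :
    rconv f (f ∘ₗ S k H) = f ∘ₗ sourceMap k H := by
  ext h
  rw [← conv_S_id, rconv_apply, LinearMap.comp_apply, conv_apply]
  induction Coalgebra.comul (R := k) h using TensorProduct.induction_on with
  | zero => simp
  | add s t hs ht => simp only [map_add, hs, ht]
  | tmul a b => simp [hf]

theorem comp_S_mul {f : H →ₗ[k] E} (hf : ∀ x y, f (x * y) = f y * f x) (x y : H) :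
    (f ∘ₗ S k H) (x * y) = (f ∘ₗ S k H) x * (f ∘ₗ S k H) y := by
  simp [S_mul_rev, hf]

/-- `f(z₁)g(z₂) = f(z) · f(1₁)g(1₂)` on the target space -/
theorem conv_of_target {f g : H →ₗ[k] E} (hf : ∀ x y, f (x * y) = f x * f y) {z : H}
    (hz : z ∈ targetSpace k H) : conv f g z = f z * conv f g 1 := by
  rw [conv_apply, conv_apply]
  change pairing f g (Δ k H z) = _
  rw [Δ_of_target hz, pairing_fst_mul hf]

/-- `f(y₁)g(y₂) = g(y) · f(1₁)g(1₂)` on the source space -/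
theorem conv_of_source {f g : H →ₗ[k] E} (hg : ∀ x y, g (x * y) = g x * g y) {y : H}
    (h : ∀ x, Commute (f x) (g y)) (hy : y ∈ sourceSpace k H) :
    conv f g y = g y * conv f g 1 := by
  rw [conv_apply, conv_apply]
  change pairing f g (Δ k H y) = _
  rw [Δ_of_source hy, pairing_snd_mul hg h]

/-- `f(1₁)g(1₂)g'(1₃) = g(1₁)g'(1₂) · f(1₁')g(1₂')` -/
theorem conv_conv_one {f g g' : H →ₗ[k] E} (hg : ∀ x y, g (x * y) = g x * g y)
    (h : ∀ x y, Commute (f x) (g y)) (h' : ∀ x y, Commute (f x) (g' y))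
    (h'' : ∀ x y, Commute (g x) (g' y)) :
    conv f (conv g g') 1 = conv g g' 1 * conv f g 1 := by
  have e := WeakHopfAlgebra.comul_one' (k := k) (H := H)
  change (Δ k H).lTensor H (Δ k H 1) = _ at e
  have e1 : conv f (conv g g') 1 = pairing f (pairing g g') ((Δ k H).lTensor H (Δ k H 1)) := by
    rw [pairing_lTensor]; rfl
  rw [e1, e, conv_apply, conv_apply]
  change pairing f (pairing g g') (((1 : H) ⊗ₜ[k] Δ k H 1) *
    TensorProduct.assoc k H H H (Δ k H 1 ⊗ₜ[k] (1 : H))) =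
      pairing g g' (Δ k H 1) * pairing f g (Δ k H 1)
  generalize Δ k H 1 = D
  have : ∀ D' : H ⊗[k] H, pairing f (pairing g g') (((1 : H) ⊗ₜ[k] D) *
    TensorProduct.assoc k H H H (D' ⊗ₜ[k] (1 : H))) = pairing g g' D * pairing f g D' := by
    intro D'
    induction D using TensorProduct.induction_on with
    | zero => simp
    | add s t hs ht => simp only [TensorProduct.tmul_add, map_add, add_mul, hs, ht]
    | tmul a b =>
      induction D' using TensorProduct.induction_on with
      | zero => simp
      | add s t hs ht => simp only [TensorProduct.add_tmul, map_add, mul_add, hs, ht]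
      | tmul c d =>
        simp only [TensorProduct.assoc_tmul, Algebra.TensorProduct.tmul_mul_tmul, one_mul, mul_one,
          pairing_tmul, hg]
        rw [mul_assoc (g a), (h'' d b).eq, ← mul_assoc (f c), (h c a).eq, mul_assoc, mul_assoc,
          ← mul_assoc (f c), (h' c b).eq, mul_assoc]
  exact this D

end Antipode

/-! ### The `R`-matrix -/

section RMatrix

theorem comm_mul_comm {k : Type u} {H : Type v} [Field k] [Ring H] [Algebra k H] (s t : H ⊗[k] H) :
    TensorProduct.comm k H H (s * t) =
      TensorProduct.comm k H H s * TensorProduct.comm k H H t :=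
  map_mul (Algebra.TensorProduct.comm k H H) s t

variable {k : Type u} {H : Type v} [Field k] [Ring H] [Algebra k H] [WeakHopfAlgebra k H]

variable {R : H ⊗[k] H}

namespace IsQuasitriangular

theorem cop_one_mul (hR : IsQuasitriangular R) : TensorProduct.comm k H H (Δ k H 1) * R = R := by
  obtain ⟨x, hx⟩ := hR.mem
  rw [hx, ← mul_assoc, ← mul_assoc, ← comm_mul_comm, Δ_one_mul]

theorem mul_Δ_one (hR : IsQuasitriangular R) : R * Δ k H 1 = R := by
  obtain ⟨x, hx⟩ := hR.mem
  rw [hx, mul_assoc, Δ_one_mul]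

/-- `(1 ⊗ z)R = R(z ⊗ 1)` -/
theorem snd_mul_of_target (hR : IsQuasitriangular R) {z : H} (hz : z ∈ targetSpace k H) :
    ((1 : H) ⊗ₜ[k] z) * R = R * (z ⊗ₜ[k] (1 : H)) := by
  have e := hR.intertwine z
  nth_rw 1 [Δ_of_target hz] at e
  rw [Δ_of_target' hz, comm_mul_comm, mul_assoc, hR.cop_one_mul, ← mul_assoc,
    hR.mul_Δ_one] at e
  simpa using e

/-- `(y ⊗ 1)R = R(1 ⊗ y)` -/
theorem fst_mul_of_source (hR : IsQuasitriangular R) {y : H} (hy : y ∈ sourceSpace k H) :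
    (y ⊗ₜ[k] (1 : H)) * R = R * ((1 : H) ⊗ₜ[k] y) := by
  have e := hR.intertwine y
  nth_rw 1 [Δ_of_source hy] at e
  rw [Δ_of_source' hy, comm_mul_comm, mul_assoc, hR.cop_one_mul, ← mul_assoc,
    hR.mul_Δ_one] at e
  simpa using e

theorem counit_fst (hR : IsQuasitriangular R) : TensorProduct.lid k H ((ε k H).rTensor H R) = 1 := by
  obtain ⟨R', -, h1, -⟩ := hR.exists_inv
  obtain ⟨v, hv⟩ : ∃ v, v = TensorProduct.lid k H ((ε k H).rTensor H R) := ⟨_, rfl⟩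
  rw [← hv]
  have e1 : R = ((1 : H) ⊗ₜ[k] v) * R := by
    have e := congrArg (fun t => (TensorProduct.lid k (H ⊗[k] H)) ((ε k H).rTensor (H ⊗[k] H) t))
      hR.comul_left
    have a1 : ∀ D : H ⊗[k] H, TensorProduct.lid k (H ⊗[k] H) ((ε k H).rTensor (H ⊗[k] H)
        (TensorProduct.assoc k H H H ((Δ k H).rTensor H D))) = D := by
      intro D
      induction D using TensorProduct.induction_on with
      | zero => simp
      | add s t hs ht => simp only [map_add, hs, ht]
      | tmul a b =>
        have : ∀ E : H ⊗[k] H, TensorProduct.lid k (H ⊗[k] H) ((ε k H).rTensor (H ⊗[k] H)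
            (TensorProduct.assoc k H H H (E ⊗ₜ[k] b))) =
            (TensorProduct.lid k H ((ε k H).rTensor H E)) ⊗ₜ[k] b := by
          intro E
          induction E using TensorProduct.induction_on with
          | zero => simp
          | add s t hs ht => simp only [map_add, TensorProduct.add_tmul, hs, ht]
          | tmul c d => simp [TensorProduct.smul_tmul']
        rw [LinearMap.rTensor_tmul, this, counit_left]
    have a2 : ∀ D E : H ⊗[k] H, TensorProduct.lid k (H ⊗[k] H) ((ε k H).rTensor (H ⊗[k] H)
        ((TensorProduct.mk k H H 1).lTensor H D * ((1 : H) ⊗ₜ[k] E))) =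
        ((1 : H) ⊗ₜ[k] TensorProduct.lid k H ((ε k H).rTensor H D)) * E := by
      intro D E
      induction D using TensorProduct.induction_on with
      | zero => simp
      | add s t hs ht => simp only [map_add, add_mul, TensorProduct.tmul_add, hs, ht]
      | tmul a b => simp
    simpa only [a1, a2, ← hv] using e
  have e2 : ((1 : H) ⊗ₜ[k] v) * TensorProduct.comm k H H (Δ k H 1) =
      TensorProduct.comm k H H (Δ k H 1) := by
    rw [← h1, ← mul_assoc, ← e1]
  have e3 := congrArg (fun t => TensorProduct.lid k H ((ε k H).rTensor H t)) e2
  have a3 : ∀ D : H ⊗[k] H, TensorProduct.lid k H ((ε k H).rTensor H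
      (((1 : H) ⊗ₜ[k] v) * TensorProduct.comm k H H D)) =
      v * TensorProduct.rid k H ((ε k H).lTensor H D) := by
    intro D
    induction D using TensorProduct.induction_on with
    | zero => simp
    | add s t hs ht => simp only [map_add, mul_add, hs, ht]
    | tmul a b => simp
  have a4 := a3 (Δ k H 1)
  have a5 : ∀ D : H ⊗[k] H, TensorProduct.lid k H ((ε k H).rTensor H
      (TensorProduct.comm k H H D)) = TensorProduct.rid k H ((ε k H).lTensor H D) := by
    intro D
    induction D using TensorProduct.induction_on with
    | zero => simp
    | add s t hs ht => simp only [map_add, hs, ht]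
    | tmul a b => simp
  simp only [a3, a5, counit_right, mul_one] at e3
  exact e3

theorem counit_snd (hR : IsQuasitriangular R) : TensorProduct.rid k H ((ε k H).lTensor H R) = 1 := by
  obtain ⟨R', -, -, h1⟩ := hR.exists_inv
  obtain ⟨v, hv⟩ : ∃ v, v = TensorProduct.rid k H ((ε k H).lTensor H R) := ⟨_, rfl⟩
  rw [← hv]
  have e1 : R = R * (v ⊗ₜ[k] (1 : H)) := by
    have e := congrArg ctr hR.comul_right
    have a1 : ∀ D : H ⊗[k] H, ctr ((Δ k H).lTensor H D) = D := by
      intro D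
      induction D using TensorProduct.induction_on with
      | zero => simp
      | add s t hs ht => simp only [map_add, hs, ht]
      | tmul a b => simp [ctr]
    have a2 : ∀ D E : H ⊗[k] H, ctr ((TensorProduct.mk k H H 1).lTensor H D *
        TensorProduct.assoc k H H H (E ⊗ₜ[k] (1 : H))) =
        D * (TensorProduct.rid k H ((ε k H).lTensor H E) ⊗ₜ[k] (1 : H)) := by
      intro D E
      induction E using TensorProduct.induction_on with
      | zero => simp
      | add s t hs ht => simp only [map_add, mul_add, TensorProduct.add_tmul, hs, ht]
      | tmul a b =>
        induction D using TensorProduct.induction_on with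
        | zero => simp
        | add s t hs ht => simp only [map_add, add_mul, hs, ht]
        | tmul c d => simp [ctr, TensorProduct.smul_tmul']
    simpa only [a1, a2, ← hv] using e
  have e2 : Δ k H 1 * (v ⊗ₜ[k] (1 : H)) = Δ k H 1 := by
    rw [← h1, mul_assoc, ← e1]
  have e3 := congrArg (fun t => TensorProduct.rid k H ((ε k H).lTensor H t)) e2
  have a3 : ∀ D : H ⊗[k] H, TensorProduct.rid k H ((ε k H).lTensor H
      (D * (v ⊗ₜ[k] (1 : H)))) = TensorProduct.rid k H ((ε k H).lTensor H D) * v := by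
    intro D
    induction D using TensorProduct.induction_on with
    | zero => simp
    | add s t hs ht => simp only [map_add, add_mul, hs, ht]
    | tmul a b => simp
  simp only [a3, counit_right, one_mul] at e3
  exact e3

section Regular
variable [Regular k H]

omit [Regular k H] in
/-- `(z ⊗ 1)R = (1 ⊗ S(z))R` -/
theorem fst_mul_of_target (hR : IsQuasitriangular R) {z : H} (hz : z ∈ targetSpace k H) :
    (z ⊗ₜ[k] (1 : H)) * R = ((1 : H) ⊗ₜ[k] S k H z) * R := by
  have e := congrArg (TensorProduct.comm k H H) (S_mul_Δ_one hz)
  simp only [comm_mul_comm, TensorProduct.comm_tmul] at e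
  rw [← hR.cop_one_mul, ← mul_assoc, ← e, mul_assoc]

/-- `(1 ⊗ y)R = (S(y) ⊗ 1)R` -/
theorem snd_mul_of_source (hR : IsQuasitriangular R) {y : H} (hy : y ∈ sourceSpace k H) :
    ((1 : H) ⊗ₜ[k] y) * R = (S k H y ⊗ₜ[k] (1 : H)) * R := by
  rw [hR.fst_mul_of_target (S_mem_targetSpace hy), S_S_of_source hy]

/-- `R(1 ⊗ z) = R(S(z) ⊗ 1)` -/
theorem mul_snd_of_target (hR : IsQuasitriangular R) {z : H} (hz : z ∈ targetSpace k H) :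
    R * ((1 : H) ⊗ₜ[k] z) = R * (S k H z ⊗ₜ[k] (1 : H)) := by
  rw [← hR.mul_Δ_one, mul_assoc, ← Δ_one_mul_S hz, mul_assoc]

omit [Regular k H] in
/-- `ε_t(R¹) ⊗ R² = 1₂ ⊗ 1₁` -/
theorem rTensor_targetMap (hR : IsQuasitriangular R) :
    (targetMap k H).rTensor H R = TensorProduct.comm k H H (Δ k H 1) := by
  -- `ε(1₁R¹)1₂ ⊗ R² = ε(R¹)1₂ ⊗ R²1₁`
  refine Δ_one_induction (p := fun D => ((TensorProduct.lid k H).toLinearMap ∘ₗ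
    (ε k H).rTensor H ∘ₗ LinearMap.mulLeft k D ∘ₗ (TensorProduct.mk k H H).flip 1).rTensor H R =
      TensorProduct.comm k H H D) ?_ ?_ fun y hy z hz => ?_
  · simp
  · intro s t hs ht
    rw [map_add, ← hs, ← ht, ← LinearMap.add_apply, ← LinearMap.rTensor_add]
    congr 2
    ext; simp [add_mul]
  · have a1 : ∀ F : H ⊗[k] H, ((TensorProduct.lid k H).toLinearMap ∘ₗ
        (ε k H).rTensor H ∘ₗ LinearMap.mulLeft k (y ⊗ₜ[k] z) ∘ₗ
          (TensorProduct.mk k H H).flip 1).rTensor H F =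
        z ⊗ₜ[k] TensorProduct.lid k H ((ε k H).rTensor H ((y ⊗ₜ[k] (1 : H)) * F)) := by
      intro F
      induction F using TensorProduct.induction_on with
      | zero => simp
      | add s t hs ht => simp only [map_add, mul_add, TensorProduct.tmul_add, hs, ht]
      | tmul a b => simp [TensorProduct.smul_tmul]
    have a2 : ∀ F : H ⊗[k] H, TensorProduct.lid k H ((ε k H).rTensor H (F * ((1 : H) ⊗ₜ[k] y))) =
        TensorProduct.lid k H ((ε k H).rTensor H F) * y := by
      intro F
      induction F using TensorProduct.induction_on with
      | zero => simp
      | add s t hs ht => simp only [map_add, add_mul, hs, ht]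
      | tmul a b => simp
    rw [a1, hR.fst_mul_of_source hy, a2, hR.counit_fst]
    simp

/-- `R¹ ⊗ ε_s(R²) = S(1₂) ⊗ 1₁` -/
theorem lTensor_sourceMap (hR : IsQuasitriangular R) :
    (sourceMap k H).lTensor H R = TensorProduct.comm k H H ((S k H).lTensor H (Δ k H 1)) := by
  -- `R¹ ⊗ ε(R²1₂)1₁ = R¹S(1₂) ⊗ ε(R²)1₁`
  refine Δ_one_induction (p := fun D => ((TensorProduct.rid k H).toLinearMap ∘ₗ
    (ε k H).lTensor H ∘ₗ LinearMap.mulRight k D ∘ₗ TensorProduct.mk k H H 1).lTensor H R =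
      TensorProduct.comm k H H ((S k H).lTensor H D)) ?_ ?_ fun y hy z hz => ?_
  · simp
  · intro s t hs ht
    rw [map_add, map_add, ← hs, ← ht, ← LinearMap.add_apply, ← LinearMap.lTensor_add]
    congr 2
    ext; simp [mul_add]
  · have a1 : ∀ F : H ⊗[k] H, ((TensorProduct.rid k H).toLinearMap ∘ₗ
        (ε k H).lTensor H ∘ₗ LinearMap.mulRight k (y ⊗ₜ[k] z) ∘ₗ
          TensorProduct.mk k H H 1).lTensor H F =
        TensorProduct.rid k H ((ε k H).lTensor H (F * ((1 : H) ⊗ₜ[k] z))) ⊗ₜ[k] y := by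
      intro F
      induction F using TensorProduct.induction_on with
      | zero => simp
      | add s t hs ht => simp only [map_add, add_mul, TensorProduct.add_tmul, hs, ht]
      | tmul a b => simp [TensorProduct.smul_tmul]
    have a2 : ∀ (F : H ⊗[k] H) (x : H), TensorProduct.rid k H ((ε k H).lTensor H
        (F * (x ⊗ₜ[k] (1 : H)))) = TensorProduct.rid k H ((ε k H).lTensor H F) * x := by
      intro F x
      induction F using TensorProduct.induction_on with
      | zero => simp
      | add s t hs ht => simp only [map_add, add_mul, hs, ht]
      | tmul a b => simp
    rw [a1, hR.mul_snd_of_target hz, a2, hR.counit_snd]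
    simp

/-- `R¹ ⊗ ε_t(R²) = S(1₁) ⊗ 1₂` -/
theorem lTensor_targetMap (hR : IsQuasitriangular R) :
    (targetMap k H).lTensor H R = (S k H).rTensor H (Δ k H 1) := by
  -- `R¹ ⊗ ε(1₁R²)1₂ = S(1₁)R¹ ⊗ ε(R²)1₂`
  refine Δ_one_induction (p := fun D => ((TensorProduct.lid k H).toLinearMap ∘ₗ
    (ε k H).rTensor H ∘ₗ LinearMap.mulLeft k D ∘ₗ (TensorProduct.mk k H H).flip 1).lTensor H R =
      (S k H).rTensor H D) ?_ ?_ fun y hy z hz => ?_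
  · simp
  · intro s t hs ht
    rw [map_add, ← hs, ← ht, ← LinearMap.add_apply, ← LinearMap.lTensor_add]
    congr 2
    ext; simp [add_mul]
  · have a1 : ∀ F : H ⊗[k] H, ((TensorProduct.lid k H).toLinearMap ∘ₗ
        (ε k H).rTensor H ∘ₗ LinearMap.mulLeft k (y ⊗ₜ[k] z) ∘ₗ
          (TensorProduct.mk k H H).flip 1).lTensor H F =
        TensorProduct.rid k H ((ε k H).lTensor H (((1 : H) ⊗ₜ[k] y) * F)) ⊗ₜ[k] z := by
      intro F
      induction F using TensorProduct.induction_on with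
      | zero => simp
      | add s t hs ht => simp only [map_add, mul_add, TensorProduct.add_tmul, hs, ht]
      | tmul a b => simp [TensorProduct.smul_tmul]
    have a2 : ∀ (F : H ⊗[k] H) (x : H), TensorProduct.rid k H ((ε k H).lTensor H
        ((x ⊗ₜ[k] (1 : H)) * F)) = x * TensorProduct.rid k H ((ε k H).lTensor H F) := by
      intro F x
      induction F using TensorProduct.induction_on with
      | zero => simp
      | add s t hs ht => simp only [map_add, mul_add, hs, ht]
      | tmul a b => simp
    rw [a1, hR.snd_mul_of_source hy, a2, hR.counit_snd]
    simp

end Regular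

section Hexagon
variable {E : Type*} [Ring E] [Algebra k E]

/-- The hexagon `(id ⊗ Δ)(R) = R₁₃R₁₂` for pairings: `f(R¹)g'(R²₂)g(R²₁)` is the product of
`f(R¹)g'(R²)` and `f(R¹)g(R²)`. -/
theorem pairing_rconv (hR : IsQuasitriangular R) {f g g' : H →ₗ[k] E}
    (hf : ∀ x y, f (x * y) = f x * f y) (h : ∀ x y, Commute (f x) (g' y)) :
    pairing f (rconv g' g) R = pairing f g' R * pairing f g R := by
  have e1 : pairing f (rconv g' g) R = pairing f (pairing g' g ∘ₗ
      (TensorProduct.comm k H H).toLinearMap) ((Δ k H).lTensor H R) := by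
    rw [pairing_lTensor]; rfl
  have key : ∀ s t : H ⊗[k] H, pairing f (pairing g' g ∘ₗ (TensorProduct.comm k H H).toLinearMap)
      ((TensorProduct.mk k H H 1).lTensor H s * TensorProduct.assoc k H H H (t ⊗ₜ[k] (1 : H))) =
      pairing f g' s * pairing f g t := by
    intro s t
    induction s using TensorProduct.induction_on with
    | zero => simp
    | add x y hx hy => simp only [map_add, add_mul, hx, hy]
    | tmul a b =>
      induction t using TensorProduct.induction_on with
      | zero => simp
      | add x y hx hy => simp only [map_add, TensorProduct.add_tmul, mul_add, hx, hy]
      | tmul c d =>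
        simp only [LinearMap.lTensor_tmul, TensorProduct.mk_apply, TensorProduct.assoc_tmul,
          Algebra.TensorProduct.tmul_mul_tmul, one_mul, mul_one, pairing_tmul, hf,
          LinearMap.comp_apply, LinearEquiv.coe_coe, TensorProduct.comm_tmul]
        rw [mul_assoc, ← mul_assoc (f c), (h c b).eq, mul_assoc, mul_assoc]
  rw [e1, hR.comul_right, key]

omit [WeakHopfAlgebra k H] in
theorem pairing_conv_aux {f g f' : H →ₗ[k] E} {p : H ⊗[k] H → H ⊗[k] H → E}
    (h0 : ∀ t, p 0 t = 0) (h0' : ∀ s, p s 0 = 0) (ha : ∀ s s' t, p (s + s') t = p s t + p s' t)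
    (ha' : ∀ s t t', p s (t + t') = p s t + p s t')
    (h : ∀ a b c d, f a * f' c * g (b * d) = p (a ⊗ₜ[k] b) (c ⊗ₜ[k] d)) (s t : H ⊗[k] H) :
    pairing (pairing f f') g ((TensorProduct.assoc k H H H).symm
      ((TensorProduct.mk k H H 1).lTensor H s * ((1 : H) ⊗ₜ[k] t))) = p s t := by
  induction s using TensorProduct.induction_on with
  | zero => simp [h0]
  | add x y hx hy => simp only [map_add, add_mul, hx, hy, ha]
  | tmul a b =>
    induction t using TensorProduct.induction_on with
    | zero => simp [h0']
    | add x y hx hy => simp only [map_add, TensorProduct.tmul_add, mul_add, hx, hy, ha']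
    | tmul c d => simp [← h]

theorem pairing_conv_eq (hR : IsQuasitriangular R) (f f' g : H →ₗ[k] E) :
    pairing (conv f f') g R = pairing (pairing f f') g ((TensorProduct.assoc k H H H).symm
      ((TensorProduct.mk k H H 1).lTensor H R * ((1 : H) ⊗ₜ[k] R))) := by
  rw [← hR.comul_left, LinearEquiv.symm_apply_apply, pairing_rTensor]; rfl

/-- The hexagon `(Δ ⊗ id)(R) = R₁₃R₂₃` for pairings with an antimultiplicative map:
`f(R¹₁)f'(R¹₂)g(R²)` is the product of `f'(R¹)g(R²)` and `f(R¹)g(R²)`. -/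
theorem pairing_conv_of_anti (hR : IsQuasitriangular R) {f f' g : H →ₗ[k] E}
    (hg : ∀ x y, g (x * y) = g y * g x) (h : ∀ x y, Commute (f x) (f' y))
    (h' : ∀ x y, Commute (f x) (g y)) :
    pairing (conv f f') g R = pairing f' g R * pairing f g R := by
  rw [hR.pairing_conv_eq]
  refine pairing_conv_aux (p := fun s t => pairing f' g t * pairing f g s) (by simp) (by simp)
    (by simp [mul_add]) (by simp [add_mul]) (fun a b c d => ?_) R R
  simp only [pairing_tmul, hg]
  rw [(h a c).eq, mul_assoc, ← mul_assoc (f a), (h' a d).eq, mul_assoc, mul_assoc]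

/-- The hexagon `(Δ ⊗ id)(R) = R₁₃R₂₃` for pairings with a multiplicative map:
`f(R¹₁)f'(R¹₂)g(R²)` is the product of `f(R¹)g(R²)` and `f'(R¹)g(R²)`. -/
theorem pairing_conv_of_mul (hR : IsQuasitriangular R) {f f' g : H →ₗ[k] E}
    (hg : ∀ x y, g (x * y) = g x * g y) (h : ∀ x y, Commute (f' x) (g y)) :
    pairing (conv f f') g R = pairing f g R * pairing f' g R := by
  rw [hR.pairing_conv_eq]
  refine pairing_conv_aux (p := fun s t => pairing f g s * pairing f' g t) (by simp) (by simp)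
    (by simp [add_mul]) (by simp [mul_add]) (fun a b c d => ?_) R R
  simp only [pairing_tmul, hg]
  rw [mul_assoc, ← mul_assoc (f' c), (h c b).eq, mul_assoc, mul_assoc]

end Hexagon

section Twist
variable {E : Type*} [Ring E] [Algebra k E] {a r : H →ₗ[k] E}

/-- `a(R¹)r(S(R²)) · a(R¹)r(R²) = a(S(1₁))r(1₂)` -/
theorem pairing_S_mul_pairing [Regular k H] (hR : IsQuasitriangular R)
    (ha : ∀ x y, a (x * y) = a x * a y) (hr : ∀ x y, r (x * y) = r y * r x)
    (h : ∀ x y, Commute (a x) (r y)) :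
    pairing a (r ∘ₗ S k H) R * pairing a r R = pairing a r ((S k H).rTensor H (Δ k H 1)) := by
  rw [← hR.pairing_rconv (g' := r ∘ₗ S k H) ha (fun x y => h x _), comp_S_rconv hr, ← pairing_lTensor,
    hR.lTensor_targetMap]

/-- `a(R¹)r(R²) · a(R¹)r(S(R²)) = a(S(1₂))r(1₁)` -/
theorem pairing_mul_pairing_S [Regular k H] (hR : IsQuasitriangular R)
    (ha : ∀ x y, a (x * y) = a x * a y) (hr : ∀ x y, r (x * y) = r y * r x)
    (h : ∀ x y, Commute (a x) (r y)) :
    pairing a r R * pairing a (r ∘ₗ S k H) R =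
      pairing a r (TensorProduct.comm k H H ((S k H).lTensor H (Δ k H 1))) := by
  rw [← hR.pairing_rconv ha h, rconv_comp_S hr, ← pairing_lTensor, hR.lTensor_sourceMap]

/-- `a(h₂) a(R¹)r(R²) r(h₁) = r(h₂) a(R¹)r(R²) a(h₁)`, from `Δᶜᵒᵖ(h)R = RΔ(h)` -/
theorem rconv_pairing (hR : IsQuasitriangular R)
    (ha : ∀ x y, a (x * y) = a x * a y) (hr : ∀ x y, r (x * y) = r y * r x)
    (h : ∀ x y, Commute (a x) (r y)) :
    rconv a (LinearMap.mulLeft k (pairing a r R) ∘ₗ r) =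
      rconv r (LinearMap.mulLeft k (pairing a r R) ∘ₗ a) := by
  ext x
  have e := congrArg (pairing a r) (hR.intertwine x)
  have a1 : ∀ D : H ⊗[k] H, pairing a r (TensorProduct.comm k H H D * R) =
      pairing a (LinearMap.mulLeft k (pairing a r R) ∘ₗ r) (TensorProduct.comm k H H D) := by
    intro D
    induction D using TensorProduct.induction_on with
    | zero => simp
    | add s t hs ht => simp only [map_add, add_mul, hs, ht]
    | tmul p q =>
      have : TensorProduct.comm k H H (p ⊗ₜ[k] q) =
        (q ⊗ₜ[k] (1 : H)) * ((1 : H) ⊗ₜ[k] p) := by simp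
      rw [this, mul_assoc, pairing_fst_mul ha, pairing_snd_mul_of_anti hr, ← this]
      simp
  have a2 : ∀ D : H ⊗[k] H, pairing a r (R * D) =
      pairing r (LinearMap.mulLeft k (pairing a r R) ∘ₗ a) (TensorProduct.comm k H H D) := by
    intro D
    induction D using TensorProduct.induction_on with
    | zero => simp
    | add s t hs ht => simp only [map_add, mul_add, hs, ht]
    | tmul p q =>
      have : p ⊗ₜ[k] q = (p ⊗ₜ[k] (1 : H)) * ((1 : H) ⊗ₜ[k] q) := by simp
      rw [this, ← mul_assoc, pairing_mul_snd_of_anti hr (fun y => h y q),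
        pairing_mul_fst ha (fun y => h p y)]
      simp
  rw [a1, a2] at e
  exact e

theorem rconv_pairing_sourceMap (hR : IsQuasitriangular R)
    (ha : ∀ x y, a (x * y) = a x * a y) (hr : ∀ x y, r (x * y) = r y * r x) (x : H) :
    rconv a (LinearMap.mulLeft k (pairing a r R) ∘ₗ r ∘ₗ sourceMap k H) x =
      a x * pairing a r R := by
  have e1 : rconv a (LinearMap.mulLeft k (pairing a r R) ∘ₗ r ∘ₗ sourceMap k H) x =
      pairing a (LinearMap.mulLeft k (pairing a r R) ∘ₗ r)
        (TensorProduct.comm k H H ((sourceMap k H).rTensor H (Δ k H x))) := by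
    rw [rconv_apply]
    change pairing a _ (TensorProduct.comm k H H (Δ k H x)) = _
    induction Δ k H x using TensorProduct.induction_on with
    | zero => simp
    | add s t hs ht => simp only [map_add, hs, ht]
    | tmul p q => simp
  have a1 : ∀ D : H ⊗[k] H, pairing a (LinearMap.mulLeft k (pairing a r R) ∘ₗ r)
      (TensorProduct.comm k H H D) = pairing a r (TensorProduct.comm k H H D * R) := by
    intro D
    induction D using TensorProduct.induction_on with
    | zero => simp
    | add s t hs ht => simp only [map_add, add_mul, hs, ht]
    | tmul p q =>
      have : TensorProduct.comm k H H (p ⊗ₜ[k] q) =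
        (q ⊗ₜ[k] (1 : H)) * ((1 : H) ⊗ₜ[k] p) := by simp
      rw [this, mul_assoc, pairing_fst_mul (g := r) ha, pairing_snd_mul_of_anti hr]
      simp
  rw [e1, rTensor_sourceMap, a1, comm_mul_comm, mul_assoc, hR.cop_one_mul, TensorProduct.comm_tmul,
    pairing_fst_mul ha]

theorem rconv_targetMap_pairing (hR : IsQuasitriangular R)
    (ha : ∀ x y, a (x * y) = a x * a y) (hr : ∀ x y, r (x * y) = r y * r x)
    (h : ∀ x y, Commute (a x) (r y)) (x : H) :
    rconv (r ∘ₗ targetMap k H) (LinearMap.mulLeft k (pairing a r R) ∘ₗ a) x =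
      pairing a r R * a x := by
  have e1 : rconv (r ∘ₗ targetMap k H) (LinearMap.mulLeft k (pairing a r R) ∘ₗ a) x =
      pairing r (LinearMap.mulLeft k (pairing a r R) ∘ₗ a)
        (TensorProduct.comm k H H ((targetMap k H).lTensor H (Δ k H x))) := by
    rw [rconv_apply]
    change pairing _ _ (TensorProduct.comm k H H (Δ k H x)) = _
    induction Δ k H x using TensorProduct.induction_on with
    | zero => simp
    | add s t hs ht => simp only [map_add, hs, ht]
    | tmul p q => simp
  have a1 : ∀ D : H ⊗[k] H, pairing r (LinearMap.mulLeft k (pairing a r R) ∘ₗ a)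
      (TensorProduct.comm k H H D) = pairing a r (R * D) := by
    intro D
    induction D using TensorProduct.induction_on with
    | zero => simp
    | add s t hs ht => simp only [map_add, mul_add, hs, ht]
    | tmul p q =>
      have : p ⊗ₜ[k] q = (p ⊗ₜ[k] (1 : H)) * ((1 : H) ⊗ₜ[k] q) := by simp
      rw [this, ← mul_assoc, pairing_mul_snd_of_anti hr (fun y => h y q),
        pairing_mul_fst ha (fun y => h p y)]
      simp
  rw [e1, WeakHopf.lTensor_targetMap, a1, ← mul_assoc, hR.mul_Δ_one,
    pairing_mul_fst ha (fun y => h x y)]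

/-- `a(R¹)r(R²) · r(S(h₁))a(h₂) = a(h₁)r(S(h₂)) · a(R¹)r(R²)`: the twist by the `R`-matrix carries
the order of factors of the adjoint action to that of Yetter–Drinfeld modules. -/
theorem pairing_mul_conv (hR : IsQuasitriangular R)
    (ha : ∀ x y, a (x * y) = a x * a y) (hr : ∀ x y, r (x * y) = r y * r x)
    (h : ∀ x y, Commute (a x) (r y)) (x : H) :
    pairing a r R * conv (r ∘ₗ S k H) a x = conv a (r ∘ₗ S k H) x * pairing a r R := by
  obtain ⟨P, hP⟩ : ∃ P, P = pairing a r R := ⟨_, rfl⟩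
  have e0 := congrArg (fun u => rconv (r ∘ₗ S k H) (rconv u (r ∘ₗ S k H)))
    (hR.rconv_pairing ha hr h)
  have b1 : rconv a (LinearMap.mulLeft k (pairing a r R) ∘ₗ r ∘ₗ sourceMap k H) =
      LinearMap.mulRight k (pairing a r R) ∘ₗ a :=
    LinearMap.ext (hR.rconv_pairing_sourceMap ha hr)
  have b2 : rconv (r ∘ₗ targetMap k H) (LinearMap.mulLeft k (pairing a r R) ∘ₗ a) =
      LinearMap.mulLeft k (pairing a r R) ∘ₗ a :=
    LinearMap.ext (hR.rconv_targetMap_pairing ha hr h)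
  rw [← hP] at e0 b1 b2 ⊢
  have e1 : rconv (rconv a (LinearMap.mulLeft k P ∘ₗ r)) (r ∘ₗ S k H) =
      LinearMap.mulRight k P ∘ₗ a := by
    rw [rconv_assoc, ← mul_rconv, rconv_comp_S hr, b1]
  have e2 : rconv (r ∘ₗ S k H) (rconv (rconv r (LinearMap.mulLeft k P ∘ₗ a)) (r ∘ₗ S k H)) =
      LinearMap.mulLeft k P ∘ₗ rconv a (r ∘ₗ S k H) := by
    rw [rconv_assoc, ← rconv_assoc, comp_S_rconv hr, ← rconv_assoc, b2, mul_rconv]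
  simp only [e1, e2] at e0
  rw [conv_eq_rconv (f := r ∘ₗ S k H) (g := a) (fun c d => (h d _).symm),
    conv_eq_rconv (f := a) (g := r ∘ₗ S k H) (fun c d => h c _)]
  rw [← rconv_mul] at e0
  exact (LinearMap.congr_fun e0 x).symm

/-- `a(R¹)r(R²) · a(h₁)r(h₂) = r(h₁)a(h₂) · a(R¹)r(R²)` for multiplicative `a` and `r`. -/
theorem pairing_mul_conv_of_mul (hR : IsQuasitriangular R)
    (ha : ∀ x y, a (x * y) = a x * a y) (hr : ∀ x y, r (x * y) = r x * r y)
    (h : ∀ x y, Commute (a x) (r y)) (x : H) :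
    pairing a r R * conv a r x = conv r a x * pairing a r R := by
  rw [conv_comm_apply (fun c d => (h d c).symm), conv_apply, ← pairing_mul_pairing ha hr h,
    ← pairing_mul_pairing ha hr h]
  exact congrArg _ (hR.intertwine x).symm

end Twist
end IsQuasitriangular
end RMatrix

/-! ### Commuting actions -/

section Actions
variable {k : Type u} {H : Type v} [Field k] [Ring H] [Algebra k H] [WeakHopfAlgebra k H]
  {X : Type*} [AddCommGroup X] [Module k X]

/-- Pairwise commuting actions of `H` on a vector space: two left actions `L` and `a`, and a right
action `r`. The basic example is `H ⊗ M` for an `H`-module `M`, where `L` and `r` are the left and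
right multiplications of `H`, and `a` is the action on `M`. -/
structure CommutingActions (L a r : H →ₗ[k] Module.End k X) : Prop where
  L_one : L 1 = 1
  a_one : a 1 = 1
  r_one : r 1 = 1
  L_mul : ∀ x y, L (x * y) = L x * L y
  a_mul : ∀ x y, a (x * y) = a x * a y
  r_mul : ∀ x y, r (x * y) = r y * r x
  L_a : ∀ x y, Commute (L x) (a y)
  L_r : ∀ x y, Commute (L x) (r y)
  a_r : ∀ x y, Commute (a x) (r y)

variable {L a r : H →ₗ[k] Module.End k X}

namespace CommutingActions

theorem rS_mul (hc : CommutingActions L a r) (x y : H) :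
    (r ∘ₗ S k H) (x * y) = (r ∘ₗ S k H) x * (r ∘ₗ S k H) y := comp_S_mul hc.r_mul x y

theorem L_rS (hc : CommutingActions L a r) (x y : H) : Commute (L x) ((r ∘ₗ S k H) y) :=
  hc.L_r x _

theorem a_rS (hc : CommutingActions L a r) (x y : H) : Commute (a x) ((r ∘ₗ S k H) y) :=
  hc.a_r x _

/-- The adjoint action `L(h₁)r(S(h₂))` is multiplicative, but `1` need not act as the identity. -/
theorem ad_mul (hc : CommutingActions L a r) (x y : H) :
    conv L (r ∘ₗ S k H) (x * y) = conv L (r ∘ₗ S k H) x * conv L (r ∘ₗ S k H) y := by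
  simp only [conv_apply]
  rw [WeakHopfAlgebra.comul_mul,
    pairing_mul_pairing hc.L_mul hc.rS_mul hc.L_rS]

theorem ad_source (hc : CommutingActions L a r) {y : H} (hy : y ∈ sourceSpace k H) :
    conv L (r ∘ₗ S k H) y = r (S k H y) * conv L (r ∘ₗ S k H) 1 :=
  conv_of_source hc.rS_mul (fun x => hc.L_rS x _) hy

/-- `1₁xS(1₂) = x` if `x` commutes with the source space. -/
theorem ad_one_apply (hc : CommutingActions L a r) {t : X}
    (ht : ∀ y ∈ sourceSpace k H, L y t = r y t) : conv L (r ∘ₗ S k H) 1 t = t := by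
  have e1 : pairing L (r ∘ₗ S k H) (Δ k H 1) t =
      pairing (r ∘ₗ S k H) r (TensorProduct.comm k H H (Δ k H 1)) t := by
    refine Δ_one_induction (p := fun D => pairing L (r ∘ₗ S k H) D t =
      pairing (r ∘ₗ S k H) r (TensorProduct.comm k H H D) t) (by simp)
      (fun s t hs ht => by simp only [map_add, LinearMap.add_apply, hs, ht]) fun y hy z hz => ?_
    rw [TensorProduct.comm_tmul, pairing_tmul, pairing_tmul, (hc.L_rS y _).eq,
      Module.End.mul_apply, ht y hy, Module.End.mul_apply]
  rw [conv_apply]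
  refine e1.trans ?_
  change rconv (r ∘ₗ S k H) r 1 t = t
  rw [comp_S_rconv hc.r_mul, LinearMap.comp_apply, targetMap_one, hc.r_one, Module.End.one_apply]

/-! ### Twisting by the `R`-matrix -/

section YD
variable {t : X}

/-- For a vector `t` with the properties of the coaction of a Yetter–Drinfeld module,
`1₁·t·S(1₂) = t`, where `1₁` acts by `a`. -/
theorem yd_conv_one (hc : CommutingActions L a r) (h1 : conv L a 1 t = t)
    (h2 : conv L (conv a (r ∘ₗ S k H)) 1 t = t) : conv a (r ∘ₗ S k H) 1 t = t := by
  rw [conv_conv_one hc.a_mul hc.L_a hc.L_rS hc.a_rS,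
    Module.End.mul_apply, h1] at h2
  exact h2

variable [Regular k H]

theorem yd_source_right (hc : CommutingActions L a r) (h3 : conv a (r ∘ₗ S k H) 1 t = t) {y : H}
    (hy : y ∈ sourceSpace k H) : a y t = r y t := by
  have e : a y * conv a (r ∘ₗ S k H) 1 = r y * conv a (r ∘ₗ S k H) 1 := by
    rw [conv_apply, ← pairing_fst_mul hc.a_mul]
    change pairing a (r ∘ₗ S k H) ((y ⊗ₜ[k] (1 : H)) * Δ k H 1) = _
    rw [source_mul_Δ_one hy, pairing_snd_mul hc.rS_mul (fun x => hc.a_rS x _),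
      LinearMap.comp_apply, S_S_of_source hy]
  have := LinearMap.congr_fun e t
  rwa [Module.End.mul_apply, Module.End.mul_apply, h3] at this

theorem yd_source_left (hc : CommutingActions L a r) (h1 : conv L a 1 t = t) {y : H}
    (hy : y ∈ sourceSpace k H) : L y t = a (S k H y) t := by
  have e : L y * conv L a 1 = a (S k H y) * conv L a 1 := by
    rw [conv_apply, ← pairing_fst_mul hc.L_mul]
    change pairing L a ((y ⊗ₜ[k] (1 : H)) * Δ k H 1) = _
    rw [source_mul_Δ_one hy, pairing_snd_mul hc.a_mul (fun x => hc.L_a x _)]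
  have := LinearMap.congr_fun e t
  rwa [Module.End.mul_apply, Module.End.mul_apply, h1] at this

variable {R : H ⊗[k] H}

/-- `PQt = t`, for the twist `P = a(R¹)r(R²)` and `Q = a(R¹)r(S(R²))`, if `t` has the properties of
the coaction of a Yetter–Drinfeld module. -/
theorem yd_untwist_twist (hR : IsQuasitriangular R) (hc : CommutingActions L a r)
    (h3 : conv a (r ∘ₗ S k H) 1 t = t) :
    pairing a r R (pairing a (r ∘ₗ S k H) R t) = t := by
  rw [← Module.End.mul_apply, hR.pairing_mul_pairing_S hc.a_mul hc.r_mul hc.a_r]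
  have e : pairing a r (TensorProduct.comm k H H ((S k H).lTensor H (Δ k H 1))) t =
      a (pairing (S k H) LinearMap.id (TensorProduct.comm k H H (Δ k H 1))) t := by
    refine Δ_one_induction (p := fun D => pairing a r (TensorProduct.comm k H H
      ((S k H).lTensor H D)) t = a (pairing (S k H) LinearMap.id (TensorProduct.comm k H H D)) t)
      (by simp) (fun s t hs ht => by simp only [map_add, LinearMap.add_apply, hs, ht])
      fun y hy z hz => ?_
    simp [hc.yd_source_right h3 hy, hc.a_mul]
  rw [e, S_Δ_one_cop_sum, hc.a_one, Module.End.one_apply]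

/-- The twist `Qt` centralizes the source space. -/
theorem yd_twist_source (hR : IsQuasitriangular R) (hc : CommutingActions L a r)
    (h1 : conv L a 1 t = t) {y : H} (hy : y ∈ sourceSpace k H) :
    L y (pairing a (r ∘ₗ S k H) R t) = r y (pairing a (r ∘ₗ S k H) R t) := by
  rw [← Module.End.mul_apply, (commute_pairing (hc.L_a y) (hc.L_rS y) R).eq,
    Module.End.mul_apply, hc.yd_source_left h1 hy, ← Module.End.mul_apply,
    ← pairing_mul_fst hc.a_mul (fun x => hc.a_rS _ _),
    ← hR.snd_mul_of_target (S_mem_targetSpace hy),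
    pairing_snd_mul hc.rS_mul (fun x => hc.a_rS _ _), LinearMap.comp_apply, S_S_of_source hy,
    Module.End.mul_apply]

end YD

theorem conv_rS_a_mul_pairing {R : H ⊗[k] H} (hR : IsQuasitriangular R)
    (hc : CommutingActions L a r) :
    conv (r ∘ₗ S k H) a 1 * pairing a (r ∘ₗ S k H) R = pairing a (r ∘ₗ S k H) R := by
  have : conv (r ∘ₗ S k H) a 1 =
      pairing a (r ∘ₗ S k H) (TensorProduct.comm k H H (Δ k H 1)) :=
    conv_comm_apply (f := r ∘ₗ S k H) (fun c d => (hc.a_rS d c).symm) 1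
  rw [this, ← pairing_mul_pairing hc.a_mul hc.rS_mul hc.a_rS, hR.cop_one_mul]

section Braided
variable {t : X} {R : H ⊗[k] H}

theorem conv_ad_a_one (hc : CommutingActions L a r)
    (ht : ∀ y ∈ sourceSpace k H, L y t = r y t) :
    conv (conv L (r ∘ₗ S k H)) a 1 t = conv (r ∘ₗ S k H) a 1 t := by
  rw [conv_assoc, conv_conv_one hc.rS_mul hc.L_rS hc.L_a
    (fun x y => (hc.a_r y _).symm), Module.End.mul_apply, hc.ad_one_apply ht]

theorem yd_twist_conv_one [Regular k H] (hR : IsQuasitriangular R) (hc : CommutingActions L a r)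
    (h1 : conv L a 1 t = t) : conv (conv L (r ∘ₗ S k H)) a 1 (pairing a (r ∘ₗ S k H) R t) =
      pairing a (r ∘ₗ S k H) R t := by
  rw [hc.conv_ad_a_one fun y hy => hc.yd_twist_source hR h1 hy, ← Module.End.mul_apply,
    hc.conv_rS_a_mul_pairing hR]

/-- `QPt = t`, if `t` has the properties of the coaction of a braided comodule. -/
theorem braided_untwist_twist [Regular k H] (hR : IsQuasitriangular R)
    (hc : CommutingActions L a r) (h : conv (r ∘ₗ S k H) a 1 t = t) :
    pairing a (r ∘ₗ S k H) R (pairing a r R t) = t := by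
  rw [← Module.End.mul_apply, hR.pairing_S_mul_pairing hc.a_mul hc.r_mul hc.a_r,
    rTensor_S_Δ_one]
  have e : ∀ D : H ⊗[k] H, pairing a r (TensorProduct.comm k H H ((S k H).rTensor H D)) =
      pairing (r ∘ₗ S k H) a D := by
    intro D
    rw [← pairing_rTensor]
    exact (pairing_comm (fun c d => (hc.a_r d c).symm) _).symm
  rw [e]
  exact h

theorem braided_twist_conv_one (hR : IsQuasitriangular R) (hc : CommutingActions L a r)
    (ht : ∀ y ∈ sourceSpace k H, L y t = r y t) : conv L a 1 (pairing a r R t) =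
      pairing a r R t := by
  have e : conv L a 1 (pairing a r R t) =
      pairing a r (TensorProduct.comm k H H (Δ k H 1) * R) t := by
    refine Δ_one_induction (p := fun D => pairing L a D (pairing a r R t) =
      pairing a r (TensorProduct.comm k H H D * R) t) (by simp)
      (fun s t hs ht => by simp only [map_add, add_mul, LinearMap.add_apply, hs, ht])
      fun y hy z hz => ?_
    have : TensorProduct.comm k H H (y ⊗ₜ[k] z) = (z ⊗ₜ[k] (1 : H)) * ((1 : H) ⊗ₜ[k] y) := by simp
    rw [this, mul_assoc, pairing_fst_mul hc.a_mul, pairing_snd_mul_of_anti hc.r_mul, pairing_tmul,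
      (hc.L_a y z).eq, Module.End.mul_apply, Module.End.mul_apply, Module.End.mul_apply, ← ht y hy,
      ← Module.End.mul_apply (L y), (commute_pairing (hc.L_a y) (hc.L_r y) R).eq,
      Module.End.mul_apply]
  rw [e, hR.cop_one_mul]

/-- The twist carries the diagonal action, with the adjoint action on `H`, to the operators in the
compatibility condition of a Yetter–Drinfeld module. -/
theorem twist_conv (hR : IsQuasitriangular R) (hc : CommutingActions L a r) (x : H) :
    pairing a r R * conv (conv L (r ∘ₗ S k H)) a x =
      conv L (conv a (r ∘ₗ S k H)) x * pairing a r R := by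
  have e : LinearMap.mulLeft k (pairing a r R) ∘ₗ conv (r ∘ₗ S k H) a =
      LinearMap.mulRight k (pairing a r R) ∘ₗ conv a (r ∘ₗ S k H) :=
    LinearMap.ext fun x => hR.pairing_mul_conv hc.a_mul hc.r_mul hc.a_r x
  rw [conv_assoc]
  have e1 := LinearMap.congr_fun (mul_conv (pairing a r R) L (conv (r ∘ₗ S k H) a)) x
  have e2 : conv (LinearMap.mulLeft k (pairing a r R) ∘ₗ L) (conv (r ∘ₗ S k H) a) =
      conv L (LinearMap.mulLeft k (pairing a r R) ∘ₗ conv (r ∘ₗ S k H) a) := by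
    rw [← conv_mulRight_left]
    refine conv_congr fun c d => ?_
    simp only [LinearMap.comp_apply, LinearMap.mulLeft_apply, LinearMap.mulRight_apply,
      (commute_pairing (hc.L_a c) (hc.L_r c) R).eq]
  rw [e2, e, ← conv_mul] at e1
  exact e1

theorem untwist_conv (hR : IsQuasitriangular R) (hc : CommutingActions L a r) (x : H) :
    pairing a (r ∘ₗ S k H) R * conv L (conv a (r ∘ₗ S k H)) x =
      conv (conv L (r ∘ₗ S k H)) a x * pairing a (r ∘ₗ S k H) R := by
  have e : LinearMap.mulLeft k (pairing a (r ∘ₗ S k H) R) ∘ₗ conv a (r ∘ₗ S k H) =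
      LinearMap.mulRight k (pairing a (r ∘ₗ S k H) R) ∘ₗ conv (r ∘ₗ S k H) a :=
    LinearMap.ext fun x => hR.pairing_mul_conv_of_mul hc.a_mul hc.rS_mul hc.a_rS x
  rw [conv_assoc]
  have e1 := LinearMap.congr_fun (mul_conv (pairing a (r ∘ₗ S k H) R) L (conv a (r ∘ₗ S k H))) x
  have e2 : conv (LinearMap.mulLeft k (pairing a (r ∘ₗ S k H) R) ∘ₗ L) (conv a (r ∘ₗ S k H)) =
      conv L (LinearMap.mulLeft k (pairing a (r ∘ₗ S k H) R) ∘ₗ conv a (r ∘ₗ S k H)) := by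
    rw [← conv_mulRight_left]
    refine conv_congr fun c d => ?_
    simp only [LinearMap.comp_apply, LinearMap.mulLeft_apply, LinearMap.mulRight_apply,
      (commute_pairing (hc.L_a c) (hc.L_rS c) R).eq]
  rw [e2, e, ← conv_mul] at e1
  exact e1

end Braided

/-! ### Coassociativity -/

section Coassoc
variable [Regular k H] {R : H ⊗[k] H} {r₁ : H →ₗ[k] Module.End k X}

/-- The twist with the adjoint action and `r₁` undoes the twist with `r₁ ∘ S`. Here `r₁` is the right
multiplication on the first factor of `H ⊗ (H ⊗ M)`; the hypothesis `h1` is `x₁1₁ ⊗ x₂1₂ = x₁ ⊗ x₂`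
for a vector in the image of the comultiplication. -/
theorem coassoc_twist (hR : IsQuasitriangular R) (hc : CommutingActions L a r)
    (hr₁ : ∀ x y, r₁ (x * y) = r₁ y * r₁ x) (hL : ∀ x y, Commute (L x) (r₁ y))
    (hr : ∀ x y, Commute (r x) (r₁ y)) {t : X} (ht : ∀ y ∈ sourceSpace k H, L y t = r y t)
    (h1 : conv r₁ r 1 t = t) :
    pairing (conv L (r ∘ₗ S k H)) r₁ R (pairing (conv L (r ∘ₗ S k H)) (r₁ ∘ₗ S k H) R t) = t := by
  have hcomm : ∀ x y, Commute (conv L (r ∘ₗ S k H) x) (r₁ y) := fun x y =>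
    commute_pairing_right (fun c => hL c y) (g := r ∘ₗ S k H) (fun c => hr _ y) _
  rw [← Module.End.mul_apply, hR.pairing_mul_pairing_S hc.ad_mul hr₁ hcomm]
  refine Eq.trans ?_ h1
  refine Δ_one_induction (p := fun D => pairing (conv L (r ∘ₗ S k H)) r₁
    (TensorProduct.comm k H H ((S k H).lTensor H D)) t = pairing r₁ r D t) (by simp)
    (fun s t hs ht => by simp only [map_add, LinearMap.add_apply, hs, ht]) fun y hy z hz => ?_
  rw [LinearMap.lTensor_tmul, TensorProduct.comm_tmul, pairing_tmul, pairing_tmul,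
    (hcomm _ y).eq, Module.End.mul_apply, hc.ad_source (S_mem_sourceSpace hz),
    Module.End.mul_apply, hc.ad_one_apply ht, S_S_of_target hz, Module.End.mul_apply]

omit [Regular k H] in
theorem conv_mul_pairing_ad (hR : IsQuasitriangular R) (hc : CommutingActions L a r)
    (hr₁ : ∀ x y, r₁ (x * y) = r₁ y * r₁ x) (hL : ∀ x y, Commute (L x) (r₁ y))
    (hr : ∀ x y, Commute (r x) (r₁ y)) :
    conv r₁ r 1 * pairing (conv L (r ∘ₗ S k H)) r₁ R = pairing (conv L (r ∘ₗ S k H)) r₁ R := by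
  have hcomm : ∀ x y, Commute (conv L (r ∘ₗ S k H) x) (r₁ y) := fun x y =>
    commute_pairing_right (fun c => hL c y) (g := r ∘ₗ S k H) (fun c => hr _ y) _
  have e0 : conv L (r ∘ₗ S k H) 1 * pairing (conv L (r ∘ₗ S k H)) r₁ R =
      pairing (conv L (r ∘ₗ S k H)) r₁ R := by
    rw [← pairing_fst_mul hc.ad_mul, ← Algebra.TensorProduct.one_def, one_mul]
  have e1 : conv r₁ r 1 * pairing (conv L (r ∘ₗ S k H)) r₁ R =
      r (pairing (S k H) LinearMap.id (Δ k H 1)) * pairing (conv L (r ∘ₗ S k H)) r₁ R := by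
    refine Δ_one_induction (p := fun D => pairing r₁ r D * pairing (conv L (r ∘ₗ S k H)) r₁ R =
      r (pairing (S k H) LinearMap.id D) * pairing (conv L (r ∘ₗ S k H)) r₁ R) (by simp)
      (fun s t hs ht => by simp only [map_add, add_mul, hs, ht]) fun y hy z hz => ?_
    rw [pairing_tmul, ← (hr z y).eq, mul_assoc,
      ← pairing_mul_snd_of_anti hr₁ (fun x => hcomm x y), ← hR.fst_mul_of_source hy,
      pairing_fst_mul hc.ad_mul, hc.ad_source hy, mul_assoc (r (S k H y)), e0, ← mul_assoc,
      pairing_tmul, hc.r_mul]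
    rfl
  rw [e1, S_Δ_one_mul_sum, hc.r_one, one_mul]

/-- Coassociativity over `H`, twisted twice, implies coassociativity over the braided
Hopf algebra. -/
theorem coassoc_untwist (hR : IsQuasitriangular R) (hc : CommutingActions L a r)
    (hr₁ : ∀ x y, r₁ (x * y) = r₁ y * r₁ x) (hL : ∀ x y, Commute (L x) (r₁ y))
    (ha : ∀ x y, Commute (a x) (r₁ y)) (hr : ∀ x y, Commute (r x) (r₁ y)) {t s : X}
    (h1 : conv r₁ r 1 t = t) (h2 : pairing a r₁ ((S k H).rTensor H (Δ k H 1)) t = t)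
    (h3 : conv (conv L (r ∘ₗ S k H)) a 1 s = s)
    (h4 : conv (r₁ ∘ₗ S k H) (conv L (r ∘ₗ S k H)) 1 s = s)
    (h : pairing a r R (pairing a r₁ R t) =
      pairing a r R (pairing a r₁ R (pairing (conv L (r ∘ₗ S k H)) r₁ R s))) :
    pairing (conv L (r ∘ₗ S k H)) (r₁ ∘ₗ S k H) R t = s := by
  have hcomm : ∀ x y, Commute (conv L (r ∘ₗ S k H) x) (r₁ y) := fun x y =>
    commute_pairing_right (fun c => hL c y) (g := r ∘ₗ S k H) (fun c => hr _ y) _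
  have hcomm' : ∀ x y, Commute (conv L (r ∘ₗ S k H) x) (a y) := fun x y =>
    commute_pairing_right (fun c => hc.L_a c y) (g := r ∘ₗ S k H) (fun c => (hc.a_r y _).symm) _
  -- removing the first twist
  have e1 : pairing a (r ∘ₗ S k H) R * pairing a r R * pairing a r₁ R =
      pairing a r₁ R * conv r₁ r 1 := by
    rw [hR.pairing_S_mul_pairing hc.a_mul hc.r_mul hc.a_r]
    refine Δ_one_induction (p := fun D => pairing a r ((S k H).rTensor H D) * pairing a r₁ R =
      pairing a r₁ R * pairing r₁ r D) (by simp)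
      (fun s t hs ht => by simp only [map_add, add_mul, mul_add, hs, ht]) fun y hy z hz => ?_
    rw [LinearMap.rTensor_tmul, pairing_tmul, pairing_tmul, (hc.a_r _ z).eq, mul_assoc,
      ← pairing_fst_mul hc.a_mul, hR.fst_mul_of_target (S_mem_targetSpace hy), S_S_of_source hy,
      pairing_snd_mul_of_anti hr₁, ← mul_assoc,
      (commute_pairing (fun x => (hc.a_r x z).symm) (hr z) R).eq, mul_assoc, (hr z y).eq]
  -- removing the second twist
  have e2 : pairing a (r₁ ∘ₗ S k H) R * pairing a r₁ R =
      pairing a r₁ ((S k H).rTensor H (Δ k H 1)) :=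
    hR.pairing_S_mul_pairing hc.a_mul hr₁ ha
  have e3 : pairing a r₁ ((S k H).rTensor H (Δ k H 1)) * pairing (conv L (r ∘ₗ S k H)) r₁ R =
      pairing (conv L (r ∘ₗ S k H)) r₁ R * conv (conv L (r ∘ₗ S k H)) a 1 := by
    have a1 : conv (conv L (r ∘ₗ S k H)) a 1 = pairing (conv L (r ∘ₗ S k H)) a
        (TensorProduct.comm k H H (TensorProduct.map (S k H) (S k H) (Δ k H 1))) := by
      rw [map_S_S_Δ_one]; rfl
    rw [a1]
    refine Δ_one_induction (p := fun D => pairing a r₁ ((S k H).rTensor H D) *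
      pairing (conv L (r ∘ₗ S k H)) r₁ R = pairing (conv L (r ∘ₗ S k H)) r₁ R *
        pairing (conv L (r ∘ₗ S k H)) a (TensorProduct.comm k H H
          (TensorProduct.map (S k H) (S k H) D))) (by simp)
      (fun s t hs ht => by simp only [map_add, add_mul, mul_add, hs, ht]) fun y hy z hz => ?_
    rw [LinearMap.rTensor_tmul, pairing_tmul, TensorProduct.map_tmul, TensorProduct.comm_tmul,
      pairing_tmul, mul_assoc, ← pairing_mul_snd_of_anti hr₁ (fun x => hcomm x z),
      hR.mul_snd_of_target hz, pairing_mul_fst hc.ad_mul (fun x => hcomm _ x), ← mul_assoc,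
      (commute_pairing (fun x => (hcomm' x _).symm) (ha _) R).eq, mul_assoc, (hcomm' _ _).eq]
  have e4 : ∀ w, pairing a (r₁ ∘ₗ S k H) R (pairing a (r ∘ₗ S k H) R (pairing a r R
      (pairing a r₁ R w))) = pairing a r₁ ((S k H).rTensor H (Δ k H 1)) (conv r₁ r 1 w) := by
    intro w
    have := LinearMap.congr_fun e1 w
    simp only [Module.End.mul_apply] at this
    rw [this, ← Module.End.mul_apply (pairing a (r₁ ∘ₗ S k H) R), e2]
  have e5 : t = pairing (conv L (r ∘ₗ S k H)) r₁ R s := by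
    have := congrArg (fun w => pairing a (r₁ ∘ₗ S k H) R (pairing a (r ∘ₗ S k H) R w)) h
    simp only [e4, h1, h2] at this
    rw [this, ← Module.End.mul_apply (conv r₁ r 1), hc.conv_mul_pairing_ad hR hr₁ hL hr,
      ← Module.End.mul_apply, e3, Module.End.mul_apply, h3]
  rw [e5, ← Module.End.mul_apply, hR.pairing_S_mul_pairing hc.ad_mul hr₁ hcomm,
    rTensor_S_Δ_one]
  refine Eq.trans (congrFun (congrArg _ ?_) s) h4
  rw [conv_apply, ← pairing_rTensor]
  exact (pairing_comm (fun c d => (hcomm d c).symm) _).symm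

end Coassoc

end CommutingActions
end Actions

/-! ### The actions on `H ⊗ M` -/

section Operators
variable (k : Type u) (H : Type v) [Field k] [Ring H] [Algebra k H]

/-- The action `f ↦ id ⊗ f` of endomorphisms on `U ⊗ X`. -/
noncomputable def liftL (U : Type*) {X : Type*} [AddCommGroup U] [Module k U] [AddCommGroup X]
    [Module k X] : Module.End k X →ₗ[k] Module.End k (U ⊗[k] X) := LinearMap.lTensorHom U

/-- The action `f ↦ f ⊗ id` of endomorphisms on `X ⊗ V`. -/
noncomputable def liftR (V : Type*) {X : Type*} [AddCommGroup V] [Module k V] [AddCommGroup X]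
    [Module k X] : Module.End k X →ₗ[k] Module.End k (X ⊗[k] V) := LinearMap.rTensorHom V

/-- `b ↦ (x ↦ bx)` -/
noncomputable def lmul : H →ₗ[k] Module.End k H := LinearMap.mul k H

/-- The left multiplication of `H` on `H ⊗ V`. -/
noncomputable def opL (V : Type*) [AddCommGroup V] [Module k V] :
    H →ₗ[k] Module.End k (H ⊗[k] V) := liftR k V ∘ₗ lmul k H

/-- The right multiplication of `H` on `H ⊗ V`. -/
noncomputable def opR (V : Type*) [AddCommGroup V] [Module k V] :
    H →ₗ[k] Module.End k (H ⊗[k] V) := liftR k V ∘ₗ rmul k H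

/-- The action of `H` on the module `M` in `U ⊗ M`. -/
noncomputable def opA (U M : Type*) [AddCommGroup U] [Module k U] [AddCommGroup M] [Module k M]
    [Module H M] [IsScalarTower k H M] :
    H →ₗ[k] Module.End k (U ⊗[k] M) := liftL k U ∘ₗ lsm k H M

/-- The left multiplication of `H` on the second factor of `H ⊗ (H ⊗ V)`. -/
noncomputable abbrev opL₂ (V : Type*) [AddCommGroup V] [Module k V] :
    H →ₗ[k] Module.End k (H ⊗[k] (H ⊗[k] V)) := liftL k H ∘ₗ opL k H V

/-- The right multiplication of `H` on the second factor of `H ⊗ (H ⊗ V)`. -/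
noncomputable abbrev opR₂ (V : Type*) [AddCommGroup V] [Module k V] :
    H →ₗ[k] Module.End k (H ⊗[k] (H ⊗[k] V)) := liftL k H ∘ₗ opR k H V

/-- The action of `H` on the module `M` in `H ⊗ (H ⊗ M)`. -/
noncomputable abbrev opA₂ (M : Type*) [AddCommGroup M] [Module k M] [Module H M]
    [IsScalarTower k H M] : H →ₗ[k] Module.End k (H ⊗[k] (H ⊗[k] M)) := liftL k H ∘ₗ opA k H H M

variable {k H}
variable {V M : Type*} [AddCommGroup V] [Module k V] [AddCommGroup M] [Module k M]
    [Module H M] [IsScalarTower k H M]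

@[simp] theorem liftL_tmul {U X : Type*} [AddCommGroup U] [Module k U] [AddCommGroup X]
    [Module k X] (f : Module.End k X) (u : U) (x : X) :
    liftL k U f (u ⊗ₜ[k] x) = u ⊗ₜ[k] f x := rfl

@[simp] theorem liftR_tmul {X : Type*} [AddCommGroup X] [Module k X] (f : Module.End k X)
    (x : X) (v : V) : liftR k V f (x ⊗ₜ[k] v) = f x ⊗ₜ[k] v := rfl

@[simp] theorem opL_tmul (h x : H) (v : V) : opL k H V h (x ⊗ₜ[k] v) = (h * x) ⊗ₜ[k] v := rfl

@[simp] theorem opR_tmul (h x : H) (v : V) : opR k H V h (x ⊗ₜ[k] v) = (x * h) ⊗ₜ[k] v := rfl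

@[simp] theorem opA_tmul (h : H) (v : V) (m : M) :
    opA k H V M h (v ⊗ₜ[k] m) = v ⊗ₜ[k] (h • m) := rfl

theorem act₂_eq_pairing {U : Type*} [AddCommGroup U] [Module k U] (f : H →ₗ[k] Module.End k U)
    (g : H →ₗ[k] Module.End k V) (D : H ⊗[k] H) : act₂ f g D =
      pairing (liftR k V ∘ₗ f) (liftL k U ∘ₗ g) D := by
  induction D using TensorProduct.induction_on with
  | zero => simp
  | add s t hs ht => simp only [map_add, hs, ht]
  | tmul a b =>
    refine TensorProduct.ext' fun x y => ?_
    simp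

theorem dact_eq_pairing (D : H ⊗[k] H) : dact k H H M D = pairing (opL k H M) (opA k H H M) D := by
  rw [dact, act₂_eq_pairing]
  congr 2

theorem commutingActions : CommutingActions (opL k H M) (opA k H H M) (opR k H M) where
  L_one := TensorProduct.ext' fun x y => by simp
  a_one := TensorProduct.ext' fun x y => by simp
  r_one := TensorProduct.ext' fun x y => by simp
  L_mul g h := TensorProduct.ext' fun x y => by simp [mul_assoc]
  a_mul g h := TensorProduct.ext' fun x y => by simp [mul_smul]
  r_mul g h := TensorProduct.ext' fun x y => by simp [mul_assoc]
  L_a g h := TensorProduct.ext' fun x y => by simp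
  L_r g h := TensorProduct.ext' fun x y => by simp [mul_assoc]
  a_r g h := TensorProduct.ext' fun x y => by simp

theorem liftL_mul {U X : Type*} [AddCommGroup U] [Module k U] [AddCommGroup X] [Module k X]
    (f g : Module.End k X) : liftL k U (f * g) =
      (liftL k U f : Module.End k (U ⊗[k] X)) * liftL k U g :=
  LinearMap.lTensor_comp U f g

theorem liftL_one {U X : Type*} [AddCommGroup U] [Module k U] [AddCommGroup X] [Module k X] :
    liftL k U (1 : Module.End k X) = (1 : Module.End k (U ⊗[k] X)) :=
  LinearMap.lTensor_id U X

theorem CommutingActions.lTensor (U : Type*) {X : Type*} [AddCommGroup U] [Module k U]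
    [AddCommGroup X] [Module k X] {L a r : H →ₗ[k] Module.End k X} (hc : CommutingActions L a r) :
    CommutingActions (X := U ⊗[k] X) (liftL k U ∘ₗ L) (liftL k U ∘ₗ a)
      (liftL k U ∘ₗ r) where
  L_one := by simp only [LinearMap.comp_apply, hc.L_one, liftL_one]
  a_one := by simp only [LinearMap.comp_apply, hc.a_one, liftL_one]
  r_one := by simp only [LinearMap.comp_apply, hc.r_one, liftL_one]
  L_mul x y := by simp only [LinearMap.comp_apply, hc.L_mul, liftL_mul]
  a_mul x y := by simp only [LinearMap.comp_apply, hc.a_mul, liftL_mul]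
  r_mul x y := by simp only [LinearMap.comp_apply, hc.r_mul, liftL_mul]
  L_a x y := by
    simp only [LinearMap.comp_apply, commute_iff_eq, ← liftL_mul, (hc.L_a x y).eq]
  L_r x y := by
    simp only [LinearMap.comp_apply, commute_iff_eq, ← liftL_mul, (hc.L_r x y).eq]
  a_r x y := by
    simp only [LinearMap.comp_apply, commute_iff_eq, ← liftL_mul, (hc.a_r x y).eq]

/-- An intertwiner of two families of operators intertwines their pairings. -/
theorem comp_pairing {X X' : Type*} [AddCommGroup X] [Module k X] [AddCommGroup X'] [Module k X']
    (c : X →ₗ[k] X') {f g : H →ₗ[k] Module.End k X} {f' g' : H →ₗ[k] Module.End k X'}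
    (hf : ∀ h x, c (f h x) = f' h (c x)) (hg : ∀ h x, c (g h x) = g' h (c x)) (D : H ⊗[k] H)
    (x : X) : c (pairing f g D x) = pairing f' g' D (c x) := by
  induction D using TensorProduct.induction_on with
  | zero => simp
  | add s t hs ht => simp only [map_add, LinearMap.add_apply, hs, ht]
  | tmul a b => simp [hf, hg]

theorem liftL_pairing (U : Type*) {X : Type*} [AddCommGroup U] [Module k U]
    [AddCommGroup X] [Module k X] (f g : H →ₗ[k] Module.End k X) (D : H ⊗[k] H) :
    liftL k U (pairing f g D) = pairing (A := Module.End k (U ⊗[k] X))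
      (liftL k U ∘ₗ f) (liftL k U ∘ₗ g) D := by
  induction D using TensorProduct.induction_on with
  | zero => simp
  | add s t hs ht => simp only [map_add, hs, ht]
  | tmul a b => simp only [pairing_tmul, liftL_mul, LinearMap.comp_apply]

variable [WeakHopfAlgebra k H]

theorem liftL_conv (U : Type*) {X : Type*} [AddCommGroup U] [Module k U]
    [AddCommGroup X] [Module k X] (f g : H →ₗ[k] Module.End k X) :
    liftL k U ∘ₗ conv f g = conv (A := Module.End k (U ⊗[k] X))
      (liftL k U ∘ₗ f) (liftL k U ∘ₗ g) :=
  LinearMap.ext fun _ => liftL_pairing U f g _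

omit [WeakHopfAlgebra k H] in
theorem liftR_pairing (V : Type*) {X : Type*} [AddCommGroup V] [Module k V]
    [AddCommGroup X] [Module k X] (f g : H →ₗ[k] Module.End k X) (D : H ⊗[k] H) :
    liftR k V (pairing f g D) = pairing (A := Module.End k (X ⊗[k] V))
      (liftR k V ∘ₗ f) (liftR k V ∘ₗ g) D := by
  induction D using TensorProduct.induction_on with
  | zero => simp
  | add s t hs ht => simp only [map_add, hs, ht]
  | tmul a b =>
    simp only [pairing_tmul, LinearMap.comp_apply]
    exact LinearMap.rTensor_comp V (f a) (g b)

theorem liftR_conv (V : Type*) {X : Type*} [AddCommGroup V] [Module k V]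
    [AddCommGroup X] [Module k X] (f g : H →ₗ[k] Module.End k X) :
    liftR k V ∘ₗ conv f g = conv (A := Module.End k (X ⊗[k] V))
      (liftR k V ∘ₗ f) (liftR k V ∘ₗ g) :=
  LinearMap.ext fun _ => liftR_pairing V f g _

theorem ad_eq_conv : ad k H = conv (lmul k H) (rmul k H ∘ₗ S k H) := by
  refine LinearMap.ext fun h => ?_
  rw [ad, LinearMap.comp_apply, conv_apply]
  induction Δ k H h using TensorProduct.induction_on with
  | zero => simp
  | add s t hs ht => simp only [map_add, hs, ht]
  | tmul a b =>
    rw [pairing_tmul]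
    ext x
    simp [sandwich, rmul, lmul]

theorem liftR_ad : liftR k V ∘ₗ ad k H =
    conv (A := Module.End k (H ⊗[k] V)) (opL k H V) (opR k H V ∘ₗ S k H) := by
  rw [ad_eq_conv]
  exact LinearMap.ext fun _ => liftR_pairing V (lmul k H) (rmul k H ∘ₗ S k H) _

theorem act₂_ad (D : H ⊗[k] H) : act₂ (ad k H) (lsm k H M) D =
    pairing (conv (opL k H M) (opR k H M ∘ₗ S k H)) (opA k H H M) D := by
  rw [act₂_eq_pairing, liftR_ad]; rfl

theorem act₂_sandwich (h : H) : act₂ (sandwich k H) (lsm k H M)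
    ((TensorProduct.assoc k H H H).symm ((TensorProduct.comm k H H).toLinearMap.lTensor H
      ((Δ k H).lTensor H (Δ k H h)))) =
    conv (opL k H M) (conv (opA k H H M) (opR k H M ∘ₗ S k H)) h := by
  rw [conv_apply]
  induction Δ k H h using TensorProduct.induction_on with
  | zero => simp
  | add s t hs ht => simp only [map_add, hs, ht]
  | tmul a b =>
    rw [LinearMap.lTensor_tmul, LinearMap.lTensor_tmul, pairing_tmul, conv_apply]
    induction Δ k H b using TensorProduct.induction_on with
    | zero => simp
    | add s t hs ht => simp only [map_add, TensorProduct.tmul_add, mul_add, hs, ht]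
    | tmul c d =>
      refine TensorProduct.ext' fun x m => ?_
      simp [sandwich]

/-- The map `x ⊗ m ↦ x₁ ⊗ x₂ ⊗ m` -/
noncomputable def comulT (k : Type u) (H : Type v) [Field k] [Ring H] [Algebra k H]
    [WeakHopfAlgebra k H] (V : Type*) [AddCommGroup V] [Module k V] :
    H ⊗[k] V →ₗ[k] H ⊗[k] (H ⊗[k] V) :=
  (TensorProduct.assoc k H H V).toLinearMap ∘ₗ (Δ k H).rTensor V

theorem comulT_opA (h : H) (t : H ⊗[k] M) : comulT k H M (opA k H H M h t) =
    liftL k H (opA k H H M h) (comulT k H M t) := by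
  induction t using TensorProduct.induction_on with
  | zero => simp
  | add s t hs ht => simp only [map_add, hs, ht]
  | tmul x m =>
    simp only [opA_tmul, comulT, LinearMap.comp_apply, LinearMap.rTensor_tmul]
    induction Δ k H x using TensorProduct.induction_on with
    | zero => simp
    | add s t hs ht => simp only [map_add, TensorProduct.add_tmul, hs, ht]
    | tmul c d => simp

theorem comulT_opR (h : H) (t : H ⊗[k] V) : comulT k H V (opR k H V h t) =
    conv (A := Module.End k (H ⊗[k] (H ⊗[k] V))) (opR k H (H ⊗[k] V)) (opR₂ k H V) h (comulT k H V t) := by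
  induction t using TensorProduct.induction_on with
  | zero => simp
  | add s t hs ht => simp only [map_add, hs, ht]
  | tmul x m =>
    simp only [opR_tmul, comulT, LinearMap.comp_apply, LinearMap.rTensor_tmul, Δ_mul, conv_apply]
    induction Δ k H x using TensorProduct.induction_on with
    | zero => simp
    | add s t hs ht => simp only [map_add, add_mul, TensorProduct.add_tmul, hs, ht]
    | tmul c d =>
      change _ = pairing (A := Module.End k (H ⊗[k] (H ⊗[k] V))) _ _ (Δ k H h) _
      induction Δ k H h using TensorProduct.induction_on with
      | zero => simp
      | add s t hs ht =>
        simp only [map_add, LinearMap.add_apply, mul_add, TensorProduct.add_tmul, hs, ht]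
      | tmul p q => simp

/-- `x₁1₁ ⊗ x₂1₂ = x₁ ⊗ x₂` -/
theorem conv_one_comulT (t : H ⊗[k] V) :
    conv (A := Module.End k (H ⊗[k] (H ⊗[k] V))) (opR k H (H ⊗[k] V)) (opR₂ k H V) 1 (comulT k H V t) =
      comulT k H V t := by
  rw [← comulT_opR]
  congr 1
  induction t using TensorProduct.induction_on with
  | zero => simp
  | add s t hs ht => simp only [map_add, hs, ht]
  | tmul x m => simp

/-- `Δ(xz) = x₁z ⊗ x₂` for `z` in the target space -/
theorem comulT_opR_target {z : H} (hz : z ∈ targetSpace k H) (t : H ⊗[k] V) :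
    comulT k H V (opR k H V z t) = opR k H (H ⊗[k] V) z (comulT k H V t) := by
  induction t using TensorProduct.induction_on with
  | zero => simp
  | add s t hs ht => simp only [map_add, hs, ht]
  | tmul x m =>
    simp only [opR_tmul, comulT, LinearMap.comp_apply, LinearMap.rTensor_tmul, Δ_mul]
    rw [Δ_of_target' hz, ← mul_assoc, Δ_mul_one]
    induction Δ k H x using TensorProduct.induction_on with
    | zero => simp
    | add s t hs ht => simp only [map_add, add_mul, TensorProduct.add_tmul, hs, ht]
    | tmul c d => simp

/-- `Δ(xy) = x₁ ⊗ x₂y` for `y` in the source space -/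
theorem comulT_opR_source {y : H} (hy : y ∈ sourceSpace k H) (t : H ⊗[k] V) :
    comulT k H V (opR k H V y t) = liftL k H (opR k H V y) (comulT k H V t) := by
  induction t using TensorProduct.induction_on with
  | zero => simp
  | add s t hs ht => simp only [map_add, hs, ht]
  | tmul x m =>
    simp only [opR_tmul, comulT, LinearMap.comp_apply, LinearMap.rTensor_tmul, Δ_mul]
    rw [Δ_of_source' hy, ← mul_assoc, Δ_mul_one]
    induction Δ k H x using TensorProduct.induction_on with
    | zero => simp
    | add s t hs ht => simp only [map_add, add_mul, TensorProduct.add_tmul, hs, ht]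
    | tmul c d => simp

/-- `Δ(yx) = x₁ ⊗ yx₂` for `y` in the source space -/
theorem comulT_opL_source {y : H} (hy : y ∈ sourceSpace k H) (t : H ⊗[k] V) :
    comulT k H V (opL k H V y t) = liftL k H (opL k H V y) (comulT k H V t) := by
  induction t using TensorProduct.induction_on with
  | zero => simp
  | add s t hs ht => simp only [map_add, hs, ht]
  | tmul x m =>
    simp only [opL_tmul, comulT, LinearMap.comp_apply, LinearMap.rTensor_tmul, Δ_mul]
    rw [Δ_of_source hy, mul_assoc, Δ_one_mul]
    induction Δ k H x using TensorProduct.induction_on with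
    | zero => simp
    | add s t hs ht => simp only [map_add, mul_add, TensorProduct.add_tmul, hs, ht]
    | tmul c d => simp

/-- A tensor lies in `C_H(H_s) ⊗ V` if left and right multiplications by `H_s` agree on it. -/
theorem mem_range_centralizer_iff (t : H ⊗[k] V) :
    t ∈ LinearMap.range ((centralizer k H).val.toLinearMap.rTensor V) ↔
      ∀ y ∈ sourceSpace k H, opL k H V y t = opR k H V y t := by
  constructor
  · rintro ⟨t, rfl⟩ y hy
    induction t using TensorProduct.induction_on with
    | zero => simp
    | add s t hs ht => simp only [map_add, hs, ht]
    | tmul x m =>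
      have := x.2
      have := (Subalgebra.mem_centralizer_iff k).1 this y hy
      simp [this]
  · intro h
    classical
    let b := Module.Basis.ofVectorSpace k V
    let e := TensorProduct.equivFinsuppOfBasisRight (M := H) b
    have h1 : ∀ (y : H) (t : H ⊗[k] V) i, e (opL k H V y t) i = y * e t i := by
      intro y t i
      induction t using TensorProduct.induction_on with
      | zero => simp
      | add s t hs ht => simp only [map_add, Finsupp.add_apply, mul_add, hs, ht]
      | tmul x m => simp [e]
    have h2 : ∀ (y : H) (t : H ⊗[k] V) i, e (opR k H V y t) i = e t i * y := by
      intro y t i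
      induction t using TensorProduct.induction_on with
      | zero => simp
      | add s t hs ht => simp only [map_add, Finsupp.add_apply, add_mul, hs, ht]
      | tmul x m => simp [e]
    have h3 : ∀ i, e t i ∈ centralizer k H := by
      intro i
      refine (Subalgebra.mem_centralizer_iff k).2 fun y hy => ?_
      rw [← h1, h y hy, h2]
    have h4 : t = (e t).sum fun i x => x ⊗ₜ[k] b i := by
      conv_lhs => rw [← e.symm_apply_apply t]
      exact TensorProduct.equivFinsuppOfBasisRight_symm_apply b (e t)
    rw [h4]
    exact Submodule.sum_mem _ fun i _ => ⟨(⟨e t i, h3 i⟩ : centralizer k H) ⊗ₜ[k] b i, rfl⟩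

end Operators

/-! ### Yetter–Drinfeld modules and braided comodules -/

section Twists
variable {k : Type u} {H : Type v} [Field k] [Ring H] [Algebra k H] [WeakHopfAlgebra k H]

theorem CommutingActions.ad_a {X : Type*} [AddCommGroup X] [Module k X]
    {L a r : H →ₗ[k] Module.End k X} (hc : CommutingActions L a r) (x y : H) :
    Commute (conv L (r ∘ₗ S k H) x) (a y) :=
  commute_pairing_right (fun c => hc.L_a c y) (g := r ∘ₗ S k H) (fun _ => (hc.a_r y _).symm) _

section Module
variable (k H)
variable (M : Type*) [AddCommGroup M] [Module k M] [Module H M] [IsScalarTower k H M]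

/-- The adjoint action on the first factor of `H ⊗ M`. -/
noncomputable abbrev opAd (V : Type*) [AddCommGroup V] [Module k V] :
    H →ₗ[k] Module.End k (H ⊗[k] V) :=
  conv (A := Module.End k (H ⊗[k] V)) (opL k H V) (opR k H V ∘ₗ S k H)

/-- The adjoint action on the second factor of `H ⊗ (H ⊗ M)`. -/
noncomputable abbrev opAd₂ (V : Type*) [AddCommGroup V] [Module k V] :
    H →ₗ[k] Module.End k (H ⊗[k] (H ⊗[k] V)) :=
  conv (A := Module.End k (H ⊗[k] (H ⊗[k] V))) (opL₂ k H V) (opR₂ k H V ∘ₗ S k H)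

variable {k H}
variable (R : H ⊗[k] H)

/-- The operator `x ⊗ m ↦ xR² ⊗ R¹·m` on `H ⊗ M`. -/
noncomputable abbrev twistOp : Module.End k (H ⊗[k] M) :=
  pairing (A := Module.End k (H ⊗[k] M)) (opA k H H M) (opR k H M) R

/-- The operator `x ⊗ m ↦ xS(R²) ⊗ R¹·m` on `H ⊗ M`. -/
noncomputable abbrev untwistOp : Module.End k (H ⊗[k] M) :=
  pairing (A := Module.End k (H ⊗[k] M)) (opA k H H M) (opR k H M ∘ₗ S k H) R

variable {M}

omit [WeakHopfAlgebra k H] in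
theorem act₂_rmul : act₂ (rmul k H) (lsm k H M) (TensorProduct.comm k H H R) = twistOp M R := by
  induction R using TensorProduct.induction_on with
  | zero => simp
  | add s t hs ht => simp only [map_add, hs, ht]
  | tmul p q => exact TensorProduct.ext' fun x m => by simp [rmul]

theorem act₂_rmul_S : act₂ (rmul k H ∘ₗ S k H) (lsm k H M) (TensorProduct.comm k H H R) =
    untwistOp M R := by
  induction R using TensorProduct.induction_on with
  | zero => simp
  | add s t hs ht => simp only [map_add, hs, ht]
  | tmul p q => exact TensorProduct.ext' fun x m => by simp [rmul]

theorem mem_TProd_iff (t : H ⊗[k] M) : t ∈ TProd k H H M ↔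
    conv (A := Module.End k (H ⊗[k] M)) (opL k H M) (opA k H H M) 1 t = t := by
  rw [conv_apply, ← dact_eq_pairing]
  refine ⟨fun h => dact_inc ⟨t, h⟩, fun h => ?_⟩
  exact ⟨t, h⟩

theorem opAd₂_eq (V : Type*) [AddCommGroup V] [Module k V] :
    opAd₂ k H V = liftL k H ∘ₗ opAd k H V := by
  rw [opAd, liftL_conv]; rfl

theorem braidedΔ_eq (V : Type*) [AddCommGroup V] [Module k V] (t : H ⊗[k] V) :
    TensorProduct.assoc k H H V ((braidedΔ R).rTensor V t) =
      pairing (A := Module.End k (H ⊗[k] (H ⊗[k] V))) (opAd₂ k H V)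
        (opR k H (H ⊗[k] V) ∘ₗ S k H) R (comulT k H V t) := by
  rw [opAd₂_eq, opAd, ← liftR_ad]
  induction t using TensorProduct.induction_on with
  | zero => simp
  | add s t hs ht => simp only [map_add, hs, ht]
  | tmul x v =>
    rw [LinearMap.rTensor_tmul, braidedΔ, LinearMap.comp_apply, comulT, LinearMap.comp_apply,
      LinearMap.rTensor_tmul]
    induction Δ k H x using TensorProduct.induction_on with
    | zero => simp
    | add s t hs ht => simp only [map_add, TensorProduct.add_tmul, hs, ht]
    | tmul c d =>
      induction R using TensorProduct.induction_on with
      | zero => simp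
      | add s t hs ht => simp only [map_add, TensorProduct.add_tmul, LinearMap.add_apply, hs, ht]
      | tmul p q => simp [rmul]

/-! ### The twists and coassociativity -/

section Coassoc
variable {R}

omit [WeakHopfAlgebra k H] in
theorem opR_mul {V : Type*} [AddCommGroup V] [Module k V] (x y : H) :
    opR k H V (x * y) = opR k H V y * opR k H V x :=
  TensorProduct.ext' fun z v => by simp [mul_assoc]

omit [WeakHopfAlgebra k H] in
theorem opR_commute_liftL {V : Type*} [AddCommGroup V] [Module k V] (h : H) (f : Module.End k V) :
    Commute (opR k H V h) (liftL k H f) :=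
  TensorProduct.ext' fun x v => by simp

omit [WeakHopfAlgebra k H] in
theorem lTensor_opR {V W : Type*} [AddCommGroup V] [Module k V] [AddCommGroup W] [Module k W]
    (f : V →ₗ[k] W) (h : H) (t : H ⊗[k] V) :
    f.lTensor H (opR k H V h t) = opR k H W h (f.lTensor H t) := by
  induction t using TensorProduct.induction_on with
  | zero => simp
  | add s t hs ht => simp only [map_add, hs, ht]
  | tmul x v => simp

theorem lTensor_opA {ρ : M →ₗ[k] H ⊗[k] M} (hρ : ∀ (h : H) m, ρ (h • m) =
    conv (A := Module.End k (H ⊗[k] M)) (opAd k H M) (opA k H H M) h (ρ m)) (h : H)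
    (t : H ⊗[k] M) : ρ.lTensor H (opA k H H M h t) =
      conv (A := Module.End k (H ⊗[k] (H ⊗[k] M))) (opAd₂ k H M) (opA₂ k H M) h
        (ρ.lTensor H t) := by
  rw [opAd₂_eq, opA₂, ← liftL_conv, LinearMap.comp_apply]
  induction t using TensorProduct.induction_on with
  | zero => simp
  | add s t hs ht => simp only [map_add, hs, ht]
  | tmul x m => simp [hρ]

omit [WeakHopfAlgebra k H] in
theorem liftL_twistOp : liftL k H (twistOp M R) =
    pairing (A := Module.End k (H ⊗[k] (H ⊗[k] M))) (opA₂ k H M) (opR₂ k H M) R :=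
  liftL_pairing H _ _ _

variable (hR : IsQuasitriangular R)
include hR

/-- The comultiplication of `H` after the twist, by the hexagon `(id ⊗ Δ)(R) = R₁₃R₁₂`. -/
theorem comulT_twistOp (t : H ⊗[k] M) : comulT k H M (twistOp M R t) =
    pairing (A := Module.End k (H ⊗[k] (H ⊗[k] M))) (opA₂ k H M) (opR₂ k H M) R
      (pairing (A := Module.End k (H ⊗[k] (H ⊗[k] M))) (opA₂ k H M) (opR k H (H ⊗[k] M)) R
        (comulT k H M t)) := by
  have hc : CommutingActions (opL₂ k H M) (opA₂ k H M) (opR₂ k H M) :=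
    (commutingActions (k := k) (H := H) (M := M)).lTensor H
  have e := comp_pairing (comulT k H M) (f' := opA₂ k H M)
    (g' := conv (A := Module.End k (H ⊗[k] (H ⊗[k] M))) (opR k H (H ⊗[k] M)) (opR₂ k H M))
    comulT_opA comulT_opR R t
  rw [e, conv_eq_rconv (fun c d => opR_commute_liftL c _), hR.pairing_rconv hc.a_mul hc.a_r]
  rfl

/-- The twist of an iterated coaction, for a map `ρ : M → H ⊗ M` which is linear with respect to
the adjoint action on `H`. -/
theorem lTensor_twistOp {ρ : M →ₗ[k] H ⊗[k] M} (hρ : ∀ (h : H) m, ρ (h • m) =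
    conv (A := Module.End k (H ⊗[k] M)) (opAd k H M) (opA k H H M) h (ρ m)) (t : H ⊗[k] M) :
    ρ.lTensor H (twistOp M R t) =
      pairing (A := Module.End k (H ⊗[k] (H ⊗[k] M))) (opA₂ k H M) (opR k H (H ⊗[k] M)) R
        (pairing (A := Module.End k (H ⊗[k] (H ⊗[k] M))) (opAd₂ k H M) (opR k H (H ⊗[k] M)) R
          (ρ.lTensor H t)) := by
  have hc : CommutingActions (opL₂ k H M) (opA₂ k H M) (opR₂ k H M) :=
    (commutingActions (k := k) (H := H) (M := M)).lTensor H
  have e := comp_pairing (ρ.lTensor H)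
    (f := opA k H H M) (g := opR k H M)
    (f' := conv (A := Module.End k (H ⊗[k] (H ⊗[k] M))) (opAd₂ k H M) (opA₂ k H M))
    (g' := opR k H (H ⊗[k] M)) (lTensor_opA hρ) (lTensor_opR ρ) R t
  have hcomm : ∀ x y, Commute (opAd₂ k H M x) (opR k H (H ⊗[k] M) y) := fun x y => by
    rw [opAd₂_eq]; exact (opR_commute_liftL _ _).symm
  rw [e, hR.pairing_conv_of_anti opR_mul hc.ad_a hcomm]
  rfl

end Coassoc
end Module
end Twists

section WellDefined
variable {k : Type u} {H : Type v} [Field k] [Ring H] [Algebra k H] [WeakHopfAlgebra k H]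

/-! ### The counit and the twist -/

section Counit
variable {M : Type*} [AddCommGroup M] [Module k M] [Module H M] [IsScalarTower k H M]

variable (k H M) in
/-- `x ⊗ m ↦ ε(x)m` -/
noncomputable def counitT : H ⊗[k] M →ₗ[k] M :=
  (TensorProduct.lid k M).toLinearMap ∘ₗ (ε k H).rTensor M

omit [Module H M] [IsScalarTower k H M] in
@[simp] theorem counitT_tmul (x : H) (m : M) : counitT k H M (x ⊗ₜ[k] m) = ε k H x • m := by
  simp [counitT]

theorem counitT_opA (h : H) (t : H ⊗[k] M) :
    counitT k H M (opA k H H M h t) = h • counitT k H M t := by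
  induction t using TensorProduct.induction_on with
  | zero => simp
  | add s t hs ht => simp only [map_add, smul_add, hs, ht]
  | tmul x m => simpa using (smul_algebra_smul_comm _ _ _).symm

omit [Module H M] [IsScalarTower k H M] in
theorem counitT_opR_targetMap (h : H) (t : H ⊗[k] M) :
    counitT k H M (opR k H M (targetMap k H h) t) = counitT k H M (opR k H M h t) := by
  induction t using TensorProduct.induction_on with
  | zero => simp
  | add s t hs ht => simp only [map_add, hs, ht]
  | tmul x m => simp [counit_mul_targetMap]

theorem counitT_pairing_targetMap (D : H ⊗[k] H) (t : H ⊗[k] M) :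
    counitT k H M (pairing (A := Module.End k (H ⊗[k] M)) (opA k H H M) (opR k H M)
      ((targetMap k H).lTensor H D) t) =
    counitT k H M (pairing (A := Module.End k (H ⊗[k] M)) (opA k H H M) (opR k H M) D t) := by
  induction D using TensorProduct.induction_on with
  | zero => simp
  | add s t hs ht => simp only [map_add, LinearMap.add_apply, hs, ht]
  | tmul p q => simp [counitT_opA, counitT_opR_targetMap]

/-- `ε(1₁m₍₋₁₎)1₂·m₍₀₎ = ε_t(m₍₋₁₎)·m₍₀₎` -/
theorem counitT_conv_one (t : H ⊗[k] M) :
    counitT k H M (pairing (A := Module.End k (H ⊗[k] M)) (opL k H M) (opA k H H M)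
      (Δ k H 1) t) = TensorProduct.lift (lsm k H M ∘ₗ targetMap k H) t := by
  induction t using TensorProduct.induction_on with
  | zero => simp
  | add s t hs ht => simp only [map_add, hs, ht]
  | tmul x m =>
    rw [TensorProduct.lift.tmul, LinearMap.comp_apply, targetMap_apply]
    induction Δ k H 1 using TensorProduct.induction_on with
    | zero => simp
    | add s t hs ht => simp only [map_add, add_mul, LinearMap.add_apply, hs, ht]
    | tmul p q => simp

/-- The twist turns the counit `ε_t` of the braided Hopf algebra into that of `H`. -/
theorem counitT_twistOp [Regular k H] {R : H ⊗[k] H} (hR : IsQuasitriangular R) {t : H ⊗[k] M}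
    (ht : ∀ y ∈ sourceSpace k H, opL k H M y t = opR k H M y t) :
    counitT k H M (twistOp M R t) = TensorProduct.lift (lsm k H M ∘ₗ targetMap k H) t := by
  rw [← counitT_conv_one, ← counitT_pairing_targetMap, hR.lTensor_targetMap, rTensor_S_Δ_one]
  refine Δ_one_induction (p := fun D => counitT k H M (pairing (A := Module.End k (H ⊗[k] M))
      (opA k H H M) (opR k H M) (TensorProduct.comm k H H ((S k H).rTensor H D)) t) =
    counitT k H M (pairing (A := Module.End k (H ⊗[k] M)) (opL k H M) (opA k H H M) D t))
    (by simp) (fun s t hs ht => by simp only [map_add, LinearMap.add_apply, hs, ht])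
    fun y hy z hz => ?_
  rw [LinearMap.rTensor_tmul, TensorProduct.comm_tmul, pairing_tmul, pairing_tmul,
    (commutingActions.L_a y z).eq, Module.End.mul_apply, Module.End.mul_apply, counitT_opA,
    counitT_opA, ← targetMap_of_source hy, counitT_opR_targetMap, ht y hy]

end Counit

variable {R : H ⊗[k] H}

variable (R) in
omit [WeakHopfAlgebra k H] in
theorem toYD_eq (M : CoactMod k H) :
    toYD R M = ⟨M.toHMod, twistOp M.toHMod.carrier R ∘ₗ M.coact⟩ := by
  rw [toYD, twist, act₂_rmul]

variable (R) in
theorem toBraided_eq (N : CoactMod k H) :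
    toBraided R N = ⟨N.toHMod, untwistOp N.toHMod.carrier R ∘ₗ N.coact⟩ := by
  rw [toBraided, twist, act₂_rmul_S]

namespace IsYetterDrinfeld
variable {N : CoactMod k H} (hN : IsYetterDrinfeld N)
include hN

theorem conv_one (n : N.toHMod.carrier) :
    conv (A := Module.End k (H ⊗[k] N.toHMod.carrier)) (opL k H _) (opA k H H _) 1 (N.coact n) =
      N.coact n :=
  (mem_TProd_iff _).1 (hN.mem_tensor n)

theorem coact_smul (h : H) (n : N.toHMod.carrier) : N.coact (h • n) =
    conv (A := Module.End k (H ⊗[k] N.toHMod.carrier)) (opL k H _)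
      (conv (A := Module.End k (H ⊗[k] N.toHMod.carrier)) (opA k H H _) (opR k H _ ∘ₗ S k H)) h
      (N.coact n) := by
  rw [hN.compat, act₂_sandwich]

/-- `n₍₋₁₎S(1₂) ⊗ 1₁·n₍₀₎ = n₍₋₁₎ ⊗ n₍₀₎` -/
theorem conv_a_rS_one (n : N.toHMod.carrier) :
    conv (A := Module.End k (H ⊗[k] N.toHMod.carrier)) (opA k H H _) (opR k H _ ∘ₗ S k H) 1
      (N.coact n) = N.coact n := by
  refine commutingActions.yd_conv_one (hN.conv_one n) ?_
  rw [← hN.coact_smul, one_smul]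

variable [Regular k H] (hR : IsQuasitriangular R)
include hR

theorem twist_untwist : toYD R (toBraided R N) = N := by
  rw [toBraided_eq, toYD_eq]
  exact congrArg (CoactMod.mk N.toHMod) (LinearMap.ext fun n =>
    commutingActions.yd_untwist_twist hR (hN.conv_a_rS_one n))

theorem untwist_source (n : N.toHMod.carrier) {y : H} (hy : y ∈ sourceSpace k H) :
    opL k H _ y (untwistOp N.toHMod.carrier R (N.coact n)) =
      opR k H _ y (untwistOp N.toHMod.carrier R (N.coact n)) :=
  commutingActions.yd_twist_source hR (hN.conv_one n) hy

theorem untwist_conv_one (n : N.toHMod.carrier) :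
    conv (A := Module.End k (H ⊗[k] N.toHMod.carrier)) (opAd k H _) (opA k H H _) 1
      (untwistOp N.toHMod.carrier R (N.coact n)) = untwistOp N.toHMod.carrier R (N.coact n) :=
  commutingActions.yd_twist_conv_one hR (hN.conv_one n)

omit [Regular k H] in
theorem untwist_smul (h : H) (n : N.toHMod.carrier) :
    untwistOp N.toHMod.carrier R (N.coact (h • n)) =
      conv (A := Module.End k (H ⊗[k] N.toHMod.carrier)) (opAd k H _) (opA k H H _) h
        (untwistOp N.toHMod.carrier R (N.coact n)) := by
  rw [hN.coact_smul]
  exact LinearMap.congr_fun (commutingActions.untwist_conv hR h) (N.coact n)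

end IsYetterDrinfeld

namespace IsBraidedComodule
variable {M : CoactMod k H} (hM : IsBraidedComodule R M)
include hM

theorem source (m : M.toHMod.carrier) {y : H} (hy : y ∈ sourceSpace k H) :
    opL k H _ y (M.coact m) = opR k H _ y (M.coact m) :=
  (mem_range_centralizer_iff _).1 (hM.mem_centralizer m) y hy

theorem coact_smul (h : H) (m : M.toHMod.carrier) : M.coact (h • m) =
    conv (A := Module.End k (H ⊗[k] M.toHMod.carrier)) (opAd k H _) (opA k H H _) h
      (M.coact m) := by
  rw [hM.linear, act₂_ad]; rfl

theorem conv_rS_a_one (m : M.toHMod.carrier) :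
    conv (A := Module.End k (H ⊗[k] M.toHMod.carrier)) (opR k H _ ∘ₗ S k H) (opA k H H _) 1
      (M.coact m) = M.coact m := by
  rw [← commutingActions.conv_ad_a_one (fun y hy => hM.source m hy), ← hM.coact_smul, one_smul]

variable [Regular k H] (hR : IsQuasitriangular R)
include hR

theorem untwist_twist : toBraided R (toYD R M) = M := by
  rw [toYD_eq, toBraided_eq]
  exact congrArg (CoactMod.mk M.toHMod) (LinearMap.ext fun m =>
    commutingActions.braided_untwist_twist hR (hM.conv_rS_a_one m))

/-- The twist of a braided comodule is a Yetter–Drinfeld module. -/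
theorem isYetterDrinfeld : IsYetterDrinfeld (toYD R M) := by
  have hc : CommutingActions (opL₂ k H M.toHMod.carrier) (opA₂ k H M.toHMod.carrier)
      (opR₂ k H M.toHMod.carrier) := commutingActions.lTensor H
  rw [toYD_eq]
  refine ⟨fun m => ?_, fun m => ?_, fun m => ?_, fun h m => ?_⟩
  · change comulT k H _ (twistOp M.toHMod.carrier R (M.coact m)) =
      (twistOp M.toHMod.carrier R ∘ₗ M.coact).lTensor H (twistOp M.toHMod.carrier R (M.coact m))
    have e : pairing (A := Module.End k (H ⊗[k] (H ⊗[k] M.toHMod.carrier))) (opAd₂ k H _)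
        (opR k H _) R (M.coact.lTensor H (M.coact m)) = comulT k H _ (M.coact m) := by
      rw [← hM.coassoc, braidedΔ_eq]
      exact hc.coassoc_twist hR opR_mul (fun x y => (opR_commute_liftL y _).symm)
        (fun x y => (opR_commute_liftL y _).symm)
        (fun y hy => by
          change liftL k H (opL k H _ y) _ = liftL k H (opR k H _ y) _
          rw [← comulT_opL_source hy, ← comulT_opR_source hy, hM.source m hy])
        (conv_one_comulT _)
    rw [LinearMap.lTensor_comp, LinearMap.comp_apply, lTensor_twistOp hR hM.coact_smul, e,
      comulT_twistOp hR]
    exact LinearMap.congr_fun (liftL_twistOp (k := k) (H := H) (M := M.toHMod.carrier)).symm _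
  · change counitT k H _ (twistOp M.toHMod.carrier R (M.coact m)) = m
    rw [counitT_twistOp hR (fun y hy => hM.source m hy), hM.counit]
  · exact (mem_TProd_iff _).2 (commutingActions.braided_twist_conv_one hR
      (fun y hy => hM.source m hy))
  · rw [act₂_sandwich]
    change twistOp M.toHMod.carrier R (M.coact (h • m)) = _
    rw [hM.coact_smul]
    exact LinearMap.congr_fun (commutingActions.twist_conv hR h) (M.coact m)

end IsBraidedComodule

namespace IsYetterDrinfeld
variable {N : CoactMod k H} (hN : IsYetterDrinfeld N) [Regular k H] (hR : IsQuasitriangular R)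
include hN hR

theorem untwist_coassoc (n : N.toHMod.carrier) :
    pairing (A := Module.End k (H ⊗[k] (H ⊗[k] N.toHMod.carrier))) (opAd₂ k H _)
      (opR k H _ ∘ₗ S k H) R (comulT k H _ (untwistOp N.toHMod.carrier R (N.coact n))) =
    (untwistOp N.toHMod.carrier R ∘ₗ N.coact).lTensor H
      (untwistOp N.toHMod.carrier R (N.coact n)) := by
  have hc : CommutingActions (opL₂ k H N.toHMod.carrier) (opA₂ k H N.toHMod.carrier)
      (opR₂ k H N.toHMod.carrier) := commutingActions.lTensor H
  have hPQ : ∀ n, twistOp N.toHMod.carrier R (untwistOp N.toHMod.carrier R (N.coact n)) =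
      N.coact n := fun n => commutingActions.yd_untwist_twist hR (hN.conv_a_rS_one n)
  obtain ⟨ρ, hρ⟩ : ∃ ρ, ρ = untwistOp N.toHMod.carrier R ∘ₗ N.coact := ⟨_, rfl⟩
  have hρn : ∀ n, untwistOp N.toHMod.carrier R (N.coact n) = ρ n := fun n => by rw [hρ]; rfl
  have hρs : ∀ (h : H) m, ρ (h • m) = conv (A := Module.End k (H ⊗[k] N.toHMod.carrier))
    (opAd k H _) (opA k H H _) h (ρ m) := hρ ▸ hN.untwist_smul hR
  have h3 : ∀ t, conv (A := Module.End k (H ⊗[k] (H ⊗[k] N.toHMod.carrier))) (opAd₂ k H _)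
      (opA₂ k H _) 1 (ρ.lTensor H t) = ρ.lTensor H t := by
    intro t
    rw [← lTensor_opA hρs, commutingActions.a_one, Module.End.one_apply]
  have h4 : conv (A := Module.End k (H ⊗[k] N.toHMod.carrier)) (opR k H _ ∘ₗ S k H)
      (opA k H H _) 1 (ρ n) = ρ n := by
    rw [← hρn]
    exact LinearMap.congr_fun (commutingActions.conv_rS_a_mul_pairing hR) (N.coact n)
  have h2 : pairing (A := Module.End k (H ⊗[k] N.toHMod.carrier)) (opA k H H _) (opR k H _)
      ((S k H).rTensor H (Δ k H 1)) (ρ n) = ρ n := by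
    rw [← hR.pairing_S_mul_pairing commutingActions.a_mul opR_mul commutingActions.a_r,
      Module.End.mul_apply, ← hρn, hPQ]
  rw [← hρ, hρn]
  simp only [hρn] at hPQ
  refine hc.coassoc_untwist hR opR_mul (fun x y => (opR_commute_liftL y _).symm)
    (fun x y => (opR_commute_liftL y _).symm) (fun x y => (opR_commute_liftL y _).symm)
    (conv_one_comulT _) ?_ (h3 _) ?_ ?_
  · conv_rhs => rw [← h2]
    refine Δ_one_induction (p := fun D => pairing (A := Module.End k
        (H ⊗[k] (H ⊗[k] N.toHMod.carrier))) (opA₂ k H _) (opR k H _) ((S k H).rTensor H D)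
        (comulT k H _ (ρ n)) = comulT k H _ (pairing (A := Module.End k
          (H ⊗[k] N.toHMod.carrier)) (opA k H H _) (opR k H _) ((S k H).rTensor H D) (ρ n)))
      (by simp) (fun s t hs ht => by simp only [map_add, LinearMap.add_apply, hs, ht])
      fun y hy z hz => ?_
    rw [LinearMap.rTensor_tmul, pairing_tmul, pairing_tmul, Module.End.mul_apply,
      Module.End.mul_apply, comulT_opA, comulT_opR_target hz]
    rfl
  · conv_rhs => rw [← h4]
    refine Δ_one_induction (p := fun D => pairing (A := Module.End k
        (H ⊗[k] (H ⊗[k] N.toHMod.carrier))) (opR k H _ ∘ₗ S k H) (opAd₂ k H _) D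
        (ρ.lTensor H (ρ n)) = ρ.lTensor H (pairing (A := Module.End k
          (H ⊗[k] N.toHMod.carrier)) (opR k H _ ∘ₗ S k H) (opA k H H _) D (ρ n)))
      (by simp) (fun s t hs ht => by simp only [map_add, LinearMap.add_apply, hs, ht])
      fun y hy z hz => ?_
    rw [pairing_tmul, pairing_tmul, Module.End.mul_apply, Module.End.mul_apply,
      LinearMap.comp_apply, LinearMap.comp_apply, lTensor_opR, lTensor_opA hρs,
      conv_of_target hc.ad_mul hz, Module.End.mul_apply, h3]
  · rw [← comulT_twistOp hR, ← lTensor_twistOp hR hρs, ← liftL_twistOp]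
    have e : N.coact = twistOp N.toHMod.carrier R ∘ₗ ρ := LinearMap.ext fun n => (hPQ n).symm
    have e' : twistOp N.toHMod.carrier R (ρ n) = N.coact n := by rw [e]; rfl
    rw [e']
    refine (hN.coassoc n).trans ?_
    conv_lhs => rw [e, LinearMap.lTensor_comp, ← e]
    rfl

/-- The twist of a Yetter–Drinfeld module is a braided comodule. -/
theorem isBraidedComodule : IsBraidedComodule R (toBraided R N) := by
  rw [toBraided_eq]
  refine ⟨fun n => ?_, fun n => ?_, fun h n => ?_, fun n => ?_, fun n => ?_⟩
  · exact (mem_range_centralizer_iff _).2 fun y hy => hN.untwist_source hR n hy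
  · rw [act₂_ad]
    exact hN.untwist_conv_one hR n
  · rw [act₂_ad]
    exact hN.untwist_smul hR h n
  · rw [braidedΔ_eq]
    exact hN.untwist_coassoc hR n
  · change TensorProduct.lift (lsm k H N.toHMod.carrier ∘ₗ targetMap k H)
      (untwistOp N.toHMod.carrier R (N.coact n)) = n
    rw [← counitT_twistOp hR (fun y hy => hN.untwist_source hR n hy),
      commutingActions.yd_untwist_twist hR (hN.conv_a_rS_one n)]
    exact hN.counit n

end IsYetterDrinfeld

end WellDefined

/-! ### Products of coactions -/

section Products
variable {k : Type u} {H : Type v} [Field k] [Ring H] [Algebra k H]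

section Linear
variable {X Y Z X' Y' : Type*} [AddCommGroup X] [Module k X] [AddCommGroup Y] [Module k Y]
  [AddCommGroup Z] [Module k Z] [AddCommGroup X'] [Module k X'] [AddCommGroup Y'] [Module k Y']

variable (k H X Y) in
/-- The map `(x ⊗ m) ⊗ (x' ⊗ n) ↦ xx' ⊗ (m ⊗ n)`. -/
noncomputable def mulT : (H ⊗[k] X) ⊗[k] (H ⊗[k] Y) →ₗ[k] H ⊗[k] (X ⊗[k] Y) :=
  (LinearMap.mul' k H).rTensor (X ⊗[k] Y) ∘ₗ
    (TensorProduct.tensorTensorTensorComm k H X H Y).toLinearMap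

@[simp] theorem mulT_tmul (x x' : H) (m : X) (n : Y) :
    mulT k H X Y ((x ⊗ₜ[k] m) ⊗ₜ[k] (x' ⊗ₜ[k] n)) = (x * x') ⊗ₜ[k] (m ⊗ₜ[k] n) := by
  simp [mulT]

/-- The map `m ⊗ n ↦ m₍₋₁₎n₍₋₁₎ ⊗ (m₍₀₎ ⊗ n₍₀₎)`. -/
noncomputable def mulCoact (ρ : X →ₗ[k] H ⊗[k] X') (σ : Y →ₗ[k] H ⊗[k] Y') :
    X ⊗[k] Y →ₗ[k] H ⊗[k] (X' ⊗[k] Y') := mulT k H X' Y' ∘ₗ TensorProduct.map ρ σ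

theorem mulCoact_tmul (ρ : X →ₗ[k] H ⊗[k] X') (σ : Y →ₗ[k] H ⊗[k] Y') (m : X) (n : Y) :
    mulCoact ρ σ (m ⊗ₜ[k] n) = mulT k H X' Y' (ρ m ⊗ₜ[k] σ n) := rfl

/-- To compare linear maps on `(U ⊗ X) ⊗ (V ⊗ Y)`, it suffices to do so on pure tensors. -/
theorem tensor_ext₄ {U V W : Type*} [AddCommGroup U] [Module k U] [AddCommGroup V] [Module k V]
    [AddCommGroup W] [Module k W] {f g : (U ⊗[k] X) ⊗[k] (V ⊗[k] Y) →ₗ[k] W}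
    (h : ∀ u x v y, f ((u ⊗ₜ x) ⊗ₜ (v ⊗ₜ y)) = g ((u ⊗ₜ x) ⊗ₜ (v ⊗ₜ y))) : f = g :=
  TensorProduct.ext (TensorProduct.ext' fun u x => TensorProduct.ext' fun v y => h u x v y)

theorem lTensor_mulT (f : X →ₗ[k] X') (g : Y →ₗ[k] Y') (s : (H ⊗[k] X) ⊗[k] (H ⊗[k] Y)) :
    (TensorProduct.map f g).lTensor H (mulT k H X Y s) =
      mulT k H X' Y' (TensorProduct.map (f.lTensor H) (g.lTensor H) s) :=
  LinearMap.congr_fun (f := (TensorProduct.map f g).lTensor H ∘ₗ mulT k H X Y)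
    (g := mulT k H X' Y' ∘ₗ TensorProduct.map (f.lTensor H) (g.lTensor H))
    (tensor_ext₄ fun u x v y => by simp) s

theorem mulT_opL (h : H) (s : (H ⊗[k] X) ⊗[k] (H ⊗[k] Y)) :
    mulT k H X Y (liftR k _ (opL k H X h) s) = opL k H _ h (mulT k H X Y s) :=
  LinearMap.congr_fun (f := mulT k H X Y ∘ₗ liftR k _ (opL k H X h))
    (g := opL k H _ h ∘ₗ mulT k H X Y) (tensor_ext₄ fun u x v y => by simp [mul_assoc]) s

theorem mulT_opR (h : H) (s : (H ⊗[k] X) ⊗[k] (H ⊗[k] Y)) :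
    mulT k H X Y (liftL k _ (opR k H Y h) s) = opR k H _ h (mulT k H X Y s) :=
  LinearMap.congr_fun (f := mulT k H X Y ∘ₗ liftL k _ (opR k H Y h))
    (g := opR k H _ h ∘ₗ mulT k H X Y) (tensor_ext₄ fun u x v y => by simp [mul_assoc]) s

/-- The multiplication is balanced. -/
theorem mulT_balanced (h : H) (s : (H ⊗[k] X) ⊗[k] (H ⊗[k] Y)) :
    mulT k H X Y (liftR k _ (opR k H X h) s) = mulT k H X Y (liftL k _ (opL k H Y h) s) :=
  LinearMap.congr_fun (f := mulT k H X Y ∘ₗ liftR k _ (opR k H X h))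
    (g := mulT k H X Y ∘ₗ liftL k _ (opL k H Y h))
    (tensor_ext₄ fun u x v y => by simp [mul_assoc]) s

theorem mulT_liftL_left (f : Module.End k X) (s : (H ⊗[k] X) ⊗[k] (H ⊗[k] Y)) :
    mulT k H X Y (liftR k _ (liftL k H f) s) = liftL k H (liftR k Y f) (mulT k H X Y s) :=
  LinearMap.congr_fun (f := mulT k H X Y ∘ₗ liftR k _ (liftL k H f))
    (g := liftL k H (liftR k Y f) ∘ₗ mulT k H X Y) (tensor_ext₄ fun u x v y => by simp) s

theorem mulT_liftL_right (f : Module.End k Y) (s : (H ⊗[k] X) ⊗[k] (H ⊗[k] Y)) :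
    mulT k H X Y (liftL k _ (liftL k H f) s) = liftL k H (liftL k X f) (mulT k H X Y s) :=
  LinearMap.congr_fun (f := mulT k H X Y ∘ₗ liftL k _ (liftL k H f))
    (g := liftL k H (liftL k X f) ∘ₗ mulT k H X Y) (tensor_ext₄ fun u x v y => by simp) s

theorem lTensor_mulCoact {X₁ Y₁ : Type*} [AddCommGroup X₁] [Module k X₁] [AddCommGroup Y₁]
    [Module k Y₁] {ρ : X →ₗ[k] H ⊗[k] X'} {σ : Y →ₗ[k] H ⊗[k] Y'} (f : X' →ₗ[k] X₁)
    (g : Y' →ₗ[k] Y₁) (t : X ⊗[k] Y) : (TensorProduct.map f g).lTensor H (mulCoact ρ σ t) =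
      mulCoact (f.lTensor H ∘ₗ ρ) (g.lTensor H ∘ₗ σ) t := by
  rw [mulCoact, LinearMap.comp_apply, lTensor_mulT, mulCoact, TensorProduct.map_comp]
  rfl

theorem mulCoact_map {X₁ Y₁ : Type*} [AddCommGroup X₁] [Module k X₁] [AddCommGroup Y₁]
    [Module k Y₁] {ρ : X →ₗ[k] H ⊗[k] X'} {σ : Y →ₗ[k] H ⊗[k] Y'} (f : X₁ →ₗ[k] X)
    (g : Y₁ →ₗ[k] Y) (t : X₁ ⊗[k] Y₁) : mulCoact ρ σ (TensorProduct.map f g t) =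
      mulCoact (ρ ∘ₗ f) (σ ∘ₗ g) t := by
  rw [mulCoact, LinearMap.comp_apply, mulCoact, TensorProduct.map_comp]
  rfl

theorem mulCoact_assoc {Z' : Type*} [AddCommGroup Z'] [Module k Z'] (ρ : X →ₗ[k] H ⊗[k] X')
    (σ : Y →ₗ[k] H ⊗[k] Y') (τ : Z →ₗ[k] H ⊗[k] Z') (t : (X ⊗[k] Y) ⊗[k] Z) :
    mulCoact ρ (mulCoact σ τ) (TensorProduct.assoc k X Y Z t) =
      (TensorProduct.assoc k X' Y' Z').toLinearMap.lTensor H (mulCoact (mulCoact ρ σ) τ t) := by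
  induction t using TensorProduct.induction_on with
  | zero => simp
  | add s t hs ht => simp only [map_add, hs, ht]
  | tmul w z =>
    induction w using TensorProduct.induction_on with
    | zero => simp
    | add s t hs ht => simp only [map_add, TensorProduct.add_tmul, hs, ht]
    | tmul x y =>
      simp only [TensorProduct.assoc_tmul, mulCoact_tmul]
      induction ρ x using TensorProduct.induction_on with
      | zero => simp
      | add s t hs ht => simp only [map_add, TensorProduct.add_tmul, hs, ht]
      | tmul a x =>
        induction σ y using TensorProduct.induction_on with
        | zero => simp
        | add s t hs ht =>
          simp only [map_add, TensorProduct.add_tmul, TensorProduct.tmul_add, hs, ht]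
        | tmul b y =>
          induction τ z using TensorProduct.induction_on with
          | zero => simp
          | add s t hs ht => simp only [map_add, TensorProduct.tmul_add, hs, ht]
          | tmul c z => simp [mul_assoc]

end Linear

section Coassoc
variable [WeakHopfAlgebra k H]
variable {X Y : Type*} [AddCommGroup X] [Module k X] [AddCommGroup Y] [Module k Y]

theorem comulT_mulT (s : (H ⊗[k] X) ⊗[k] (H ⊗[k] Y)) : comulT k H _ (mulT k H X Y s) =
    (mulT k H X Y).lTensor H (mulT k H _ _ (TensorProduct.map (comulT k H X) (comulT k H Y) s)) :=
  LinearMap.congr_fun (f := comulT k H _ ∘ₗ mulT k H X Y) (g := (mulT k H X Y).lTensor H ∘ₗ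
    mulT k H _ _ ∘ₗ TensorProduct.map (comulT k H X) (comulT k H Y)) (tensor_ext₄ fun u x v y => by
      simp only [LinearMap.comp_apply, mulT_tmul, comulT, LinearMap.rTensor_tmul, Δ_mul,
        TensorProduct.map_tmul]
      induction Δ k H u using TensorProduct.induction_on with
      | zero => simp
      | add s t hs ht => simp only [map_add, add_mul, TensorProduct.add_tmul, hs, ht]
      | tmul a b =>
        induction Δ k H v using TensorProduct.induction_on with
        | zero => simp
        | add s t hs ht =>
          simp only [map_add, mul_add, TensorProduct.add_tmul, TensorProduct.tmul_add, hs, ht]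
        | tmul c d => simp) s

theorem mulCoact_coassoc {ρ : X →ₗ[k] H ⊗[k] X} {σ : Y →ₗ[k] H ⊗[k] Y}
    (hρ : ∀ m, comulT k H X (ρ m) = ρ.lTensor H (ρ m))
    (hσ : ∀ n, comulT k H Y (σ n) = σ.lTensor H (σ n)) (t : X ⊗[k] Y) :
    comulT k H _ (mulCoact ρ σ t) = (mulCoact ρ σ).lTensor H (mulCoact ρ σ t) := by
  induction t using TensorProduct.induction_on with
  | zero => simp
  | add s t hs ht => simp only [map_add, hs, ht]
  | tmul m n =>
    rw [mulCoact_tmul, comulT_mulT, TensorProduct.map_tmul, hρ, hσ, mulCoact,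
      LinearMap.lTensor_comp, LinearMap.comp_apply, lTensor_mulT, TensorProduct.map_tmul]

end Coassoc
end Products

/-! ### The diagonal action on products -/

section YDTensor
variable {k : Type u} {H : Type v} [Field k] [Ring H] [Algebra k H] [WeakHopfAlgebra k H]

section Abstract
variable {A B : Type*} [Ring A] [Algebra k A] [AddCommGroup B] [Module k B]

omit [WeakHopfAlgebra k H] in
theorem map_pairing_congr (φ : A →ₗ[k] B) {f f' g g' : H →ₗ[k] A}
    (h : ∀ c d, φ (f c * g d) = φ (f' c * g' d)) (t : H ⊗[k] H) :
    φ (pairing f g t) = φ (pairing f' g' t) := by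
  induction t using TensorProduct.induction_on with
  | zero => simp
  | add s t hs ht => simp only [map_add, hs, ht]
  | tmul a b => simpa using h a b

theorem comp_conv {X X' : Type*} [AddCommGroup X] [Module k X] [AddCommGroup X'] [Module k X']
    (c : X →ₗ[k] X') {f g : H →ₗ[k] Module.End k X} {f' g' : H →ₗ[k] Module.End k X'}
    (hf : ∀ h x, c (f h x) = f' h (c x)) (hg : ∀ h x, c (g h x) = g' h (c x)) (h : H) (x : X) :
    c (conv f g h x) = conv f' g' h (c x) := comp_pairing c hf hg _ x

theorem commute_conv {f g r : H →ₗ[k] A} (hf : ∀ x y, Commute (f x) (r y))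
    (hg : ∀ x y, Commute (g x) (r y)) (x y : H) : Commute (conv f g x) (r y) :=
  commute_pairing_right (fun c => hf c y) (fun d => hg d y) _

/-- `f(h₁)f(ε_s(h₂)) = f(h)` -/
theorem conv_comp_sourceMap {f : H →ₗ[k] A} (hf : ∀ x y, f (x * y) = f x * f y) :
    conv f (f ∘ₗ sourceMap k H) = f := by
  refine LinearMap.ext fun h => ?_
  rw [conv_apply, ← pairing_lTensor]
  change pairing f f ((sourceMap k H).lTensor H (Δ k H h)) = _
  rw [lTensor_sourceMap, pairing_fst_mul hf, pairing_lTensor]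
  have e : ∀ D : H ⊗[k] H, pairing f (f ∘ₗ S k H) D = f (pairing LinearMap.id (S k H) D) := by
    intro D
    induction D using TensorProduct.induction_on with
    | zero => simp
    | add s t hs ht => simp only [map_add, hs, ht]
    | tmul a b => simp [hf]
  rw [e, Δ_one_mul_S_sum, ← hf, mul_one]

/-- The cancellation of `S(h₃)h₄` in `h₁m₍₋₁₎S(h₃)h₄n₍₋₁₎S(h₆) ⊗ h₂·m₍₀₎ ⊗ h₅·n₍₀₎`. Here `φ`
sends an operator to its value at `m₍₋₁₎ ⊗ m₍₀₎ ⊗ n₍₋₁₎ ⊗ n₍₀₎`, followed by the multiplication of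
the two tensor factors in `H`. -/
theorem map_conv_cancel (φ : A →ₗ[k] B) {L₁ a₁ r₁ L₂ Z : H →ₗ[k] A}
    (hφ : ∀ x f, φ (r₁ x * f) = φ (L₂ x * f))
    (hφ' : ∀ y ∈ sourceSpace k H, ∀ f, φ (f * a₁ y) = φ (f * r₁ y))
    (ha : ∀ x y, a₁ (x * y) = a₁ x * a₁ y) (hL : ∀ x y, L₂ (x * y) = L₂ x * L₂ y)
    (hLr : ∀ x y, Commute (L₁ x) (r₁ y)) (hLL : ∀ x y, Commute (L₁ x) (L₂ y))
    (har : ∀ x y, Commute (a₁ x) (r₁ y)) (haL : ∀ x y, Commute (a₁ x) (L₂ y))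
    (hZr : ∀ x y, Commute (Z x) (r₁ y)) (hZa : ∀ x y, Commute (Z x) (a₁ y)) (h : H) :
    φ (conv (conv L₁ (conv a₁ (r₁ ∘ₗ S k H))) (conv L₂ Z) h) = φ (conv L₁ (conv a₁ Z) h) := by
  have e1 : conv (conv L₁ (conv a₁ (r₁ ∘ₗ S k H))) (conv L₂ Z) =
      conv L₁ (conv a₁ (conv (conv (r₁ ∘ₗ S k H) L₂) Z)) := by simp only [conv_assoc]
  have e2 : conv a₁ Z = conv a₁ (conv (a₁ ∘ₗ sourceMap k H) Z) := by
    rw [← conv_assoc, conv_comp_sourceMap ha]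
  rw [e1, e2]
  refine map_pairing_congr φ (fun c x => ?_) _
  refine map_pairing_congr (φ ∘ₗ LinearMap.mulLeft k (L₁ c)) (fun d x => ?_) _
  refine map_pairing_congr (φ ∘ₗ LinearMap.mulLeft k (L₁ c) ∘ₗ LinearMap.mulLeft k (a₁ d))
    (fun e g => ?_) _
  simp only [LinearMap.comp_apply, LinearMap.mulLeft_apply]
  have hc : ∀ {b}, (∀ x, Commute (L₁ x) b) → (∀ x, Commute (a₁ x) b) →
      ∀ f, L₁ c * (a₁ d * (b * f)) = b * (L₁ c * (a₁ d * f)) := by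
    intro b h1 h2 f
    rw [← mul_assoc (a₁ d), (h2 d).eq, mul_assoc, ← mul_assoc, (h1 c).eq, mul_assoc]
  have e3 : φ (L₁ c * (a₁ d * (conv (r₁ ∘ₗ S k H) L₂ e * Z g))) =
      φ (L₁ c * (a₁ d * (conv (L₂ ∘ₗ S k H) L₂ e * Z g))) := by
    refine map_pairing_congr (φ ∘ₗ LinearMap.mulLeft k (L₁ c) ∘ₗ LinearMap.mulLeft k (a₁ d) ∘ₗ
      LinearMap.mulRight k (Z g)) (fun p q => ?_) _
    simp only [LinearMap.comp_apply, LinearMap.mulLeft_apply, LinearMap.mulRight_apply, mul_assoc]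
    rw [hc (fun x => hLr x _) (fun x => har x _), hφ, hc (fun x => hLL x q) (fun x => haL x q),
      hc (fun x => hLL x (S k H p)) (fun x => haL x _), hc (fun x => hLL x q) (fun x => haL x q)]
  rw [e3, comp_S_conv_of_mul hL, LinearMap.comp_apply,
    hc (fun x => hLL x _) (fun x => haL x _), ← hφ, ← hc (fun x => hLr x _) (fun x => har x _),
    ← (hZr g _).eq, ← mul_assoc, ← mul_assoc, ← hφ' _ (sourceMap_mem e), mul_assoc, mul_assoc,
    (hZa g _).eq]

end Abstract

namespace IsYetterDrinfeld
variable {N : CoactMod k H} (hN : IsYetterDrinfeld N)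
include hN

theorem coact_target_smul {z : H} (hz : z ∈ targetSpace k H) (n : N.toHMod.carrier) :
    N.coact (z • n) = opL k H _ z (N.coact n) := by
  rw [hN.coact_smul, conv_of_target commutingActions.L_mul hz, Module.End.mul_apply,
    ← hN.coact_smul, one_smul]

theorem coact_source_smul {y : H} (hy : y ∈ sourceSpace k H) (n : N.toHMod.carrier) :
    N.coact (y • n) = opR k H _ (S k H y) (N.coact n) := by
  have hc := commutingActions (k := k) (H := H) (M := N.toHMod.carrier)
  rw [hN.coact_smul, ← conv_assoc, conv_of_source hc.rS_mul (fun x =>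
    commute_pairing_right (fun c => hc.L_rS c y) (fun c => hc.a_rS c y) _) hy,
    Module.End.mul_apply, conv_assoc, ← hN.coact_smul, one_smul]
  rfl

theorem opA_source [Regular k H] {y : H} (hy : y ∈ sourceSpace k H) (n : N.toHMod.carrier) :
    opA k H H _ y (N.coact n) = opR k H _ y (N.coact n) :=
  commutingActions.yd_source_right (hN.conv_a_rS_one n) hy

end IsYetterDrinfeld

section Pure
variable {X Y : Type*} [AddCommGroup X] [Module k X] [Module H X] [IsScalarTower k H X]
  [AddCommGroup Y] [Module k Y] [Module H Y] [IsScalarTower k H Y]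

omit [WeakHopfAlgebra k H] in
theorem liftL_dact_tmul (p q : H) (s : H ⊗[k] X) (t : H ⊗[k] Y) :
    liftL k H (dact k H X Y (p ⊗ₜ[k] q)) (mulT k H X Y (s ⊗ₜ[k] t)) =
      mulT k H X Y (opA k H H X p s ⊗ₜ[k] opA k H H Y q t) := by
  rw [dact, act₂_tmul]
  exact lTensor_mulT _ _ _

omit [WeakHopfAlgebra k H] in
theorem liftL_dact_mul (D E : H ⊗[k] H) (t : H ⊗[k] (X ⊗[k] Y)) :
    liftL k H (dact k H X Y (D * E)) t =
      liftL k H (dact k H X Y D) (liftL k H (dact k H X Y E) t) := by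
  have : dact k H X Y (D * E) = dact k H X Y D * dact k H X Y E :=
    LinearMap.ext fun t => dact_mul D E t
  rw [this, liftL_mul, Module.End.mul_apply]

/-- `m₍₋₁₎n₍₋₁₎ ⊗ 1₁·m₍₀₎ ⊗ 1₂·n₍₀₎ = m₍₋₁₎n₍₋₁₎ ⊗ m₍₀₎ ⊗ n₍₀₎` -/
theorem liftL_dact_one_mulT {s : H ⊗[k] X} {t : H ⊗[k] Y}
    (hs : ∀ y ∈ sourceSpace k H, opA k H H X y s = opR k H X y s)
    (ht : conv (A := Module.End k (H ⊗[k] Y)) (opL k H Y) (opA k H H Y) 1 t = t) :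
    liftL k H (dact k H X Y (Δ k H 1)) (mulT k H X Y (s ⊗ₜ[k] t)) =
      mulT k H X Y (s ⊗ₜ[k] t) := by
  conv_rhs => rw [← ht]
  refine Δ_one_induction (p := fun D => liftL k H (dact k H X Y D) (mulT k H X Y (s ⊗ₜ[k] t)) =
    mulT k H X Y (s ⊗ₜ[k] pairing (A := Module.End k (H ⊗[k] Y)) (opL k H Y) (opA k H H Y) D t))
    (by simp) (fun s t hs ht => by
      simp only [map_add, LinearMap.add_apply, TensorProduct.tmul_add, hs, ht]) fun y hy z hz => ?_
  rw [liftL_dact_tmul, hs y hy, pairing_tmul, Module.End.mul_apply]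
  exact mulT_balanced y (s ⊗ₜ[k] _)

variable (k H X Y) in
/-- The diagonal action of `H` on `X ⊗ Y`, on the second factor of `H ⊗ (X ⊗ Y)`. -/
noncomputable def opD : H →ₗ[k] Module.End k (H ⊗[k] (X ⊗[k] Y)) :=
  liftL k H ∘ₗ dact k H X Y ∘ₗ Δ k H

theorem opD_eq_conv : opD k H X Y = conv (A := Module.End k (H ⊗[k] (X ⊗[k] Y)))
    (liftL k H ∘ₗ liftR k Y ∘ₗ lsm k H X) (liftL k H ∘ₗ liftL k X ∘ₗ lsm k H Y) := by
  refine LinearMap.ext fun h => ?_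
  rw [opD, LinearMap.comp_apply, LinearMap.comp_apply, dact, act₂_eq_pairing]
  exact liftL_pairing H _ _ _

theorem opD_mul (x y : H) : opD k H X Y (x * y) = opD k H X Y x * opD k H X Y y :=
  LinearMap.ext fun t => by
    rw [opD, LinearMap.comp_apply, LinearMap.comp_apply, Δ_mul, liftL_dact_mul]; rfl

theorem lTensor_inc_opA (h : H) (t : H ⊗[k] TProd k H X Y) :
    inc.lTensor H (opA k H H (TProd k H X Y) h t) = opD k H X Y h (inc.lTensor H t) := by
  induction t using TensorProduct.induction_on with
  | zero => simp
  | add s t hs ht => simp only [map_add, hs, ht]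
  | tmul x w => simp [opD, inc_smul]

omit [WeakHopfAlgebra k H] in
theorem lTensor_opL {V W : Type*} [AddCommGroup V] [Module k V] [AddCommGroup W] [Module k W]
    (f : V →ₗ[k] W) (h : H) (t : H ⊗[k] V) :
    f.lTensor H (opL k H V h t) = opL k H W h (f.lTensor H t) := by
  induction t using TensorProduct.induction_on with
  | zero => simp
  | add s t hs ht => simp only [map_add, hs, ht]
  | tmul x v => simp

theorem lTensor_inc_injective' : Function.Injective
    ((inc : TProd k H X Y →ₗ[k] X ⊗[k] Y).lTensor H) :=
  Module.Flat.lTensor_preserves_injective_linearMap (M := H) _ inc_injective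

end Pure

end YDTensor

/-! ### Properties of the product coaction -/

section ProductCoaction
variable {k : Type u} {H : Type v} [Field k] [Ring H] [Algebra k H] [WeakHopfAlgebra k H]

/-- The product of two families `h₁ • (-) • S(h₃)`, `h₂ • (-)`, formed in `U ⊗ V` and mapped to `W`
by a balanced map `c`. -/
theorem CommutingActions.map_conv_conv {U V W : Type*} [AddCommGroup U] [Module k U]
    [AddCommGroup V] [Module k V] [AddCommGroup W] [Module k W]
    {L a r : H →ₗ[k] Module.End k U} (hc : CommutingActions L a r)
    {L' a' r' : H →ₗ[k] Module.End k V} (hc' : CommutingActions L' a' r') (c : U ⊗[k] V →ₗ[k] W)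
    {L₀ a₁ a₂ r₀ : H →ₗ[k] Module.End k W} (hL : ∀ h u, c (liftR k V (L h) u) = L₀ h (c u))
    (ha : ∀ h u, c (liftR k V (a h) u) = a₁ h (c u))
    (ha' : ∀ h u, c (liftL k U (a' h) u) = a₂ h (c u))
    (hr : ∀ h u, c (liftL k U (r' h) u) = r₀ h (c u))
    (hb : ∀ h u, c (liftR k V (r h) u) = c (liftL k U (L' h) u)) {s : U}
    (hs : ∀ y ∈ sourceSpace k H, a y s = r y s) (h : H) (t : V) :
    c (pairing (A := Module.End k (U ⊗[k] V)) (liftR k V ∘ₗ conv L (conv a (r ∘ₗ S k H)))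
        (liftL k U ∘ₗ conv L' (conv a' (r' ∘ₗ S k H))) (Δ k H h) (s ⊗ₜ[k] t)) =
      conv L₀ (conv a₁ (conv a₂ (r₀ ∘ₗ S k H))) h (c (s ⊗ₜ[k] t)) := by
  have hlr : ∀ (f : Module.End k U) (g : Module.End k V),
      Commute (liftR k V f) (liftL k U g) := fun f g => TensorProduct.ext' fun u v => by simp
  have hR : ∀ {f g : Module.End k U}, Commute f g → Commute (liftR k V f) (liftR k V g) :=
    fun {f g} h => TensorProduct.ext' fun u v => by
      have := LinearMap.congr_fun h.eq u
      simp only [Module.End.mul_apply] at this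
      simp [this]
  have hRm : ∀ f g : Module.End k U, liftR k V (f * g) = liftR k V f * liftR k V g :=
    fun f g => LinearMap.rTensor_comp V f g
  simp only [liftR_conv, liftL_conv]
  refine (map_conv_cancel (c ∘ₗ LinearMap.applyₗ (s ⊗ₜ[k] t)) (L₁ := liftR k V ∘ₗ L)
    (a₁ := liftR k V ∘ₗ a) (r₁ := liftR k V ∘ₗ r) (L₂ := liftL k U ∘ₗ L')
    (Z := conv (A := Module.End k (U ⊗[k] V)) (liftL k U ∘ₗ a') (liftL k U ∘ₗ r' ∘ₗ S k H))
    (fun x f => hb x _) (fun y hy f => ?_) (fun x y => ?_) (fun x y => ?_)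
    (fun x y => hR (hc.L_r x y)) (fun x y => hlr _ _) (fun x y => hR (hc.a_r x y))
    (fun x y => hlr _ _)
    (commute_conv (fun _ _ => (hlr _ _).symm) (fun _ _ => (hlr _ _).symm))
    (commute_conv (fun _ _ => (hlr _ _).symm) (fun _ _ => (hlr _ _).symm))
    h).trans ?_
  · simp [hs y hy]
  · rw [LinearMap.comp_apply, hc.a_mul, hRm]; rfl
  · rw [LinearMap.comp_apply, hc'.L_mul, liftL_mul]; rfl
  · exact comp_conv c hL (comp_conv c ha (comp_conv c (f := liftL k U ∘ₗ a')
      (g := liftL k U ∘ₗ r' ∘ₗ S k H) (g' := r₀ ∘ₗ S k H) ha' (fun h u => hr _ u))) h _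

theorem counitT_mulT {X Y : Type*} [AddCommGroup X] [Module k X] [AddCommGroup Y] [Module k Y]
    (s : H ⊗[k] X) (t : H ⊗[k] Y) : counitT k H _ (mulT k H X Y (s ⊗ₜ[k] t)) =
      TensorProduct.map (counitT k H X ∘ₗ LinearMap.applyₗ s ∘ₗ opR k H X)
        (counitT k H Y ∘ₗ LinearMap.applyₗ t ∘ₗ opL k H Y) (Δ k H 1) := by
  induction s using TensorProduct.induction_on with
  | zero => simp
  | add s s' hs hs' =>
    simp only [TensorProduct.add_tmul, map_add, hs, hs', LinearMap.add_comp, LinearMap.comp_add,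
      TensorProduct.map_add_left, LinearMap.add_apply]
  | tmul x m =>
    induction t using TensorProduct.induction_on with
    | zero => simp
    | add s s' hs hs' =>
      simp only [TensorProduct.tmul_add, map_add, hs, hs', LinearMap.add_comp, LinearMap.comp_add,
        TensorProduct.map_add_right, LinearMap.add_apply]
    | tmul x' n =>
      have := WeakHopfAlgebra.counit_mul (k := k) x 1 x'
      rw [mul_one] at this
      rw [mulT_tmul, counitT_tmul, this]
      change LinearMap.mul' k k (TensorProduct.map _ _ (Δ k H 1)) • _ = _
      induction Δ k H 1 using TensorProduct.induction_on with
      | zero => simp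
      | add s t hs ht => simp only [map_add, add_smul, hs, ht]
      | tmul p q => simp [← TensorProduct.smul_tmul', smul_smul, mul_comm]

section Regular
variable [Regular k H] {M N : CoactMod k H} (hM : IsYetterDrinfeld M) (hN : IsYetterDrinfeld N)
include hM hN

theorem liftL_dact_one_mulCoact (t : M.toHMod.carrier ⊗[k] N.toHMod.carrier) :
    liftL k H (dact k H _ _ (Δ k H 1)) (mulCoact M.coact N.coact t) =
      mulCoact M.coact N.coact t := by
  induction t using TensorProduct.induction_on with
  | zero => simp
  | add s t hs ht => simp only [map_add, hs, ht]
  | tmul m n => exact liftL_dact_one_mulT (fun y hy => hM.opA_source hy m) (hN.conv_one n)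

/-- The coaction of `M ⊗_t N` is the restriction of the product of the coactions. -/
theorem lTensor_inc_ydTensor (w : TProd k H M.toHMod.carrier N.toHMod.carrier) :
    inc.lTensor H ((ydTensor k H).tensor M N w) = mulCoact M.coact N.coact (inc w) := by
  rw [← liftL_dact_one_mulCoact hM hN]
  change inc.lTensor H (prj.lTensor H (mulCoact M.coact N.coact (inc w))) = _
  rw [← LinearMap.comp_apply, ← LinearMap.lTensor_comp]
  rfl

theorem counitT_mulCoact (t : M.toHMod.carrier ⊗[k] N.toHMod.carrier) :
    counitT k H _ (mulCoact M.coact N.coact t) = dact k H _ _ (Δ k H 1) t := by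
  induction t using TensorProduct.induction_on with
  | zero => simp
  | add s t hs ht => simp only [map_add, hs, ht]
  | tmul m n =>
    rw [mulCoact_tmul, counitT_mulT]
    refine Δ_one_induction (p := fun D => TensorProduct.map _ _ D = dact k H _ _ D (m ⊗ₜ[k] n))
      (by simp) (fun s t hs ht => by simp only [map_add, LinearMap.add_apply, hs, ht])
      fun y hy z hz => ?_
    simp only [TensorProduct.map_tmul, LinearMap.comp_apply, LinearMap.applyₗ_apply_apply]
    rw [← hM.opA_source hy, counitT_opA, ← hN.coact_target_smul hz]
    have h1 : counitT k H _ (M.coact m) = m := hM.counit m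
    have h2 : counitT k H _ (N.coact (z • n)) = z • n := hN.counit _
    rw [h1, h2]
    simp

theorem opL_opD_mulCoact (t : M.toHMod.carrier ⊗[k] N.toHMod.carrier) :
    conv (A := Module.End k (H ⊗[k] (M.toHMod.carrier ⊗[k] N.toHMod.carrier))) (opL k H _)
      (opD k H _ _) 1 (mulCoact M.coact N.coact t) = mulCoact M.coact N.coact t := by
  induction t using TensorProduct.induction_on with
  | zero => simp
  | add s t hs ht => simp only [map_add, hs, ht]
  | tmul m n =>
    conv_rhs => rw [mulCoact_tmul, ← hM.conv_one m]
    refine Δ_one_induction (p := fun D => pairing (A := Module.End k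
        (H ⊗[k] (M.toHMod.carrier ⊗[k] N.toHMod.carrier))) (opL k H _) (opD k H _ _) D
        (mulT k H _ _ (M.coact m ⊗ₜ[k] N.coact n)) = mulT k H _ _ (pairing (A := Module.End k
          (H ⊗[k] M.toHMod.carrier)) (opL k H _) (opA k H H _) D (M.coact m) ⊗ₜ[k] N.coact n))
      (by simp) (fun s t hs ht => by
        simp only [map_add, LinearMap.add_apply, TensorProduct.add_tmul, hs, ht])
      fun y hy z hz => ?_
    rw [pairing_tmul, Module.End.mul_apply, opD, LinearMap.comp_apply, LinearMap.comp_apply,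
      Δ_of_target hz, liftL_dact_mul,
      liftL_dact_one_mulT (fun y hy => hM.opA_source hy m) (hN.conv_one n), liftL_dact_tmul,
      commutingActions.a_one, pairing_tmul, Module.End.mul_apply, Module.End.one_apply]
    exact (mulT_opL y (_ ⊗ₜ[k] _)).symm

theorem mulCoact_dact (h : H) (t : M.toHMod.carrier ⊗[k] N.toHMod.carrier) :
    mulCoact M.coact N.coact (dact k H _ _ (Δ k H h) t) =
      conv (A := Module.End k (H ⊗[k] (M.toHMod.carrier ⊗[k] N.toHMod.carrier))) (opL k H _)
        (conv (A := Module.End k (H ⊗[k] (M.toHMod.carrier ⊗[k] N.toHMod.carrier)))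
          (opD k H _ _) (opR k H _ ∘ₗ S k H)) h (mulCoact M.coact N.coact t) := by
  induction t using TensorProduct.induction_on with
  | zero => simp
  | add s t hs ht => simp only [map_add, hs, ht]
  | tmul m n =>
    rw [opD_eq_conv, conv_assoc, mulCoact_tmul]
    refine Eq.trans ?_ (commutingActions.map_conv_conv commutingActions (mulT k H _ _)
      mulT_opL (fun h s => mulT_liftL_left _ s) (fun h s => mulT_liftL_right _ s) mulT_opR
      mulT_balanced (fun y hy => hM.opA_source hy m) h (N.coact n))
    induction Δ k H h using TensorProduct.induction_on with
    | zero => simp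
    | add s t hs ht => simp only [map_add, LinearMap.add_apply, hs, ht]
    | tmul p q =>
      rw [act₂_tmul, TensorProduct.map_tmul, mulCoact_tmul]
      simp [hM.coact_smul, hN.coact_smul]

end Regular
end ProductCoaction

/-! ### Tensor products and unit of Yetter–Drinfeld modules -/

section YDMonoidal
variable {k : Type u} {H : Type v} [Field k] [Ring H] [Algebra k H] [WeakHopfAlgebra k H]

/-- The axioms of a Yetter–Drinfeld module `V` can be checked after an injection `ι` of `V` into a
vector space `E`, on which elements `h` of `H` need only act as a linear map extending the action
on `V`. -/
theorem IsYetterDrinfeld.of_injective {V : HMod k H} {ρ : V.carrier →ₗ[k] H ⊗[k] V.carrier}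
    {E : Type*} [AddCommGroup E] [Module k E] {ι : V.carrier →ₗ[k] E}
    (hι : Function.Injective ι) {aE : H →ₗ[k] Module.End k (H ⊗[k] E)}
    (hA : ∀ h t, ι.lTensor H (opA k H H V.carrier h t) = aE h (ι.lTensor H t))
    (coassoc : ∀ m, comulT k H E (ι.lTensor H (ρ m)) = (ι.lTensor H ∘ₗ ρ).lTensor H (ρ m))
    (counit : ∀ m, counitT k H E (ι.lTensor H (ρ m)) = ι m)
    (conv_one : ∀ m, conv (A := Module.End k (H ⊗[k] E)) (opL k H E) aE 1 (ι.lTensor H (ρ m)) =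
      ι.lTensor H (ρ m))
    (coact_smul : ∀ (h : H) m, ι.lTensor H (ρ (h • m)) = conv (A := Module.End k (H ⊗[k] E))
      (opL k H E) (conv (A := Module.End k (H ⊗[k] E)) aE (opR k H E ∘ₗ S k H)) h
        (ι.lTensor H (ρ m))) : IsYetterDrinfeld ⟨V, ρ⟩ := by
  have hι' : Function.Injective (ι.lTensor H) :=
    Module.Flat.lTensor_preserves_injective_linearMap (M := H) _ hι
  have hι'' : Function.Injective ((ι.lTensor H).lTensor H) :=
    Module.Flat.lTensor_preserves_injective_linearMap (M := H) _ hι'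
  refine ⟨fun m => hι'' ?_, fun m => hι ?_, fun m => (mem_TProd_iff _).2 (hι' ?_),
    fun h m => hι' ?_⟩
  · have e : (ι.lTensor H).lTensor H (ρ.lTensor H (ρ m)) = comulT k H E (ι.lTensor H (ρ m)) := by
      rw [← LinearMap.comp_apply, ← LinearMap.lTensor_comp, ← coassoc m]
    change (ι.lTensor H).lTensor H (comulT k H V.carrier (ρ m)) =
      (ι.lTensor H).lTensor H (ρ.lTensor H (ρ m))
    rw [e]
    induction ρ m using TensorProduct.induction_on with
    | zero => simp
    | add s t hs ht => simp only [map_add, hs, ht]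
    | tmul x v =>
      simp only [comulT, LinearMap.comp_apply, LinearMap.rTensor_tmul, LinearMap.lTensor_tmul]
      induction Δ k H x using TensorProduct.induction_on with
      | zero => simp
      | add s t hs ht => simp only [map_add, TensorProduct.add_tmul, hs, ht]
      | tmul c d => simp
  · change ι (counitT k H V.carrier (ρ m)) = ι m
    rw [← counit m]
    induction ρ m using TensorProduct.induction_on with
    | zero => simp
    | add s t hs ht => simp only [map_add, hs, ht]
    | tmul x v => simp
  · refine Eq.trans ?_ (conv_one m)
    exact comp_conv (ι.lTensor H) (lTensor_opL ι) hA 1 _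
  · rw [act₂_sandwich]
    refine (coact_smul h m).trans (Eq.symm ?_)
    exact comp_conv (ι.lTensor H) (lTensor_opL ι) (comp_conv (ι.lTensor H) hA
      (g := opR k H V.carrier ∘ₗ S k H) (g' := opR k H E ∘ₗ S k H)
      (fun h u => lTensor_opR ι _ u)) h _

/-- The tensor product of Yetter–Drinfeld modules is a Yetter–Drinfeld module. -/
theorem IsYetterDrinfeld.tensor [Regular k H] {M N : CoactMod k H} (hM : IsYetterDrinfeld M)
    (hN : IsYetterDrinfeld N) : IsYetterDrinfeld ((ydTensor k H).obj M N) := by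
  have e := lTensor_inc_ydTensor hM hN
  refine IsYetterDrinfeld.of_injective (V := ⟨TProd k H M.toHMod.carrier N.toHMod.carrier⟩)
    (ρ := (ydTensor k H).tensor M N) inc_injective (aE := opD k H _ _) lTensor_inc_opA
    (fun w => ?_) (fun w => ?_) (fun w => ?_) (fun h w => ?_)
  · have e' : inc.lTensor H ∘ₗ (ydTensor k H).tensor M N = mulCoact M.coact N.coact ∘ₗ inc :=
      LinearMap.ext e
    rw [e', LinearMap.lTensor_comp, LinearMap.comp_apply, e]
    exact mulCoact_coassoc hM.coassoc hN.coassoc _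
  · rw [e, counitT_mulCoact hM hN, dact_inc]
  · rw [e, opL_opD_mulCoact hM hN]
  · rw [e, e, ← mulCoact_dact hM hN]
    exact congrArg _ (inc_smul h w)

section Unit

theorem lTensor_subtype_unit (z : targetSpace k H) :
    (targetSpace k H).subtype.lTensor H ((ydTensor k H).unit z) = Δ k H z := by
  change (targetSpace k H).subtype.lTensor H (toT.lTensor H (Δ k H z)) = _
  rw [← LinearMap.comp_apply, ← LinearMap.lTensor_comp]
  refine (lTensor_targetMap (z : H)).trans (Δ_of_target' z.2).symm

variable (k H) in
/-- The extension `h ⊗ x ↦ ε_t(hx)` of the action of `H` on `H_t`, on the second factor of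
`H ⊗ H`. -/
noncomputable def opT : H →ₗ[k] Module.End k (H ⊗[k] H) :=
  liftL k H ∘ₗ ((LinearMap.mul k H).compr₂ (targetMap k H) : H →ₗ[k] Module.End k H)

theorem opT_tmul (h x y : H) : opT k H h (x ⊗ₜ[k] y) = x ⊗ₜ[k] targetMap k H (h * y) := rfl

theorem pairing_opL_opT (D E : H ⊗[k] H) :
    pairing (A := Module.End k (H ⊗[k] H)) (opL k H H) (opT k H) D E =
      (targetMap k H).lTensor H (D * E) := by
  induction D using TensorProduct.induction_on with
  | zero => simp
  | add s t hs ht => simp only [map_add, add_mul, LinearMap.add_apply, hs, ht]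
  | tmul p q =>
    induction E using TensorProduct.induction_on with
    | zero => simp
    | add s t hs ht => simp only [map_add, mul_add, hs, ht]
    | tmul x y => simp [opT_tmul]

theorem lTensor_subtype_opA (h : H) (t : H ⊗[k] targetSpace k H) :
    (targetSpace k H).subtype.lTensor H (opA k H H (targetSpace k H) h t) =
      opT k H h ((targetSpace k H).subtype.lTensor H t) := by
  induction t using TensorProduct.induction_on with
  | zero => simp
  | add s t hs ht => simp only [map_add, hs, ht]
  | tmul x v => simp [opT_tmul, coe_smul_target]

/-- The unit object is a Yetter–Drinfeld module. -/
theorem isYetterDrinfeld_unit : IsYetterDrinfeld (ydTensor k H).unitObj := by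
  have e := lTensor_subtype_unit (k := k) (H := H)
  refine IsYetterDrinfeld.of_injective (V := ⟨targetSpace k H⟩) (ρ := (ydTensor k H).unit)
    (ι := (targetSpace k H).subtype) Subtype.val_injective (aE := opT k H) (fun h t => ?_)
    (fun z => ?_) (fun z => ?_) (fun z => ?_) (fun h z => ?_)
  · exact lTensor_subtype_opA h t
  · have e' : (targetSpace k H).subtype.lTensor H ∘ₗ (ydTensor k H).unit =
      Δ k H ∘ₗ (targetSpace k H).subtype := LinearMap.ext e
    rw [e', LinearMap.lTensor_comp, LinearMap.comp_apply, e]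
    exact coassoc' _
  · rw [e]
    exact counit_left _
  · rw [e, conv_apply]
    refine (pairing_opL_opT _ _).trans ?_
    rw [Δ_one_mul, lTensor_targetMap, Δ_of_target' z.2]
  · have e1 : ∀ D : H ⊗[k] H, pairing (A := Module.End k (H ⊗[k] H)) (conv
        (A := Module.End k (H ⊗[k] H)) (opL k H H) (opT k H)) (opR k H H ∘ₗ S k H) D (Δ k H z) =
        Δ k H 1 * (LinearMap.mul' k H ((S k H).lTensor H (D * ((z : H) ⊗ₜ[k] (1 : H)))) ⊗ₜ[k]
          (1 : H)) := by
      intro D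
      induction D using TensorProduct.induction_on with
      | zero => simp
      | add s t hs ht =>
        simp only [map_add, add_mul, mul_add, LinearMap.add_apply, TensorProduct.add_tmul, hs, ht]
      | tmul p q =>
        have hc : Commute (conv (A := Module.End k (H ⊗[k] H)) (opL k H H) (opT k H) p)
            (opR k H H (S k H q)) := commute_conv
          (fun x y => TensorProduct.ext' fun a b => by simp [mul_assoc])
          (fun x y => TensorProduct.ext' fun a b => by simp [opT_tmul]) p (S k H q)
        rw [pairing_tmul, LinearMap.comp_apply, hc.eq, Module.End.mul_apply, conv_apply]
        have := pairing_opL_opT (Δ k H p) (Δ k H (z : H))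
        rw [← Δ_mul, lTensor_targetMap] at this
        refine (congrArg (opR k H H (S k H q)) this).trans ?_
        induction Δ k H 1 using TensorProduct.induction_on with
        | zero => simp
        | add s t hs ht => simp only [map_add, add_mul, hs, ht]
        | tmul a b => simp [mul_assoc]
    have e2 : LinearMap.mul' k H ((S k H).lTensor H (Δ k H h * ((z : H) ⊗ₜ[k] (1 : H)))) =
        targetMap k H (h * z) := by
      rw [← mul_S, Δ_mul, Δ_coe, ← mul_assoc, Δ_mul_one]
    rw [e, e, ← conv_assoc, conv_apply]
    refine Eq.trans ?_ (e1 (Δ k H h)).symm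
    rw [e2]
    exact Δ_targetMap' _

end Unit

end YDMonoidal

/-! ### The constraints for Yetter–Drinfeld modules -/

section YDClosed
variable {k : Type u} {H : Type v} [Field k] [Ring H] [Algebra k H] [WeakHopfAlgebra k H]
  [Regular k H]

theorem isColinear_mapT {M M' N N' : CoactMod k H} (hM : IsYetterDrinfeld M)
    (hM' : IsYetterDrinfeld M') (hN : IsYetterDrinfeld N) (hN' : IsYetterDrinfeld N')
    (f : M ⟶ M') (g : N ⟶ N') : CoactMod.IsColinear ((ydTensor k H).obj M N)
      ((ydTensor k H).obj M' N') (mapT k f.hom g.hom) := by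
  intro (w : TProd k H M.toHMod.carrier N.toHMod.carrier)
  apply lTensor_inc_injective'
  change inc.lTensor H ((ydTensor k H).tensor M' N' (mapT k f.hom g.hom w)) =
    inc.lTensor H (((mapT k f.hom g.hom).restrictScalars k).lTensor H
      ((ydTensor k H).tensor M N w))
  have e : inc ∘ₗ ((mapT k f.hom g.hom).restrictScalars k) =
      TensorProduct.map (f.hom.restrictScalars k) (g.hom.restrictScalars k) ∘ₗ inc :=
    LinearMap.ext fun w => inc_mapT f.hom g.hom w
  have ef : M'.coact ∘ₗ f.hom.restrictScalars k =
      (f.hom.restrictScalars k).lTensor H ∘ₗ M.coact := LinearMap.ext f.colinear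
  have eg : N'.coact ∘ₗ g.hom.restrictScalars k =
      (g.hom.restrictScalars k).lTensor H ∘ₗ N.coact := LinearMap.ext g.colinear
  rw [lTensor_inc_ydTensor hM' hN', inc_mapT, mulCoact_map, ef, eg, ← lTensor_mulCoact,
    ← lTensor_inc_ydTensor hM hN]
  refine (LinearMap.congr_fun (LinearMap.lTensor_comp H _ inc) _).symm.trans ?_
  rw [← e]
  exact LinearMap.congr_fun (LinearMap.lTensor_comp H inc _) _

section Assoc
variable {M N L : CoactMod k H} (hM : IsYetterDrinfeld M) (hN : IsYetterDrinfeld N)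
  (hL : IsYetterDrinfeld L)
include hM hN hL

theorem lTensor_inc₃_ydTensor (u : TProd k H M.toHMod.carrier
    (TProd k H N.toHMod.carrier L.toHMod.carrier)) :
    inc₃.lTensor H ((ydTensor k H).tensor M ((ydTensor k H).obj N L) u) =
      mulCoact M.coact (mulCoact N.coact L.coact) (inc₃ u) := by
  have e : inc.lTensor H ∘ₗ (ydTensor k H).tensor N L = mulCoact N.coact L.coact ∘ₗ inc :=
    LinearMap.ext (lTensor_inc_ydTensor hN hL)
  rw [inc₃, LinearMap.lTensor_comp, LinearMap.comp_apply]
  refine (congrArg _ (lTensor_inc_ydTensor hM (hN.tensor hL) u)).trans ?_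
  refine (lTensor_mulCoact LinearMap.id inc _).trans ?_
  rw [LinearMap.lTensor_id, LinearMap.id_comp]
  refine Eq.trans ?_ (mulCoact_map LinearMap.id inc (inc u)).symm
  rw [LinearMap.comp_id, ← e]
  rfl

theorem lTensor_inc₃'_ydTensor (u : TProd k H
    (TProd k H M.toHMod.carrier N.toHMod.carrier) L.toHMod.carrier) :
    inc₃'.lTensor H ((ydTensor k H).tensor ((ydTensor k H).obj M N) L u) =
      mulCoact (mulCoact M.coact N.coact) L.coact (inc₃' u) := by
  have e : inc.lTensor H ∘ₗ (ydTensor k H).tensor M N = mulCoact M.coact N.coact ∘ₗ inc :=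
    LinearMap.ext (lTensor_inc_ydTensor hM hN)
  rw [inc₃', LinearMap.lTensor_comp, LinearMap.comp_apply]
  refine (congrArg _ (lTensor_inc_ydTensor (hM.tensor hN) hL u)).trans ?_
  refine (lTensor_mulCoact inc LinearMap.id _).trans ?_
  rw [LinearMap.lTensor_id, LinearMap.id_comp]
  refine Eq.trans ?_ (mulCoact_map inc LinearMap.id (inc u)).symm
  rw [LinearMap.comp_id, ← e]
  rfl

theorem isColinear_assocT : CoactMod.IsColinear
    ((ydTensor k H).obj ((ydTensor k H).obj M N) L)
    ((ydTensor k H).obj M ((ydTensor k H).obj N L))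
    (assocT (k := k) (H := H) (M := M.toHMod.carrier) (N := N.toHMod.carrier)
        (P := L.toHMod.carrier)).toLinearMap := by
  intro (w : TProd k H (TProd k H M.toHMod.carrier N.toHMod.carrier) L.toHMod.carrier)
  have hinj : Function.Injective (inc₃.lTensor H : H ⊗[k] TProd k H M.toHMod.carrier
      (TProd k H N.toHMod.carrier L.toHMod.carrier) →ₗ[k] _) :=
    Module.Flat.lTensor_preserves_injective_linearMap (M := H) _ inc₃_injective
  apply hinj
  refine (lTensor_inc₃_ydTensor hM hN hL _).trans ?_
  have e : inc₃ ∘ₗ (assocT (k := k) (H := H) (M := M.toHMod.carrier) (N := N.toHMod.carrier)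
        (P := L.toHMod.carrier)).toLinearMap.restrictScalars k =
      (TensorProduct.assoc k _ _ _).toLinearMap ∘ₗ inc₃' := LinearMap.ext inc₃_assocT
  refine ((congrArg _ (inc₃_assocT w)).trans (mulCoact_assoc _ _ _ _)).trans ?_
  rw [← lTensor_inc₃'_ydTensor hM hN hL]
  refine (LinearMap.congr_fun (LinearMap.lTensor_comp H _ inc₃') _).symm.trans ?_
  rw [← e]
  exact LinearMap.congr_fun (LinearMap.lTensor_comp H inc₃ _) _

end Assoc

section Units
variable {M : CoactMod k H} (hM : IsYetterDrinfeld M)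
include hM

omit hM [Regular k H] in
theorem lTensor_lmap_mulT (u : H ⊗[k] targetSpace k H) (t : H ⊗[k] M.toHMod.carrier) :
    (lmap k H M.toHMod.carrier).lTensor H (mulT k H _ _ (u ⊗ₜ[k] t)) =
      pairing (A := Module.End k (H ⊗[k] M.toHMod.carrier)) (opL k H _) (opA k H H _)
        ((targetSpace k H).subtype.lTensor H u) t := by
  induction u using TensorProduct.induction_on with
  | zero => simp
  | add s s' hs hs' =>
    simp only [TensorProduct.add_tmul, map_add, hs, hs', LinearMap.add_apply]
  | tmul h z =>
    induction t using TensorProduct.induction_on with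
    | zero => simp
    | add s s' hs hs' => simp only [TensorProduct.tmul_add, map_add, hs, hs']
    | tmul x m => simp

omit hM [Regular k H] in
theorem lTensor_rmap_mulT (u : H ⊗[k] targetSpace k H) (t : H ⊗[k] M.toHMod.carrier) :
    (rmap k H M.toHMod.carrier).lTensor H (mulT k H _ _ (t ⊗ₜ[k] u)) =
      pairing (A := Module.End k (H ⊗[k] M.toHMod.carrier)) (opR k H _) (opA k H H _ ∘ₗ S k H)
        ((targetSpace k H).subtype.lTensor H u) t := by
  induction u using TensorProduct.induction_on with
  | zero => simp
  | add s s' hs hs' =>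
    simp only [TensorProduct.tmul_add, map_add, hs, hs', LinearMap.add_apply]
  | tmul h z =>
    induction t using TensorProduct.induction_on with
    | zero => simp
    | add s s' hs hs' => simp only [TensorProduct.add_tmul, map_add, hs, hs']
    | tmul x m => simp

theorem isColinear_lunitT : CoactMod.IsColinear ((ydTensor k H).obj (ydTensor k H).unitObj M) M
    (lunitT k H M.toHMod.carrier).toLinearMap := by
  intro (w : TProd k H (targetSpace k H) M.toHMod.carrier)
  have e : ∀ t : targetSpace k H ⊗[k] M.toHMod.carrier, M.coact (lmap k H M.toHMod.carrier t) = (lmap k H M.toHMod.carrier).lTensor H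
      (mulCoact (ydTensor k H).unit M.coact t) := by
    intro t
    induction t using TensorProduct.induction_on with
    | zero => simp
    | add s s' hs hs' => simp only [map_add, hs, hs']
    | tmul z m =>
      rw [lmap_tmul, hM.coact_target_smul z.2, mulCoact_tmul, lTensor_lmap_mulT,
        lTensor_subtype_unit, Δ_of_target z.2, pairing_fst_mul commutingActions.L_mul,
        Module.End.mul_apply]
      exact congrArg _ (hM.conv_one m).symm
  refine (e (inc w)).trans ?_
  refine (congrArg _ (lTensor_inc_ydTensor isYetterDrinfeld_unit hM w).symm).trans ?_
  exact (LinearMap.congr_fun (LinearMap.lTensor_comp H (lmap k H M.toHMod.carrier) _) _).symm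

theorem isColinear_runitT : CoactMod.IsColinear ((ydTensor k H).obj M (ydTensor k H).unitObj) M
    (runitT k H M.toHMod.carrier).toLinearMap := by
  intro (w : TProd k H M.toHMod.carrier (targetSpace k H))
  have e : ∀ t : M.toHMod.carrier ⊗[k] targetSpace k H, M.coact (rmap k H M.toHMod.carrier t) = (rmap k H M.toHMod.carrier).lTensor H
      (mulCoact M.coact (ydTensor k H).unit t) := by
    intro t
    induction t using TensorProduct.induction_on with
    | zero => simp
    | add s s' hs hs' => simp only [map_add, hs, hs']
    | tmul m z =>
      rw [rmap_tmul, hM.coact_source_smul (S_mem_sourceSpace z.2), S_S_of_target z.2,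
        mulCoact_tmul, lTensor_rmap_mulT, lTensor_subtype_unit, Δ_of_target' z.2]
      have e1 : pairing (A := Module.End k (H ⊗[k] M.toHMod.carrier)) (opR k H _)
          (opA k H H _ ∘ₗ S k H) (Δ k H 1 * ((z : H) ⊗ₜ[k] (1 : H))) (M.coact m) =
          opR k H _ (z : H) (opR k H _ (pairing (S k H) LinearMap.id
            (TensorProduct.comm k H H (Δ k H 1))) (M.coact m)) := by
        refine Δ_one_induction (p := fun D => pairing (A := Module.End k
          (H ⊗[k] M.toHMod.carrier)) (opR k H _) (opA k H H _ ∘ₗ S k H)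
            (D * ((z : H) ⊗ₜ[k] (1 : H))) (M.coact m) = opR k H _ (z : H) (opR k H _
              (pairing (S k H) LinearMap.id (TensorProduct.comm k H H D)) (M.coact m)))
          (by simp) (fun s t hs ht => by
            simp only [map_add, add_mul, LinearMap.add_apply, hs, ht]) fun y hy x hx => ?_
        rw [Algebra.TensorProduct.tmul_mul_tmul, mul_one, pairing_tmul, Module.End.mul_apply,
          LinearMap.comp_apply, hM.opA_source (S_mem_sourceSpace hx), TensorProduct.comm_tmul,
          pairing_tmul, opR_mul, opR_mul]
        rfl
      rw [e1, S_Δ_one_cop_sum, commutingActions.r_one, Module.End.one_apply]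
  refine (e (inc w)).trans ?_
  refine (congrArg _ (lTensor_inc_ydTensor hM isYetterDrinfeld_unit w).symm).trans ?_
  exact (LinearMap.congr_fun (LinearMap.lTensor_comp H (rmap k H M.toHMod.carrier) _) _).symm

end Units

variable (k H) in
/-- Yetter–Drinfeld modules are closed under the tensor product. -/
theorem ydTensor_closed : (ydTensor k H).Closed IsYetterDrinfeld where
  tensor _ _ hM hN := hM.tensor hN
  unit := isYetterDrinfeld_unit
  map _ _ _ _ hM hM' hN hN' f g := isColinear_mapT hM hM' hN hN' f g
  assoc _ _ _ hM hN hL := isColinear_assocT hM hN hL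
  left_unit _ hM := isColinear_lunitT hM
  right_unit _ hM := isColinear_runitT hM

end YDClosed

/-! ### Tensor products of braided comodules -/

section BraidedTensor
variable {k : Type u} {H : Type v} [Field k] [Ring H] [Algebra k H] [WeakHopfAlgebra k H]

/-- The product of two vectors formed with the braiding `R² • (-)`, `R¹ • (-)`, in terms of the
twist of the first vector. Here `c` is a balanced map `U ⊗ V → W`. -/
theorem CommutingActions.map_braid {U V W : Type*} [AddCommGroup U] [Module k U]
    [AddCommGroup V] [Module k V] [AddCommGroup W] [Module k W]
    {L a r : H →ₗ[k] Module.End k U} (hc : CommutingActions L a r)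
    {L' a' r' : H →ₗ[k] Module.End k V} (hc' : CommutingActions L' a' r') (c : U ⊗[k] V →ₗ[k] W)
    {a₁ r₀ : H →ₗ[k] Module.End k W} (ha : ∀ h u, c (liftR k V (a h) u) = a₁ h (c u))
    (hr : ∀ h u, c (liftL k U (r' h) u) = r₀ h (c u))
    (hb : ∀ h u, c (liftR k V (r h) u) = c (liftL k U (L' h) u)) {R : H ⊗[k] H}
    (hR : IsQuasitriangular R) (s : U) (t : V) :
    c (act₂ a (conv L' (r' ∘ₗ S k H)) R (s ⊗ₜ[k] t)) =
      pairing a₁ (r₀ ∘ₗ S k H) R (c (pairing a r R s ⊗ₜ[k] t)) := by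
  have hlr : ∀ (f : Module.End k U) (g : Module.End k V),
      Commute (liftR k V f) (liftL k U g) := fun f g => TensorProduct.ext' fun u v => by simp
  have hRm : ∀ f g : Module.End k U, liftR k V (f * g) = liftR k V f * liftR k V g :=
    fun f g => LinearMap.rTensor_comp V f g
  have e1 : liftL k U ∘ₗ conv L' (r' ∘ₗ S k H) =
      rconv (E := Module.End k (U ⊗[k] V)) (liftL k U ∘ₗ r' ∘ₗ S k H) (liftL k U ∘ₗ L') := by
    rw [conv_eq_rconv hc'.L_rS]
    refine LinearMap.ext fun x => ?_
    exact liftL_pairing U _ _ _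
  rw [act₂_eq_pairing, e1, hR.pairing_rconv (fun x y => by rw [LinearMap.comp_apply, hc.a_mul, hRm]; rfl)
    (fun x y => hlr _ _), Module.End.mul_apply, comp_pairing c (f' := a₁) (g' := r₀ ∘ₗ S k H) ha
    (fun h u => hr _ u)]
  congr 1
  have e2 : pairing a r R s ⊗ₜ[k] t = pairing (A := Module.End k (U ⊗[k] V)) (liftR k V ∘ₗ a)
      (liftR k V ∘ₗ r) R (s ⊗ₜ[k] t) := by
    rw [← liftR_pairing]; rfl
  rw [e2]
  refine map_pairing_congr (A := Module.End k (U ⊗[k] V))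
    (c ∘ₗ LinearMap.applyₗ (s ⊗ₜ[k] t)) (fun x y => ?_) R
  simp only [LinearMap.comp_apply, LinearMap.applyₗ_apply_apply, Module.End.mul_apply, ha, hb]

variable {X Y : Type*} [AddCommGroup X] [Module k X] [Module H X] [IsScalarTower k H X]
  [AddCommGroup Y] [Module k Y] [Module H Y] [IsScalarTower k H Y] {R : H ⊗[k] H}

/-- The operator `Q` for `X ⊗ Y` is the product of those for `X` and `Y`. -/
theorem pairing_opD (hR : IsQuasitriangular R) :
    pairing (A := Module.End k (H ⊗[k] (X ⊗[k] Y))) (opD k H X Y) (opR k H _ ∘ₗ S k H) R =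
      pairing (A := Module.End k (H ⊗[k] (X ⊗[k] Y))) (liftL k H ∘ₗ liftR k Y ∘ₗ lsm k H X)
          (opR k H _ ∘ₗ S k H) R *
        pairing (A := Module.End k (H ⊗[k] (X ⊗[k] Y))) (liftL k H ∘ₗ liftL k X ∘ₗ lsm k H Y)
          (opR k H _ ∘ₗ S k H) R := by
  rw [opD_eq_conv]
  exact hR.pairing_conv_of_mul (comp_S_mul (E := Module.End k (H ⊗[k] (X ⊗[k] Y))) opR_mul)
    (fun x y => (opR_commute_liftL _ _).symm)

theorem lTensor_inc_untwistOp (t : H ⊗[k] TProd k H X Y) :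
    inc.lTensor H (untwistOp (TProd k H X Y) R t) =
      pairing (A := Module.End k (H ⊗[k] (X ⊗[k] Y))) (opD k H X Y) (opR k H _ ∘ₗ S k H) R
        (inc.lTensor H t) :=
  comp_pairing _ lTensor_inc_opA (fun h => lTensor_opR _ (S k H h)) R t

omit [Module H X] [IsScalarTower k H X] in
theorem mulT_untwistOp (s : H ⊗[k] X) (t : H ⊗[k] Y) :
    mulT k H X Y (s ⊗ₜ[k] untwistOp Y R t) = pairing (A := Module.End k (H ⊗[k] (X ⊗[k] Y)))
      (liftL k H ∘ₗ liftL k X ∘ₗ lsm k H Y) (opR k H _ ∘ₗ S k H) R (mulT k H X Y (s ⊗ₜ[k] t)) := by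
  induction R using TensorProduct.induction_on with
  | zero => simp
  | add s t hs ht => simp only [map_add, LinearMap.add_apply, TensorProduct.tmul_add, hs, ht]
  | tmul p q =>
    refine Eq.trans (mulT_liftL_right _ (s ⊗ₜ[k] opR k H Y (S k H q) t)) ?_
    exact congrArg _ (mulT_opR (S k H q) (s ⊗ₜ[k] t))

variable (X Y R) in
/-- The product `(x ⊗ m) ⊗ (y ⊗ n) ↦ x(R²·y) ⊗ (R¹·m ⊗ n)`. -/
noncomputable def braidedMulT : (H ⊗[k] X) ⊗[k] (H ⊗[k] Y) →ₗ[k] H ⊗[k] (X ⊗[k] Y) :=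
  (LinearMap.mul' k H).rTensor (X ⊗[k] Y) ∘ₗ
    (TensorProduct.assoc k H H (X ⊗[k] Y)).symm.toLinearMap ∘ₗ
    ((TensorProduct.assoc k H X Y).toLinearMap ∘ₗ
      (braid R (lsm k H X) (ad k H)).rTensor Y ∘ₗ
      (TensorProduct.assoc k X H Y).symm.toLinearMap).lTensor H ∘ₗ
    (TensorProduct.assoc k H X (H ⊗[k] Y)).toLinearMap

omit [Module H Y] [IsScalarTower k H Y] in
theorem braidedMulT_eq (u : (H ⊗[k] X) ⊗[k] (H ⊗[k] Y)) : braidedMulT X Y R u =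
    mulT k H X Y (act₂ (opA k H H X) (opAd k H Y) R u) := by
  rw [opAd, ← liftR_ad]
  revert u
  refine LinearMap.congr_fun (f := braidedMulT X Y R) (g := mulT k H X Y ∘ₗ _)
    (tensor_ext₄ fun x m y n => ?_)
  rw [LinearMap.comp_apply]
  induction R using TensorProduct.induction_on with
  | zero => simp [braidedMulT, braid]
  | add s t hs ht =>
    simp only [map_add, LinearMap.add_apply, ← hs, ← ht]
    simp [braidedMulT, braid, TensorProduct.add_tmul, TensorProduct.tmul_add]
  | tmul p q => simp [braidedMulT, braid]

variable [Regular k H] {M N : CoactMod k H}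

theorem braidedMulT_untwist (hR : IsQuasitriangular R) (hM : IsYetterDrinfeld M)
    (u : M.toHMod.carrier ⊗[k] N.toHMod.carrier) :
    braidedMulT _ _ R (TensorProduct.map (untwistOp _ R ∘ₗ M.coact) (untwistOp _ R ∘ₗ N.coact) u) =
      pairing (A := Module.End k (H ⊗[k] (M.toHMod.carrier ⊗[k] N.toHMod.carrier)))
        (opD k H _ _) (opR k H _ ∘ₗ S k H) R (mulCoact M.coact N.coact u) := by
  induction u using TensorProduct.induction_on with
  | zero => simp
  | add s t hs ht => simp only [map_add, hs, ht]
  | tmul m n =>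
    rw [braidedMulT_eq, TensorProduct.map_tmul, pairing_opD hR, Module.End.mul_apply, mulCoact_tmul]
    refine (commutingActions.map_braid commutingActions (mulT k H _ _)
      (a₁ := liftL k H ∘ₗ liftR k N.toHMod.carrier ∘ₗ lsm k H M.toHMod.carrier)
      (fun h s => mulT_liftL_left _ s) mulT_opR mulT_balanced hR _ _).trans ?_
    congr 1
    have e3 : twistOp M.toHMod.carrier R (untwistOp M.toHMod.carrier R (M.coact m)) = M.coact m :=
      commutingActions.yd_untwist_twist hR (hM.conv_a_rS_one m)
    refine (congrArg (fun s => mulT k H _ _ (s ⊗ₜ[k] _)) e3).trans ?_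
    exact mulT_untwistOp _ _

/-- The twist of a tensor product of Yetter–Drinfeld modules is the tensor product of the twists. -/
theorem braidedTensor_obj (hR : IsQuasitriangular R) (hM : IsYetterDrinfeld M)
    (hN : IsYetterDrinfeld N) : (braidedTensor R).obj (toBraided R M) (toBraided R N) =
      toBraided R ((ydTensor k H).obj M N) := by
  rw [toBraided_eq R ((ydTensor k H).obj M N), toBraided_eq R M, toBraided_eq R N]
  refine congrArg (CoactMod.mk _) (LinearMap.ext fun
    (w : TProd k H M.toHMod.carrier N.toHMod.carrier) => ?_)
  apply lTensor_inc_injective'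
  refine Eq.trans ?_ (lTensor_inc_untwistOp _).symm
  refine Eq.trans ?_ (congrArg _ (lTensor_inc_ydTensor hM hN w)).symm
  refine Eq.trans ?_ (braidedMulT_untwist (N := N) hR hM (inc w))
  refine Eq.trans (b := opD k H M.toHMod.carrier N.toHMod.carrier 1 (braidedMulT _ _ R
    (TensorProduct.map (untwistOp _ R ∘ₗ M.coact) (untwistOp _ R ∘ₗ N.coact) (inc w)))) ?_ ?_
  · exact (LinearMap.congr_fun (LinearMap.lTensor_comp H inc prj) _).symm
  · have e := pairing_fst_mul
      (E := Module.End k (H ⊗[k] (M.toHMod.carrier ⊗[k] N.toHMod.carrier)))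
      (g := opR k H (M.toHMod.carrier ⊗[k] N.toHMod.carrier) ∘ₗ S k H) opD_mul (1 : H) R
    rw [← Algebra.TensorProduct.one_def, one_mul] at e
    rw [braidedMulT_untwist hR hM]
    exact (LinearMap.congr_fun e _).symm

/-! ### The unit objects -/

/-- `S(1₁) ⊗ 1₂z = zS(1₁) ⊗ 1₂` -/
theorem rTensor_S_Δ_one_mul {z : H} (hz : z ∈ targetSpace k H) :
    (S k H).rTensor H (Δ k H 1 * ((1 : H) ⊗ₜ[k] z)) =
      (z ⊗ₜ[k] (1 : H)) * (S k H).rTensor H (Δ k H 1) := by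
  rw [← Δ_one_mul_S hz]
  nth_rw 2 [← S_S_of_target hz]
  induction Δ k H 1 using TensorProduct.induction_on with
  | zero => simp
  | add s t hs ht => simp only [map_add, add_mul, mul_add, hs, ht]
  | tmul a b => simp [S_mul_rev]

omit [Regular k H] in
theorem lTensor_subtype_braidedUnit (z : targetSpace k H) :
    (targetSpace k H).subtype.lTensor H ((braidedTensor R).unit z) =
      (S k H).rTensor H (Δ k H 1 * ((1 : H) ⊗ₜ[k] (z : H))) := by
  have e : (braidedTensor R).unit z = (targetSpace k H).subtype.rTensor (targetSpace k H)
      (dact k H _ _ (Δ k H 1) (oneT k H ⊗ₜ[k] z)) := rfl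
  rw [e]
  refine Δ_one_induction (p := fun D => (targetSpace k H).subtype.lTensor H
    ((targetSpace k H).subtype.rTensor (targetSpace k H) (dact k H _ _ D (oneT k H ⊗ₜ[k] z))) =
      (S k H).rTensor H (D * ((1 : H) ⊗ₜ[k] (z : H)))) (by simp)
    (fun s t hs ht => by simp only [map_add, add_mul, LinearMap.add_apply, hs, ht])
    fun y hy w hw => ?_
  have h1 : targetMap k H (w * z) = w * z := by
    rw [targetMap_mul_of_mem hw, targetMap_coe]
  simp [coe_smul_target, oneT, targetMap_of_source hy, h1]

omit [Regular k H] in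
theorem untwist_Δ_target (hR : IsQuasitriangular R) {z : H} (hz : z ∈ targetSpace k H) :
    pairing (A := Module.End k (H ⊗[k] H)) (opT k H) (opR k H H ∘ₗ S k H) R (Δ k H z) =
      (z ⊗ₜ[k] (1 : H)) * (S k H).rTensor H (Δ k H 1) := by
  rw [Δ_of_target hz]
  have e1 : ∀ (y w : H) (Q : H ⊗[k] H), pairing (A := Module.End k (H ⊗[k] H)) (opT k H)
      (opR k H H ∘ₗ S k H) Q ((z * y) ⊗ₜ[k] w) = ((z * y) ⊗ₜ[k] (1 : H)) *
        TensorProduct.comm k H H ((S k H).lTensor H ((targetMap k H).rTensor H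
          (Q * (w ⊗ₜ[k] (1 : H))))) := by
    intro y w Q
    induction Q using TensorProduct.induction_on with
    | zero => simp
    | add s t hs ht => simp only [map_add, add_mul, mul_add, LinearMap.add_apply, hs, ht]
    | tmul p q => simp [opT_tmul]
  have e2 : ∀ (w : H) (Q : H ⊗[k] H), (targetMap k H).rTensor H (((1 : H) ⊗ₜ[k] w) * Q) =
      ((1 : H) ⊗ₜ[k] w) * (targetMap k H).rTensor H Q := by
    intro w Q
    induction Q using TensorProduct.induction_on with
    | zero => simp
    | add s t hs ht => simp only [map_add, mul_add, hs, ht]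
    | tmul p q => simp
  have e3 : pairing (A := Module.End k (H ⊗[k] H)) (opT k H) (opR k H H ∘ₗ S k H) R
      ((z ⊗ₜ[k] (1 : H)) * Δ k H 1) = (z ⊗ₜ[k] (1 : H)) * (S k H).rTensor H (Δ k H 1) *
        (pairing LinearMap.id (S k H) (Δ k H 1) ⊗ₜ[k] (1 : H)) := by
    refine Δ_one_induction (p := fun D => pairing (A := Module.End k (H ⊗[k] H)) (opT k H)
      (opR k H H ∘ₗ S k H) R ((z ⊗ₜ[k] (1 : H)) * D) =
        (z ⊗ₜ[k] (1 : H)) * (S k H).rTensor H (Δ k H 1) *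
          (pairing LinearMap.id (S k H) D ⊗ₜ[k] (1 : H))) (by simp)
      (fun s t hs ht => by simp only [map_add, mul_add, TensorProduct.add_tmul, hs, ht])
      fun y hy w hw => ?_
    rw [Algebra.TensorProduct.tmul_mul_tmul, one_mul, e1, ← hR.snd_mul_of_target hw, e2,
      hR.rTensor_targetMap]
    refine Δ_one_induction (p := fun E => ((z * y) ⊗ₜ[k] (1 : H)) * TensorProduct.comm k H H
      ((S k H).lTensor H (((1 : H) ⊗ₜ[k] w) * TensorProduct.comm k H H E)) =
        (z ⊗ₜ[k] (1 : H)) * (S k H).rTensor H E *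
          (pairing LinearMap.id (S k H) (y ⊗ₜ[k] w) ⊗ₜ[k] (1 : H))) (by simp)
      (fun s t hs ht => by simp only [map_add, mul_add, add_mul, hs, ht]) fun y' hy' w' hw' => ?_
    have := (targetSpace_comm_sourceSpace (S_mem_targetSpace hy') hy).eq
    simp only [TensorProduct.comm_tmul, Algebra.TensorProduct.tmul_mul_tmul, one_mul, mul_one,
      LinearMap.lTensor_tmul, LinearMap.rTensor_tmul, pairing_tmul, LinearMap.id_apply, S_mul_rev,
      mul_assoc]
    rw [← mul_assoc y, ← this, mul_assoc]
  rw [e3, Δ_one_mul_S_sum, ← Algebra.TensorProduct.one_def, mul_one]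

theorem braidedTensor_unitObj (hR : IsQuasitriangular R) :
    (braidedTensor R).unitObj = toBraided R (ydTensor k H).unitObj := by
  rw [toBraided_eq]
  refine congrArg (CoactMod.mk _) (LinearMap.ext fun (z : targetSpace k H) => ?_)
  apply Module.Flat.lTensor_preserves_injective_linearMap (M := H) (targetSpace k H).subtype
    Subtype.val_injective
  refine (lTensor_subtype_braidedUnit z).trans ?_
  rw [rTensor_S_Δ_one_mul z.2, ← untwist_Δ_target hR z.2, ← lTensor_subtype_unit]
  exact (comp_pairing ((targetSpace k H).subtype.lTensor H) lTensor_subtype_opA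
    (fun h t => lTensor_opR _ (S k H h) t) R _).symm

end BraidedTensor

/-! ### The monoidal equivalence -/

/-- The monoidal structure on the inverse of a monoidal functor, which is defined through the
adjunction, makes the equivalence monoidal. -/
theorem isMonoidal_inverseMonoidal {C D : Type*} [Category* C] [Category* D] [MonoidalCategory C]
    [MonoidalCategory D] (e : C ≌ D) [e.functor.Monoidal] :
    let := e.inverseMonoidal
    e.IsMonoidal := by
  let := e.toAdjunction.rightAdjointLaxMonoidal
  have : e.toAdjunction.IsMonoidal := inferInstance
  exact this

section Equivalence
variable {k : Type u} {H : Type v} [Field k] [Ring H] [Algebra k H] [WeakHopfAlgebra k H]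

omit [WeakHopfAlgebra k H] in
/-- Colinearity is transported along equalities of coactions. -/
theorem isColinear_congr {X Y : HMod k H} {ρ ρ' : X.carrier →ₗ[k] H ⊗[k] X.carrier}
    {σ σ' : Y.carrier →ₗ[k] H ⊗[k] Y.carrier} (hρ : CoactMod.mk X ρ = ⟨X, ρ'⟩)
    (hσ : CoactMod.mk Y σ = ⟨Y, σ'⟩) {f : X.carrier →ₗ[H] Y.carrier}
    (h : CoactMod.IsColinear ⟨X, ρ⟩ ⟨Y, σ⟩ f) : CoactMod.IsColinear ⟨X, ρ'⟩ ⟨Y, σ'⟩ f := by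
  cases hρ
  cases hσ
  exact h

variable [Regular k H] {R : H ⊗[k] H} (hR : IsQuasitriangular R)
include hR

/-- The tensor product of braided comodules is obtained from that of Yetter–Drinfeld modules by
transport along the twist. -/
theorem braidedTensor_obj_eq {M N : CoactMod k H} (hM : IsBraidedComodule R M)
    (hN : IsBraidedComodule R N) :
    (braidedTensor R).obj M N = toBraided R ((ydTensor k H).obj (toYD R M) (toYD R N)) :=
  (congrArg₂ (braidedTensor R).obj (hM.untwist_twist hR).symm (hN.untwist_twist hR).symm).trans
    (braidedTensor_obj hR (hM.isYetterDrinfeld hR) (hN.isYetterDrinfeld hR))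

theorem braidedTensor_closed : (braidedTensor R).Closed (IsBraidedComodule R) where
  tensor M N hM hN := by
    rw [braidedTensor_obj_eq hR hM hN]
    exact ((hM.isYetterDrinfeld hR).tensor (hN.isYetterDrinfeld hR)).isBraidedComodule hR
  unit := by
    rw [braidedTensor_unitObj hR]
    exact isYetterDrinfeld_unit.isBraidedComodule hR
  map M M' N N' hM hM' hN hN' f g := by
    have h := (ydTensor_closed k H).map _ _ _ _ (hM.isYetterDrinfeld hR) (hM'.isYetterDrinfeld hR)
      (hN.isYetterDrinfeld hR) (hN'.isYetterDrinfeld hR) ⟨f.hom, twist_colinear R _ f⟩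
      ⟨g.hom, twist_colinear R _ g⟩
    exact isColinear_congr (braidedTensor_obj_eq hR hM hN).symm
      (braidedTensor_obj_eq hR hM' hN').symm (twist_colinear R (rmul k H ∘ₗ S k H) ⟨_, h⟩)
  assoc M N L hM hN hL := by
    have hM' := hM.isYetterDrinfeld hR
    have hN' := hN.isYetterDrinfeld hR
    have hL' := hL.isYetterDrinfeld hR
    have e1 : (braidedTensor R).obj ((braidedTensor R).obj M N) L = toBraided R
        ((ydTensor k H).obj ((ydTensor k H).obj (toYD R M) (toYD R N)) (toYD R L)) :=
      (congrArg₂ (braidedTensor R).obj (braidedTensor_obj_eq hR hM hN)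
        (hL.untwist_twist hR).symm).trans (braidedTensor_obj hR (hM'.tensor hN') hL')
    have e2 : (braidedTensor R).obj M ((braidedTensor R).obj N L) = toBraided R
        ((ydTensor k H).obj (toYD R M) ((ydTensor k H).obj (toYD R N) (toYD R L))) :=
      (congrArg₂ (braidedTensor R).obj (hM.untwist_twist hR).symm
        (braidedTensor_obj_eq hR hN hL)).trans (braidedTensor_obj hR hM' (hN'.tensor hL'))
    exact isColinear_congr e1.symm e2.symm (twist_colinear R (rmul k H ∘ₗ S k H)
      ⟨_, (ydTensor_closed k H).assoc _ _ _ hM' hN' hL'⟩)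
  left_unit M hM := by
    have hM' := hM.isYetterDrinfeld hR
    have e : (braidedTensor R).obj (braidedTensor R).unitObj M = toBraided R
        ((ydTensor k H).obj (ydTensor k H).unitObj (toYD R M)) :=
      (congrArg₂ (braidedTensor R).obj (braidedTensor_unitObj hR)
        (hM.untwist_twist hR).symm).trans (braidedTensor_obj hR isYetterDrinfeld_unit hM')
    exact isColinear_congr e.symm (hM.untwist_twist hR) (twist_colinear R (rmul k H ∘ₗ S k H)
      ⟨_, (ydTensor_closed k H).left_unit _ hM'⟩)
  right_unit M hM := by
    have hM' := hM.isYetterDrinfeld hR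
    have e : (braidedTensor R).obj M (braidedTensor R).unitObj = toBraided R
        ((ydTensor k H).obj (toYD R M) (ydTensor k H).unitObj) :=
      (congrArg₂ (braidedTensor R).obj (hM.untwist_twist hR).symm
        (braidedTensor_unitObj hR)).trans (braidedTensor_obj hR hM' isYetterDrinfeld_unit)
    exact isColinear_congr e.symm (hM.untwist_twist hR) (twist_colinear R (rmul k H ∘ₗ S k H)
      ⟨_, (ydTensor_closed k H).right_unit _ hM'⟩)

theorem IsBraidedComodule.isColinear_untwist_twist {M : CoactMod k H}
    (hM : IsBraidedComodule R M) :
    CoactMod.IsColinear M (toBraided R (toYD R M)) (LinearMap.id : M.toHMod.carrier →ₗ[H] _) :=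
  isColinear_congr rfl (hM.untwist_twist hR).symm (CoactTensor.id_colinear M)

theorem IsYetterDrinfeld.isColinear_twist_untwist {N : CoactMod k H} (hN : IsYetterDrinfeld N) :
    CoactMod.IsColinear (toYD R (toBraided R N)) N (LinearMap.id : N.toHMod.carrier →ₗ[H] _) :=
  isColinear_congr (hN.twist_untwist hR).symm rfl (CoactTensor.id_colinear N)

/-- The functors between braided comodules and Yetter–Drinfeld modules form an equivalence, whose
unit and counit are the identity on underlying modules. -/
noncomputable def twistEquivalence : BraidedComodCat R ≌ YDCat k H where
  functor := functorF R fun _ hM => hM.isYetterDrinfeld hR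
  inverse := functorG R fun _ hN => hN.isBraidedComodule hR
  unitIso := NatIso.ofComponents (fun M => CoactTensor.mkIso
    (N := ⟨toBraided R (toYD R M.obj), (M.property.isYetterDrinfeld hR).isBraidedComodule hR⟩)
    (LinearEquiv.refl H M.obj.toHMod.carrier) (M.property.isColinear_untwist_twist hR))
    fun _ => rfl
  counitIso := NatIso.ofComponents (fun N => CoactTensor.mkIso
    (M := ⟨toYD R (toBraided R N.obj), (N.property.isBraidedComodule hR).isYetterDrinfeld hR⟩)
    (LinearEquiv.refl H N.obj.toHMod.carrier) (N.property.isColinear_twist_untwist hR))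
    fun _ => rfl
  functor_unitIso_comp _ := rfl

/-- The coaction of a tensor product of braided comodules, twisted to a coaction over `H`. -/
theorem toYD_braidedTensor_obj {M N : CoactMod k H} (hM : IsBraidedComodule R M)
    (hN : IsBraidedComodule R N) :
    toYD R ((braidedTensor R).obj M N) = (ydTensor k H).obj (toYD R M) (toYD R N) := by
  rw [braidedTensor_obj_eq hR hM hN]
  exact ((hM.isYetterDrinfeld hR).tensor (hN.isYetterDrinfeld hR)).twist_untwist hR

theorem toYD_braidedTensor_unitObj :
    toYD R (braidedTensor R).unitObj = (ydTensor k H).unitObj := by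
  rw [braidedTensor_unitObj hR]
  exact isYetterDrinfeld_unit.twist_untwist hR

theorem isColinear_tensorator {M N : CoactMod k H} (hM : IsBraidedComodule R M)
    (hN : IsBraidedComodule R N) : CoactMod.IsColinear
      ((ydTensor k H).obj (toYD R M) (toYD R N)) (toYD R ((braidedTensor R).obj M N))
      (LinearMap.id : TProd k H M.toHMod.carrier N.toHMod.carrier →ₗ[H] _) :=
  isColinear_congr rfl (toYD_braidedTensor_obj hR hM hN).symm (CoactTensor.id_colinear _)

theorem isColinear_unitComparison : CoactMod.IsColinear (ydTensor k H).unitObj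
    (toYD R (braidedTensor R).unitObj) (LinearMap.id : targetSpace k H →ₗ[H] _) :=
  isColinear_congr rfl (toYD_braidedTensor_unitObj hR).symm (CoactTensor.id_colinear _)

/-- The functor to Yetter–Drinfeld modules is strictly compatible with the tensor products: its
structure maps are the identity on underlying modules. -/
noncomputable def twistCoreMonoidal (hC : (braidedTensor R).Closed (IsBraidedComodule R))
    (hY : (ydTensor k H).Closed IsYetterDrinfeld) :
    letI : MonoidalCategory (BraidedComodCat R) := hC.monoidal
    letI : MonoidalCategory (YDCat k H) := hY.monoidal
    (twistEquivalence hR).functor.CoreMonoidal :=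
  letI : MonoidalCategory (BraidedComodCat R) := hC.monoidal
  letI : MonoidalCategory (YDCat k H) := hY.monoidal
  { εIso := CoactTensor.mkIso (M := ⟨(ydTensor k H).unitObj, hY.unit⟩)
      (N := ⟨toYD R (braidedTensor R).unitObj, hC.unit.isYetterDrinfeld hR⟩)
      (LinearEquiv.refl H (targetSpace k H)) (isColinear_unitComparison hR)
    μIso := fun M N => CoactTensor.mkIso
      (M := ⟨(ydTensor k H).obj (toYD R M.obj) (toYD R N.obj), hY.tensor _ _
        (M.property.isYetterDrinfeld hR) (N.property.isYetterDrinfeld hR)⟩)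
      (N := ⟨toYD R ((braidedTensor R).obj M.obj N.obj),
        (hC.tensor _ _ M.property N.property).isYetterDrinfeld hR⟩)
      (LinearEquiv.refl H (TProd k H M.obj.toHMod.carrier N.obj.toHMod.carrier))
      (isColinear_tensorator hR M.property N.property)
    μIso_hom_natural_left := fun _ _ => rfl
    μIso_hom_natural_right := fun _ _ => rfl
    associativity := fun _ _ _ => ObjectProperty.hom_ext _ (CoactMod.Hom.ext
      (LinearMap.ext fun w => (congrArg assocT (mapT_id w)).trans (mapT_id (assocT w)).symm))
    left_unitality := fun X => ObjectProperty.hom_ext _ (CoactMod.Hom.ext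
      (LinearMap.ext fun w => (congrArg (lunitT k H X.obj.toHMod.carrier) (mapT_id w)).symm))
    right_unitality := fun X => ObjectProperty.hom_ext _ (CoactMod.Hom.ext
      (LinearMap.ext fun w => (congrArg (runitT k H X.obj.toHMod.carrier) (mapT_id w)).symm)) }

end Equivalence
end WeakHopf

theorem theorem2p5 {k : Type u} {H : Type v} [Field k] [Ring H] [Algebra k H]
    [WeakHopfAlgebra k H] [Regular k H] (R : H ⊗[k] H) (hR : IsQuasitriangular R) :
    ∃ (hC : (braidedTensor R).Closed (IsBraidedComodule R))
      (hY : (ydTensor k H).Closed IsYetterDrinfeld)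
      (hF : ∀ M : CoactMod k H, IsBraidedComodule R M → IsYetterDrinfeld (toYD R M))
      (hG : ∀ N : CoactMod k H, IsYetterDrinfeld N → IsBraidedComodule R (toBraided R N)),
      letI : MonoidalCategory (BraidedComodCat R) := hC.monoidal
      letI : MonoidalCategory (YDCat k H) := hY.monoidal
      ∃ (e : BraidedComodCat R ≌ YDCat k H) (_ : e.functor.Monoidal) (_ : e.inverse.Monoidal),
        e.IsMonoidal ∧ e.functor = functorF R hF ∧ e.inverse = functorG R hG := by
  refine ⟨braidedTensor_closed hR, ydTensor_closed k H, fun _ hM => hM.isYetterDrinfeld hR,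
    fun _ hN => hN.isBraidedComodule hR, ?_⟩
  let : MonoidalCategory (BraidedComodCat R) := (braidedTensor_closed hR).monoidal
  let : MonoidalCategory (YDCat k H) := (ydTensor_closed k H).monoidal
  let := (twistCoreMonoidal hR (braidedTensor_closed hR) (ydTensor_closed k H)).toMonoidal
  let := (twistEquivalence hR).inverseMonoidal
  refine ⟨twistEquivalence hR, inferInstance, inferInstance, ?_, rfl, rfl⟩
  exact isMonoidal_inverseMonoidal _
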